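/- Let $d\ge 0$ and $N\ge 1$ be integers and let $p((x,k),(y,j))=p_{k,j}(x,y)\in[0,\infty)$ be a transition kernel on $\mathbb Z^d\times\{1,\dots,N\}$ (not assumed sub-Markov) which is $\mathbb Z^d$-invariant, i.e. $p_{k,j}(x,y)=p_{k,j}(0,y-x)$. Let $p^{(n)}$ be its $n$-th convolution power (a sum over $n$-step paths, with values in $[0,\infty]$), and assume that $p$ is strongly irreducible: for all $x,y,k,j$ there is $n_0$ such that $p^{(n)}_{k,j}(x,y)>0$ for every $n\ge n_0$. For $u\in\mathbb R^d$ let $F(u)$ be the $N\times N$ matrix with entries $F_{k,j}(u)=\sum_{x\in\mathbb Z^d}p_{k,j}(0,x)e^{u\cdot x}$, let $\mathcal F$ be the interior of the set of $u$ for which all entries of $F(u)$ are finite, let $\lambda(u)$ be the dominant eigenvalue of $F(u)$ (a simple eigenvalue whose modulus is strictly larger than that of every other eigenvalue), and let $H=\{u\in\mathcal F:\lambda(u)=1\}$. Let $C(u)$ (column) and $\nu(u)$ (row) be the right and left eigenvectors of $F(u)$ for $\lambda(u)$ with positive coordinates, normalized by $\nu(0)\cdot C(u)=1$ and $\nu(u)\cdot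 C(u)=1$, where $\sum_j\nu(0)_j=1$ (if $F(0)$ is not finite, $\nu(0)$ is replaced by the vector with all coordinates $1/N$; the product $C(u)\nu(u)$, an $N\times N$ matrix, does not depend on this normalizing vector). For $u\in H$ and $\xi\in\mathbb R^d$ let $\chi_u(\xi)$ be the matrix with entries $e^{-i\nabla\lambda(u)\cdot\xi}\sum_{x}p_{k,j}(0,x)e^{u\cdot x}e^{ix\cdot\xi}$, and let $\lambda_u(\xi)$ be its dominant eigenvalue, for $\xi$ close to $0$. Let $Q_u=-\nabla^2_\xi\lambda_u(0)$, a quadratic form on $\mathbb R^d$, let $|Q_u|$ be the determinant of its symmetric matrix, and let $\Sigma_u$ be the quadratic form of the inverse matrix. Let $P^{(n)}_u(0,x)$ be the matrix with entries $p^{(n)}_{k,j}(0,x)e^{u\cdot x}$. Let $\gamma_0\ge 0$, and for $n\geq 1$, $u\in H$, $x\in\mathbb Z^d$, $\gamma\in[0,\gamma_0]$ put $$A_n(x,u)=(2\pi n)^{d/2}P_u^{(n)}(0,x)-|Q_u|^{-1/2}e^{-\frac1{2n}\Sigma_u(x-n\nabla\lambda(u))}\,C(u)\nu(u),$$ $$\tilde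 A_n(x,u,\gamma)=\Big(\frac{\|x-n\nabla\lambda(u)\|}{\sqrt n}\Big)^{\gamma}A_n(x,u),$$ with the Euclidean norm and the convention $0^0=1$. Then these objects are well defined: the dominant eigenvalue $\lambda(u)$ exists and is real for every $u\in\mathcal F$; and for every $u\in H$, $\lambda$ is differentiable at $u$, the vectors $C(u)$ and $\nu(u)$ exist, $\lambda_u(\xi)$ exists for $\xi$ close to $0$ and is of class $C^2$ at $0$, and $Q_u$ is real and positive definite. Moreover, for every $x\in\mathbb Z^d$, $u\in H$ and $\gamma\in[0,\gamma_0]$, the matrix $\tilde A_n(x,u,\gamma)$ converges to $0$ as $n\to\infty$, and for every compact $K\subset H$ the convergence is uniform in $x\in\mathbb Z^d$, $u\in K$ and $\gamma\in[0,\gamma_0]$. -/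

import Mathlib

open Filter Topology
open scoped NNReal ENNReal

noncomputable section

namespace ThickenedLattice

/-- The state space `ℤ^d × {1, …, N}`. -/
abbrev State (d N : ℕ) : Type := (Fin d → ℤ) × Fin N

/-- A transition kernel with finite non-negative weights (no bound on the total mass). -/
abbrev TransitionKernel (d N : ℕ) : Type := State d N → State d N → ℝ≥0

/-- A lattice point seen as a vector of the Euclidean space `ℝ^d`. -/
def toVec {d : ℕ} (x : Fin d → ℤ) : EuclideanSpace ℝ (Fin d) :=
  WithLp.toLp 2 (fun i => (x i : ℝ))

section Matrices

variable {N : ℕ}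

/-- `μ` is a dominant eigenvalue of `A`: a simple eigenvalue (simple root of the characteristic
polynomial), and every other complex eigenvalue has strictly smaller modulus. -/
def IsDominantEigenvalue (A : Matrix (Fin N) (Fin N) ℂ) (μ : ℂ) : Prop :=
  A.charpoly.rootMultiplicity μ = 1 ∧ ∀ z : ℂ, A.charpoly.IsRoot z → z ≠ μ → ‖z‖ < ‖μ‖

open Classical in
/-- The dominant eigenvalue of `A` (unique when it exists; `0` when there is none). -/
def dominantEigenvalue (A : Matrix (Fin N) (Fin N) ℂ) : ℂ :=
  if h : ∃ μ : ℂ, IsDominantEigenvalue A μ then h.choose else 0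

open Classical in
/-- The right eigenvector `v` of `A` for the eigenvalue `r` that has positive coordinates and
satisfies `w · v = 1` (`0` when there is none). -/
def posRightEigenvector (A : Matrix (Fin N) (Fin N) ℝ) (r : ℝ) (w : Fin N → ℝ) : Fin N → ℝ :=
  if h : ∃ v : Fin N → ℝ, (∀ k, 0 < v k) ∧ A.mulVec v = r • v ∧ w ⬝ᵥ v = 1 then h.choose else 0

open Classical in
/-- The left eigenvector `v` of `A` for the eigenvalue `r` that has positive coordinates and
satisfies `v · w = 1` (`0` when there is none). -/
def posLeftEigenvector (A : Matrix (Fin N) (Fin N) ℝ) (r : ℝ) (w : Fin N → ℝ) : Fin N → ℝ :=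
  if h : ∃ v : Fin N → ℝ, (∀ k, 0 < v k) ∧ Matrix.vecMul v A = r • v ∧ v ⬝ᵥ w = 1
  then h.choose else 0

end Matrices

section Kernels

variable {d N : ℕ}

/-- Invariance under the translations of `ℤ^d`. -/
def IsLatticeInvariant (p : TransitionKernel d N) : Prop :=
  ∀ (x y : Fin d → ℤ) (k j : Fin N), p (x, k) (y, j) = p (0, k) (y - x, j)

/-- The `n`-th convolution power `p^{(n)}`, a sum over paths with values in `[0, ∞]`. -/
def convPow (p : TransitionKernel d N) : ℕ → State d N → State d N → ℝ≥0∞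
  | 0, a, b => if a = b then 1 else 0
  | n + 1, a, b => ∑' c : State d N, (p a c : ℝ≥0∞) * convPow p n c b

/-- Strong irreducibility: every point is reached from every point in exactly `n` steps, for all
large enough `n`. -/
def IsStronglyIrreducible (p : TransitionKernel d N) : Prop :=
  ∀ (k j : Fin N) (x y : Fin d → ℤ), ∃ n₀ : ℕ, ∀ n ≥ n₀, 0 < convPow p n (x, k) (y, j)

/-- The entries of `F(u)` are all finite. -/
def FiniteAt (p : TransitionKernel d N) (u : EuclideanSpace ℝ (Fin d)) : Prop :=
  ∀ k j : Fin N, Summable fun x : Fin d → ℤ =>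
    (p (0, k) (x, j) : ℝ) * Real.exp (inner ℝ u (toVec x))

/-- The matrix `F(u)`, with entries `∑_x p_{k,j}(0,x) e^{u·x}`. -/
def F (p : TransitionKernel d N) (u : EuclideanSpace ℝ (Fin d)) : Matrix (Fin N) (Fin N) ℝ :=
  Matrix.of fun k j => ∑' x : Fin d → ℤ,
    (p (0, k) (x, j) : ℝ) * Real.exp (inner ℝ u (toVec x))

/-- The set `𝓕`: the interior of the set of `u` such that `F(u)` is finite. -/
def finiteDomain (p : TransitionKernel d N) : Set (EuclideanSpace ℝ (Fin d)) :=
  interior {u | FiniteAt p u}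

/-- `λ(u)`, the dominant eigenvalue of the non-negative matrix `F(u)` (a real number). -/
def lam (p : TransitionKernel d N) (u : EuclideanSpace ℝ (Fin d)) : ℝ :=
  (dominantEigenvalue ((F p u).map (fun a : ℝ => (a : ℂ)))).re

/-- The level set `H = {u ∈ 𝓕 : λ(u) = 1}`. -/
def levelSet (p : TransitionKernel d N) : Set (EuclideanSpace ℝ (Fin d)) :=
  {u | u ∈ finiteDomain p ∧ lam p u = 1}

open Classical in
/-- The row vector that normalizes the right eigenvectors: `ν(0)`, the positive left eigenvector of
`F(0)` with coordinates of sum `1`. If `F(0)` is not finite, so that `ν(0)` does not exist, the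
uniform vector takes its place; the projector `C(u)ν(u)` does not depend on this vector. -/
def nuZero (p : TransitionKernel d N) : Fin N → ℝ :=
  if FiniteAt p 0 then posLeftEigenvector (F p 0) (lam p 0) (fun _ => 1)
  else fun _ => (N : ℝ)⁻¹

/-- `C(u)`, the positive right eigenvector of `F(u)` for `λ(u)` with `ν(0) · C(u) = 1`. -/
def rightVec (p : TransitionKernel d N) (u : EuclideanSpace ℝ (Fin d)) : Fin N → ℝ :=
  posRightEigenvector (F p u) (lam p u) (nuZero p)

/-- `ν(u)`, the positive left eigenvector of `F(u)` for `λ(u)` with `ν(u) · C(u) = 1`. -/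
def leftVec (p : TransitionKernel d N) (u : EuclideanSpace ℝ (Fin d)) : Fin N → ℝ :=
  posLeftEigenvector (F p u) (lam p u) (rightVec p u)

/-- The characteristic matrix `ψ_u(ξ)`, with entries `∑_x p_{k,j}(0,x) e^{u·x} e^{i x·ξ}`. -/
def psi (p : TransitionKernel d N) (u ξ : EuclideanSpace ℝ (Fin d)) :
    Matrix (Fin N) (Fin N) ℂ :=
  Matrix.of fun k j => ∑' x : Fin d → ℤ,
    (((p (0, k) (x, j) : ℝ) * Real.exp (inner ℝ u (toVec x)) : ℝ) : ℂ) *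
      Complex.exp (Complex.I * ((inner ℝ (toVec x) ξ : ℝ) : ℂ))

/-- The centered characteristic matrix `χ_u(ξ) = e^{-i ∇λ(u)·ξ} ψ_u(ξ)`. -/
def chi (p : TransitionKernel d N) (u ξ : EuclideanSpace ℝ (Fin d)) :
    Matrix (Fin N) (Fin N) ℂ :=
  Complex.exp (-Complex.I * ((inner ℝ (gradient (lam p) u) ξ : ℝ) : ℂ)) • psi p u ξ

/-- `λ_u(ξ)`, the dominant eigenvalue of `χ_u(ξ)` (it exists for `ξ` close to `0`). -/
def charLam (p : TransitionKernel d N) (u ξ : EuclideanSpace ℝ (Fin d)) : ℂ :=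
  dominantEigenvalue (chi p u ξ)

/-- The bilinear form of the Hessian of `ξ ↦ λ_u(ξ)` at `0`, on basis vectors. -/
def charHess (p : TransitionKernel d N) (u : EuclideanSpace ℝ (Fin d)) (i j : Fin d) : ℂ :=
  iteratedFDeriv ℝ 2 (charLam p u) 0 ![EuclideanSpace.single i 1, EuclideanSpace.single j 1]

/-- The symmetric matrix of the quadratic form `Q_u = -∇_ξ² λ_u(0)`. This Hessian is real for
`u ∈ H`. -/
def Q (p : TransitionKernel d N) (u : EuclideanSpace ℝ (Fin d)) : Matrix (Fin d) (Fin d) ℝ :=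
  Matrix.of fun i j => -(charHess p u i j).re

/-- The quadratic form `Σ_u`, whose matrix is the inverse of that of `Q_u`. -/
def Sig (p : TransitionKernel d N) (u y : EuclideanSpace ℝ (Fin d)) : ℝ :=
  y.ofLp ⬝ᵥ ((Q p u)⁻¹).mulVec y.ofLp

/-- `P_u^{(n)}(0,x)`, the matrix with entries `p^{(n)}_{k,j}(0,x) e^{u·x}`. -/
def P (p : TransitionKernel d N) (n : ℕ) (u : EuclideanSpace ℝ (Fin d)) (x : Fin d → ℤ) :
    Matrix (Fin N) (Fin N) ℝ :=
  Matrix.of fun k j => (convPow p n (0, k) (x, j)).toReal * Real.exp (inner ℝ u (toVec x))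

/-- The error matrix
`A_n(x,u) = (2πn)^{d/2} P_u^{(n)}(0,x) - |Q_u|^{-1/2} e^{-Σ_u(x - n∇λ(u))/(2n)} C(u)ν(u)`. -/
def A (p : TransitionKernel d N) (n : ℕ) (x : Fin d → ℤ) (u : EuclideanSpace ℝ (Fin d)) :
    Matrix (Fin N) (Fin N) ℝ :=
  (2 * Real.pi * n) ^ ((d : ℝ) / 2) • P p n u x -
    ((Q p u).det ^ (-(1 / 2) : ℝ) *
      Real.exp (-(1 / (2 * (n : ℝ))) * Sig p u (toVec x - (n : ℝ) • gradient (lam p) u))) •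
      Matrix.vecMulVec (rightVec p u) (leftVec p u)

/-- The weighted error `Ã_n(x,u,γ) = (‖x - n∇λ(u)‖ / √n)^γ A_n(x,u)` (Euclidean norm). -/
def Atilde (p : TransitionKernel d N) (n : ℕ) (x : Fin d → ℤ) (u : EuclideanSpace ℝ (Fin d))
    (γ : ℝ) : Matrix (Fin N) (Fin N) ℝ :=
  (‖toVec x - (n : ℝ) • gradient (lam p) u‖ / Real.sqrt n) ^ γ • A p n x u

end Kernels

end ThickenedLattice

end

open ThickenedLattice

/-! The proof is the Fourier method, carried out uniformly in `u`, followed by a change of drift for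
the weight.

On the tube of points `z` with real part in the finite domain, the entries of `F(z)^n` are the
exponential sums of the `n`-step weights (`hasSum_convPow_cexp`), so these weights are recovered by
integrating over the box `(-π, π]^d` (`integral_box_Fc_pow`). With `ξ = s/√n` and the phase of
`chi`, this reads (`integral_rescaled`): up to the factor `(2π)^{d/2}`, the first term of `A` is the
Fourier transform of `s ↦ χ_u(s/√n)^n`, cut off to the rescaled box, at the normalized displacement
`y = (x - n∇λ(u))/√n`. The second term is the Fourier transform of a Gaussian at the same `y`
(`integral_cexp_quadraticForm`). Hence `A` is bounded by the `L¹` distance of the two integrands, a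
quantity free of `x` (`abs_A_le`), and this distance tends to `0` by dominated convergence.

Pointwise convergence of the integrands (`tendsto_chi_pow`): Perron–Frobenius theory gives `F(u)` a
spectral gap, phrased as a contraction of some power in a weighted sup norm. This is an open
condition, so the implicit function theorem extends eigenvalue, eigenvectors and gap to complex `z`
near `u` (`SpectralGap.exists_near`). Thus `χ_u(ξ)^n` is `λ_u(ξ)^n` times a projector, up to an
exponentially smaller error. On `H` one has `λ_u(0) = 1`, and the phase cancels the first
derivative, so `λ_u(s/√n)^n` tends to `e^{-Q_u(s)/2}` by a second order Taylor expansion uniform in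
`u`.

Domination (`exists_norm_Fc_pow_le`): for one time `m`, the weights to `0` and to each unit vector
are all positive. The interference of two such terms makes the entries of `F(u+iξ)^m` smaller than
those of `F(u)^m` by an amount of order `‖ξ‖²` on the whole box. This excludes other points of the
box where the modulus could be large, supplies the integrable bound, and forces `Q_u` to be positive
definite.

For the weight, both terms of `A` are `O(e^{-‖y‖})`. For the first one, replace `u` by `u + v` with
`v` of length at most `1/√n` in the direction of `y`: the gain is `e^{-‖y‖}`, the cost a constant,
since `λ(u+v)^n` is controlled to second order (`exists_P_le_exp`). Writing `|A|` as the product of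
two square roots, one absorbs `‖y‖^γ` and the other tends to `0` (`tendsto_Atilde`).

Limits are taken along sequences with moving `u`, `n`, `x` and `γ`, so that uniformity on a compact
set follows by extracting a convergent subsequence (`exists_forall_abs_Atilde_lt`). -/

noncomputable section

namespace ThickenedLattice

/-! ### Operator bounds in weighted sup norms -/

section WeightedBounds

open Matrix

variable {N : ℕ}

/-- `M` has norm at most `c` for the operator norm of the weighted sup norm `max_k |v k| / w k`. -/
def WBound (M : Matrix (Fin N) (Fin N) ℂ) (w : Fin N → ℝ) (c : ℝ) : Prop :=
  ∀ k, ∑ j, ‖M k j‖ * w j ≤ c * w k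

lemma WBound.mono {M : Matrix (Fin N) (Fin N) ℂ} {w : Fin N → ℝ} {c c' : ℝ}
    (hw : ∀ i, 0 < w i) (h : WBound M w c) (hc : c ≤ c') : WBound M w c' := fun k =>
  (h k).trans (mul_le_mul_of_nonneg_right hc (hw k).le)

lemma WBound.mul {M M' : Matrix (Fin N) (Fin N) ℂ} {w : Fin N → ℝ} {c c' : ℝ}
    (hw : ∀ i, 0 < w i) (hc' : 0 ≤ c') (h : WBound M w c) (h' : WBound M' w c') :
    WBound (M * M') w (c * c') := by
  intro k
  calc ∑ j, ‖(M * M') k j‖ * w j ≤ ∑ j, ∑ l, ‖M k l‖ * (‖M' l j‖ * w j) := by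
        refine Finset.sum_le_sum fun j _ => ?_
        rw [Matrix.mul_apply]
        calc ‖∑ l, M k l * M' l j‖ * w j ≤ (∑ l, ‖M k l * M' l j‖) * w j := by
              gcongr
              · exact (hw j).le
              · exact norm_sum_le _ _
          _ = _ := by simp only [Finset.sum_mul, norm_mul, mul_assoc]
    _ = ∑ l, ‖M k l‖ * ∑ j, ‖M' l j‖ * w j := by
        rw [Finset.sum_comm]; simp only [Finset.mul_sum]
    _ ≤ ∑ l, ‖M k l‖ * (c' * w l) := by
        refine Finset.sum_le_sum fun l _ => ?_
        gcongr
        exact h' l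
    _ = c' * ∑ l, ‖M k l‖ * w l := by
        rw [Finset.mul_sum]; refine Finset.sum_congr rfl fun l _ => ?_; ring
    _ ≤ c' * (c * w k) := by gcongr; exact h k
    _ = c * c' * w k := by ring

lemma WBound.one (w : Fin N → ℝ) : WBound (1 : Matrix (Fin N) (Fin N) ℂ) w 1 := by
  intro k
  simp [Matrix.one_apply, apply_ite]

lemma WBound.pow {M : Matrix (Fin N) (Fin N) ℂ} {w : Fin N → ℝ} {c : ℝ}
    (hw : ∀ i, 0 < w i) (hc : 0 ≤ c) (h : WBound M w c) (n : ℕ) : WBound (M ^ n) w (c ^ n) := by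
  induction n with
  | zero => simpa using WBound.one w
  | succ n ih => rw [pow_succ, pow_succ]; exact ih.mul hw hc h

lemma WBound.add {M M' : Matrix (Fin N) (Fin N) ℂ} {w : Fin N → ℝ} {c c' : ℝ}
    (hw : ∀ i, 0 < w i) (h : WBound M w c) (h' : WBound M' w c') :
    WBound (M + M') w (c + c') := by
  intro k
  calc ∑ j, ‖(M + M') k j‖ * w j ≤ ∑ j, (‖M k j‖ * w j + ‖M' k j‖ * w j) := by
        refine Finset.sum_le_sum fun j _ => ?_
        rw [← add_mul, Matrix.add_apply]
        exact mul_le_mul_of_nonneg_right (norm_add_le _ _) (hw j).le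
    _ ≤ c * w k + c' * w k := by rw [Finset.sum_add_distrib]; exact add_le_add (h k) (h' k)
    _ = _ := by ring

lemma WBound.smul {M : Matrix (Fin N) (Fin N) ℂ} {w : Fin N → ℝ} {c : ℝ} (z : ℂ)
    (h : WBound M w c) : WBound (z • M) w (‖z‖ * c) := by
  intro k
  calc ∑ j, ‖(z • M) k j‖ * w j = ‖z‖ * ∑ j, ‖M k j‖ * w j := by
        rw [Finset.mul_sum]; refine Finset.sum_congr rfl fun j _ => ?_
        simp [mul_assoc]
    _ ≤ ‖z‖ * (c * w k) := by gcongr; exact h k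
    _ = _ := by ring

lemma WBound.norm_apply_le {M : Matrix (Fin N) (Fin N) ℂ} {w : Fin N → ℝ} {c : ℝ}
    (hw : ∀ i, 0 < w i) (h : WBound M w c) (k j : Fin N) : ‖M k j‖ ≤ c * (w k / w j) := by
  rw [← mul_div_assoc, le_div_iff₀ (hw j)]
  exact (Finset.single_le_sum (f := fun j => ‖M k j‖ * w j)
    (fun i _ => mul_nonneg (norm_nonneg _) (hw i).le) (Finset.mem_univ j)).trans (h k)

lemma exists_wBound {w : Fin N → ℝ} (hw : ∀ i, 0 < w i) (M : Matrix (Fin N) (Fin N) ℂ) :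
    ∃ c, 0 ≤ c ∧ WBound M w c := by
  refine ⟨∑ k, (∑ j, ‖M k j‖ * w j) / w k, Finset.sum_nonneg fun k _ => div_nonneg
    (Finset.sum_nonneg fun j _ => mul_nonneg (norm_nonneg _) (hw j).le) (hw k).le, fun k => ?_⟩
  rw [← div_le_iff₀ (hw k)]
  exact Finset.single_le_sum (f := fun k => (∑ j, ‖M k j‖ * w j) / w k) (fun i _ => div_nonneg
    (Finset.sum_nonneg fun j _ => mul_nonneg (norm_nonneg _) (hw j).le) (hw i).le)
    (Finset.mem_univ k)

/-- Read the eigenvalue equation at a coordinate where `‖v k‖ / w k` is largest. -/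
lemma WBound.norm_eigenvalue_le {M : Matrix (Fin N) (Fin N) ℂ} {w : Fin N → ℝ} {c : ℝ}
    (hw : ∀ i, 0 < w i) (h : WBound M w c) {z : ℂ} {v : Fin N → ℂ} (hv : v ≠ 0)
    (hz : M *ᵥ v = z • v) : ‖z‖ ≤ c := by
  obtain ⟨i₀, hi₀⟩ : ∃ i, v i ≠ 0 := by
    by_contra! hc
    exact hv (funext hc)
  obtain ⟨k, -, hk⟩ := Finset.exists_max_image Finset.univ (fun k => ‖v k‖ / w k)
    ⟨i₀, Finset.mem_univ _⟩
  have hpos : 0 < ‖v k‖ / w k :=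
    (div_pos (norm_pos_iff.2 hi₀) (hw i₀)).trans_le (hk i₀ (Finset.mem_univ _))
  have h1 : ‖z‖ * ‖v k‖ ≤ c * ‖v k‖ := by
    calc ‖z‖ * ‖v k‖ = ‖∑ j, M k j * v j‖ := by
          rw [← norm_mul]; exact congrArg norm (congrFun hz k).symm
      _ ≤ ∑ j, ‖M k j‖ * ‖v j‖ := (norm_sum_le _ _).trans (by simp)
      _ ≤ ∑ j, ‖M k j‖ * (‖v k‖ / w k * w j) := by
          refine Finset.sum_le_sum fun j _ => ?_
          gcongr
          rw [← div_le_iff₀ (hw j)]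
          exact hk j (Finset.mem_univ _)
      _ = ‖v k‖ / w k * ∑ j, ‖M k j‖ * w j := by
          rw [Finset.mul_sum]; refine Finset.sum_congr rfl fun j _ => ?_; ring
      _ ≤ ‖v k‖ / w k * (c * w k) := by gcongr; exact h k
      _ = c * ‖v k‖ := by field_simp [(hw k).ne']
  have hvk : 0 < ‖v k‖ := by
    have := mul_pos hpos (hw k)
    rwa [div_mul_cancel₀ _ (hw k).ne'] at this
  exact le_of_mul_le_mul_right h1 hvk

/-- Euclidean division of `n` by `k`: the quotient uses the contraction of `B ^ k`, and the
remainder costs at most `K ^ k` because `1 ≤ K`. -/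
lemma wBound_pow_le {B : Matrix (Fin N) (Fin N) ℂ} {w : Fin N → ℝ} {q K : ℝ} {k : ℕ}
    (hw : ∀ i, 0 < w i) (hq : 0 ≤ q) (hK : 1 ≤ K) (hk : k ≠ 0)
    (h : WBound (B ^ k) w q) (h' : WBound B w K) (n : ℕ) :
    WBound (B ^ n) w (q ^ (n / k) * K ^ k) := by
  have h1 : B ^ n = (B ^ k) ^ (n / k) * B ^ (n % k) := by
    rw [← pow_mul, ← pow_add, Nat.div_add_mod]
  rw [h1]
  have hK0 : 0 ≤ K := zero_le_one.trans hK
  refine (((h.pow hw hq (n / k)).mul hw (by positivity) (h'.pow hw hK0 (n % k)))).mono hw ?_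
  gcongr
  exact (Nat.mod_lt _ (Nat.pos_of_ne_zero hk)).le

lemma tendsto_pow_zero_of_wBound {ι : Type*} {l : Filter ι} {B : ι → Matrix (Fin N) (Fin N) ℂ}
    {n : ι → ℕ} {w : Fin N → ℝ} {q K : ℝ} {k : ℕ}
    (hw : ∀ i, 0 < w i) (hq : 0 ≤ q) (hq1 : q < 1) (hK : 1 ≤ K) (hk : k ≠ 0)
    (hn : Tendsto n l atTop) (h : ∀ᶠ i in l, WBound (B i ^ k) w q)
    (h' : ∀ᶠ i in l, WBound (B i) w K) : Tendsto (fun i => B i ^ n i) l (𝓝 0) := by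
  refine tendsto_pi_nhds.2 fun a => tendsto_pi_nhds.2 fun b => ?_
  refine squeeze_zero_norm' (a := fun i => q ^ (n i / k) * K ^ k * (w a / w b)) ?_ ?_
  · filter_upwards [h, h'] with i hi hi'
    exact (wBound_pow_le hw hq hK hk hi hi' (n i)).norm_apply_le hw a b
  · have h1 : Tendsto (fun i => n i / k) l atTop :=
      (Nat.tendsto_div_const_atTop hk).comp hn
    have h2 := (tendsto_pow_atTop_nhds_zero_of_lt_one hq hq1).comp h1
    simpa using (h2.mul_const (K ^ k)).mul_const (w a / w b)

end WeightedBounds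

/-! ### Spectral gaps and dominant eigenvalues -/

section Gap

open Matrix

variable {N : ℕ}

/-- `μ` is a nonzero eigenvalue of `M` with right and left eigenvectors `R` and `L`, `L · R = 1`,
and some power of `M - μ R L` is a contraction relative to the same power of `μ`. -/
structure SpectralGap (M : Matrix (Fin N) (Fin N) ℂ) (μ : ℂ) (R L : Fin N → ℂ) : Prop where
  right : M *ᵥ R = μ • R
  left : L ᵥ* M = μ • L
  dot : L ⬝ᵥ R = 1
  ne_zero : μ ≠ 0
  gap : ∃ (k : ℕ) (w : Fin N → ℝ) (c : ℝ), k ≠ 0 ∧ (∀ i, 0 < w i) ∧ 0 ≤ c ∧ c < ‖μ‖ ^ k ∧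
    WBound ((M - μ • vecMulVec R L) ^ k) w c

lemma vecMulVec_mul_self {K : Type*} [Field K] {R L : Fin N → K} (h : L ⬝ᵥ R = 1) :
    vecMulVec R L * vecMulVec R L = vecMulVec R L := by
  rw [vecMulVec_mul_vecMulVec, h, one_smul]

/-- `vecMulVec R L` is an idempotent that `M` multiplies by `μ` on either side, so cross terms
collapse. The exponent `n + 1` matters: at exponent `0` the projector would have to be subtracted
from the identity. -/
lemma sub_smul_vecMulVec_pow {K : Type*} [Field K] {M : Matrix (Fin N) (Fin N) K} {μ : K}
    {R L : Fin N → K} (hR : M *ᵥ R = μ • R) (hL : L ᵥ* M = μ • L) (hd : L ⬝ᵥ R = 1) (n : ℕ) :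
    (M - μ • vecMulVec R L) ^ (n + 1) = M ^ (n + 1) - μ ^ (n + 1) • vecMulVec R L := by
  have hM : ∀ n : ℕ, M ^ n * vecMulVec R L = μ ^ n • vecMulVec R L := by
    intro n
    induction n with
    | zero => simp
    | succ n ih => rw [pow_succ', mul_assoc, ih, Matrix.mul_smul, mul_vecMulVec, hR, smul_vecMulVec,
        smul_smul, ← pow_succ]
  have hM' : vecMulVec R L * M = μ • vecMulVec R L := by
    rw [vecMulVec_mul, hL, vecMulVec_smul]
  induction n with
  | zero => simp
  | succ n ih =>
    rw [pow_succ, ih, sub_mul, mul_sub, mul_sub, ← pow_succ, Matrix.mul_smul, hM, Matrix.smul_mul, hM',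
      Matrix.smul_mul, Matrix.mul_smul, vecMulVec_mul_self hd, smul_smul, smul_smul, ← pow_succ, ← pow_succ']
    abel

namespace SpectralGap

variable {M : Matrix (Fin N) (Fin N) ℂ} {μ : ℂ} {R L : Fin N → ℂ}

lemma smul (h : SpectralGap M μ R L) {z : ℂ} (hz : z ≠ 0) : SpectralGap (z • M) (z * μ) R L where
  right := by rw [smul_mulVec, h.right, smul_smul]
  left := by rw [vecMul_smul, h.left, smul_smul]
  dot := h.dot
  ne_zero := mul_ne_zero hz h.ne_zero
  gap := by
    obtain ⟨k, w, c, hk, hw, hc, hlt, hb⟩ := h.gap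
    refine ⟨k, w, ‖z ^ k‖ * c, hk, hw, by positivity, ?_, ?_⟩
    · rw [norm_mul, mul_pow, norm_pow]
      have : 0 < ‖z‖ ^ k := pow_pos (norm_pos_iff.2 hz) k
      gcongr
    · rw [← smul_smul, ← smul_sub, smul_pow]
      exact hb.smul _

lemma tendsto (h : SpectralGap M μ R L) :
    Tendsto (fun n : ℕ => (μ⁻¹ • M) ^ n) atTop (𝓝 (vecMulVec R L)) := by
  have h' := h.smul (inv_ne_zero h.ne_zero)
  rw [inv_mul_cancel₀ h.ne_zero] at h'
  obtain ⟨k, w, c, hk, hw, hc, hlt, hb⟩ := h'.gap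
  rw [norm_one, one_pow] at hlt
  obtain ⟨K, -, hK⟩ := exists_wBound hw (μ⁻¹ • M - (1 : ℂ) • vecMulVec R L)
  have ht := tendsto_pow_zero_of_wBound (l := atTop) (n := fun n => n)
    (B := fun _ => μ⁻¹ • M - (1 : ℂ) • vecMulVec R L) hw hc hlt (le_max_right K 1) hk tendsto_id
    (Eventually.of_forall fun _ => hb) (Eventually.of_forall fun _ => hK.mono hw (le_max_left _ _))
  have ht' := ht.add_const (vecMulVec R L)
  rw [zero_add] at ht'
  refine ht'.congr' ?_
  filter_upwards [eventually_ne_atTop 0] with n hn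
  obtain ⟨n, rfl⟩ := Nat.exists_eq_succ_of_ne_zero hn
  rw [Nat.succ_eq_add_one, sub_smul_vecMulVec_pow h'.right h'.left h'.dot]
  simp

/-- An eigenvector for `μ` is fixed by every power of `μ⁻¹ • M`, hence by their limit, which is the
projector. -/
lemma right_unique (h : SpectralGap M μ R L) {v : Fin N → ℂ} (hv : M *ᵥ v = μ • v) :
    v = (L ⬝ᵥ v) • R := by
  have h1 : ∀ n : ℕ, (μ⁻¹ • M) ^ n *ᵥ v = v := by
    intro n
    induction n with
    | zero => simp
    | succ n ih => rw [pow_succ, ← mulVec_mulVec, smul_mulVec, hv, smul_smul,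
        inv_mul_cancel₀ h.ne_zero, one_smul, ih]
  have h2 : Tendsto (fun n : ℕ => (μ⁻¹ • M) ^ n *ᵥ v) atTop (𝓝 (vecMulVec R L *ᵥ v)) :=
    ((continuous_id.matrix_mulVec continuous_const).tendsto _).comp h.tendsto
  simp only [h1] at h2
  have h3 := tendsto_nhds_unique tendsto_const_nhds h2
  rw [vecMulVec_mulVec] at h3
  simpa using h3

lemma left_unique (h : SpectralGap M μ R L) {v : Fin N → ℂ} (hv : v ᵥ* M = μ • v) :
    v = (v ⬝ᵥ R) • L := by
  have h1 : ∀ n : ℕ, v ᵥ* (μ⁻¹ • M) ^ n = v := by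
    intro n
    induction n with
    | zero => simp
    | succ n ih => rw [pow_succ', ← vecMul_vecMul, vecMul_smul, hv, smul_smul,
        inv_mul_cancel₀ h.ne_zero, one_smul, ih]
  have h2 : Tendsto (fun n : ℕ => v ᵥ* (μ⁻¹ • M) ^ n) atTop (𝓝 (v ᵥ* vecMulVec R L)) :=
    ((continuous_const.matrix_vecMul continuous_id).tendsto _).comp h.tendsto
  simp only [h1] at h2
  have h3 := tendsto_nhds_unique tendsto_const_nhds h2
  rw [vecMul_vecMulVec] at h3
  exact h3

lemma vecMulVec_unique (h : SpectralGap M μ R L) {R' L' : Fin N → ℂ} (hR : M *ᵥ R' = μ • R')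
    (hL : L' ᵥ* M = μ • L') (hd : L' ⬝ᵥ R' = 1) : vecMulVec R' L' = vecMulVec R L := by
  have h1 := h.right_unique hR
  have h2 := h.left_unique hL
  have h3 : (L ⬝ᵥ R') * (L' ⬝ᵥ R) = 1 := by
    rw [h1] at hd
    simpa using hd
  rw [h1, h2, smul_vecMulVec, vecMulVec_smul, smul_smul, h3, one_smul]

lemma isDominantEigenvalue (h : SpectralGap M μ R L) : IsDominantEigenvalue M μ := by
  obtain ⟨k, w, c, hk, hw, hc, hlt, hb⟩ := h.gap
  set B := M - μ • vecMulVec R L with hB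
  have hBR : B *ᵥ R = 0 := by
    rw [hB, sub_mulVec, smul_mulVec, vecMulVec_mulVec, h.right, h.dot]
    simp
  -- Rank one update: since `B *ᵥ R = 0`, the matrix `x - M` factors as `x - B` times the identity
  -- minus `(μ / x)` times the projector, whose determinant is `1 - μ / x`.
  have hdet : ∀ x : ℂ, x ≠ 0 → x * M.charpoly.eval x = (x - μ) * B.charpoly.eval x := by
    intro x hx
    have h1 : scalar (Fin N) x - M
        = (scalar (Fin N) x - B) * (1 + vecMulVec (-(μ / x) • R) L) := by
      have h2 : B * vecMulVec (-(μ / x) • R) L = 0 := by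
        rw [mul_vecMulVec, mulVec_smul, hBR, smul_zero, zero_vecMulVec]
      rw [mul_add, mul_one, sub_mul (scalar (Fin N) x), h2, sub_zero, smul_vecMulVec,
        scalar_apply, ← smul_one_eq_diagonal, smul_mul_assoc, one_mul, smul_smul, hB]
      have : x * -(μ / x) = -μ := by field_simp
      rw [this, neg_smul]
      abel
    rw [eval_charpoly, eval_charpoly, h1, det_mul, vecMulVec_eq Unit,
      det_one_add_replicateCol_mul_replicateRow, dotProduct_smul, h.dot, smul_eq_mul]
    field_simp
    ring
  have hpoly : Polynomial.X * M.charpoly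
      = (Polynomial.X - Polynomial.C μ) * B.charpoly := by
    refine Polynomial.eq_of_infinite_eval_eq _ _ ?_
    refine Set.Infinite.mono (s := {x : ℂ | x ≠ 0}) ?_ (Set.Finite.infinite_compl
      (Set.finite_singleton (0 : ℂ)))
    intro x hx
    simpa using hdet x hx
  -- Deflation leaves only small eigenvalues: if `z` is one of `B`, then `z ^ k` is one of the
  -- contraction `B ^ k`.
  have hroot : ∀ z : ℂ, B.charpoly.IsRoot z → ‖z‖ < ‖μ‖ := by
    intro z hz
    rw [Polynomial.IsRoot, eval_charpoly] at hz
    obtain ⟨v, hv0, hv⟩ := exists_mulVec_eq_zero_iff.2 hz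
    have hv' : B *ᵥ v = z • v := by
      rw [sub_mulVec, sub_eq_zero, scalar_apply, ← smul_one_eq_diagonal, smul_mulVec,
        one_mulVec] at hv
      exact hv.symm
    have hvk : ∀ n : ℕ, B ^ n *ᵥ v = z ^ n • v := by
      intro n
      induction n with
      | zero => simp
      | succ n ih => rw [pow_succ, ← mulVec_mulVec, hv', mulVec_smul, ih, smul_smul, pow_succ']
    have h1 := hb.norm_eigenvalue_le hw hv0 (hvk k)
    rw [norm_pow] at h1
    exact lt_of_pow_lt_pow_left₀ k (norm_nonneg _) (h1.trans_lt hlt)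
  have hM0 : M.charpoly ≠ 0 := (charpoly_monic M).ne_zero
  have hB0 : B.charpoly ≠ 0 := (charpoly_monic B).ne_zero
  -- In `hpoly`, `μ` is a root neither of `X` nor of the polynomial of `B`, so its multiplicity in
  -- that of `M` is the one coming from `X - μ`.
  refine ⟨?_, fun z hz hne => ?_⟩
  · have h1 := congrArg (Polynomial.rootMultiplicity μ) hpoly
    rw [Polynomial.rootMultiplicity_mul (mul_ne_zero Polynomial.X_ne_zero hM0),
      Polynomial.rootMultiplicity_mul (mul_ne_zero (Polynomial.X_sub_C_ne_zero μ) hB0),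
      Polynomial.rootMultiplicity_X_sub_C_self,
      Polynomial.rootMultiplicity_eq_zero (p := Polynomial.X) (by simpa using h.ne_zero),
      Polynomial.rootMultiplicity_eq_zero (p := B.charpoly)
        (fun hr => (hroot μ hr).false)] at h1
    simpa using h1
  · have h1 := congrArg (Polynomial.eval z) hpoly
    rw [Polynomial.eval_mul, Polynomial.eval_mul, hz.eq_zero, mul_zero] at h1
    rcases mul_eq_zero.1 h1.symm with h2 | h2
    · exact absurd (by simpa [sub_eq_zero] using h2) hne
    · exact hroot z h2

end SpectralGap

lemma IsDominantEigenvalue.unique {M : Matrix (Fin N) (Fin N) ℂ} {μ μ' : ℂ}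
    (h : IsDominantEigenvalue M μ) (h' : IsDominantEigenvalue M μ') : μ = μ' := by
  have hroot : ∀ {ν : ℂ}, IsDominantEigenvalue M ν → M.charpoly.IsRoot ν := fun hν => by
    by_contra hc
    have := Polynomial.rootMultiplicity_eq_zero hc
    rw [hν.1] at this
    exact one_ne_zero this
  by_contra hne
  exact lt_asymm (h.2 μ' (hroot h') (Ne.symm hne)) (h'.2 μ (hroot h) hne)

lemma IsDominantEigenvalue.dominantEigenvalue_eq {M : Matrix (Fin N) (Fin N) ℂ} {μ : ℂ}
    (h : IsDominantEigenvalue M μ) : dominantEigenvalue M = μ := by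
  have hex : ∃ μ : ℂ, IsDominantEigenvalue M μ := ⟨μ, h⟩
  rw [dominantEigenvalue, dif_pos hex]
  exact hex.choose_spec.unique h

lemma SpectralGap.dominantEigenvalue_eq {M : Matrix (Fin N) (Fin N) ℂ} {μ : ℂ}
    {R L : Fin N → ℂ} (h : SpectralGap M μ R L) : dominantEigenvalue M = μ :=
  h.isDominantEigenvalue.dominantEigenvalue_eq

end Gap

/-! ### Perron–Frobenius theory of primitive matrices -/

section PerronFrobenius

open Matrix

variable {N : ℕ}

lemma mulVec_pos_of_pos {A : Matrix (Fin N) (Fin N) ℝ} (hA : ∀ i j, 0 < A i j) {v : Fin N → ℝ}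
    (hv : ∀ j, 0 ≤ v j) (hv0 : v ≠ 0) (i : Fin N) : 0 < (A *ᵥ v) i := by
  obtain ⟨j, hj⟩ : ∃ j, v j ≠ 0 := by
    by_contra! hc
    exact hv0 (funext hc)
  exact Finset.sum_pos' (fun l _ => mul_nonneg (hA i l).le (hv l))
    ⟨j, Finset.mem_univ _, mul_pos (hA i j) ((hv j).lt_of_ne' hj)⟩

/-- Existence of a positive right eigenvector of a primitive matrix, by the maximization of the
Collatz–Wielandt function. -/
lemma exists_pos_eigenvector (hN : 0 < N) {A : Matrix (Fin N) (Fin N) ℝ} (hA : ∀ i j, 0 ≤ A i j)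
    {m : ℕ} (hm : m ≠ 0) (hAm : ∀ i j, 0 < (A ^ m) i j) :
    ∃ (r : ℝ) (v : Fin N → ℝ), 0 < r ∧ (∀ i, 0 < v i) ∧ A *ᵥ v = r • v := by
  -- The sum of all entries bounds every admissible value of the Collatz–Wielandt function, which
  -- makes the set `K` of admissible pairs compact.
  set S : ℝ := ∑ i, ∑ j, A i j with hS
  have hS0 : 0 ≤ S := Finset.sum_nonneg fun i _ => Finset.sum_nonneg fun j _ => hA i j
  set K : Set (ℝ × (Fin N → ℝ)) :=
    (Set.Icc 0 S ×ˢ stdSimplex ℝ (Fin N)) ∩ {q | ∀ i, q.1 * q.2 i ≤ (A *ᵥ q.2) i} with hK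
  have hKc : IsCompact K := by
    refine (isCompact_Icc.prod (isCompact_stdSimplex (𝕜 := ℝ) (Fin N))).inter_right ?_
    simp only [Set.ofPred_forall]
    refine isClosed_iInter fun i => isClosed_le ?_ ?_
    · fun_prop
    · exact (continuous_apply i).comp (continuous_const.matrix_mulVec continuous_snd)
  have hKne : K.Nonempty := by
    refine ⟨(0, Pi.single ⟨0, hN⟩ 1), ⟨⟨le_rfl, hS0⟩, single_mem_stdSimplex ℝ _⟩, fun i => ?_⟩
    rw [zero_mul]
    simp only [mulVec, dotProduct]
    refine Finset.sum_nonneg fun j _ => mul_nonneg (hA i j) ?_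
    exact (single_mem_stdSimplex ℝ (⟨0, hN⟩ : Fin N)).1 j
  obtain ⟨⟨r, x⟩, ⟨⟨⟨hr0, hrS⟩, hx⟩, hrx⟩, hmax⟩ := hKc.exists_isMaxOn hKne continuous_fst.continuousOn
  simp only [Set.mem_ofPred_eq] at hrx hr0 hrS hx
  have hx0 : x ≠ 0 := by
    rintro rfl
    simpa using hx.2
  have hy := mulVec_pos_of_pos hAm hx.1 hx0
  set y := A ^ m *ᵥ x with hydef
  have heig : A *ᵥ x = r • x := by
    by_contra hne
    have hd := mulVec_pos_of_pos hAm (v := A *ᵥ x - r • x)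
      (fun j => by simpa using hrx j) (sub_ne_zero.2 hne)
    have hd' : ∀ i, 0 < (A *ᵥ y) i - r * y i := by
      intro i
      have := hd i
      rw [mulVec_sub, mulVec_smul, mulVec_mulVec, ← pow_succ, pow_succ', ← mulVec_mulVec,
        ← hydef] at this
      simpa using this
    have hne' : (Finset.univ : Finset (Fin N)).Nonempty := ⟨⟨0, hN⟩, Finset.mem_univ _⟩
    obtain ⟨i₀, -, hi₀⟩ := Finset.exists_min_image Finset.univ
      (fun i => ((A *ᵥ y) i - r * y i) / y i) hne'
    set ε := ((A *ᵥ y) i₀ - r * y i₀) / y i₀ with hε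
    have hε0 : 0 < ε := div_pos (hd' i₀) (hy i₀)
    have hεy : ∀ i, (r + ε) * y i ≤ (A *ᵥ y) i := by
      intro i
      have h1 := hi₀ i (Finset.mem_univ _)
      rw [le_div_iff₀ (hy i)] at h1
      linarith
    set σ := ∑ i, y i with hσ
    have hσ0 : 0 < σ := Finset.sum_pos (fun i _ => hy i) hne'
    have hz : σ⁻¹ • y ∈ stdSimplex ℝ (Fin N) := by
      refine ⟨fun i => mul_nonneg (inv_nonneg.2 hσ0.le) (hy i).le, ?_⟩
      simp only [Pi.smul_apply, smul_eq_mul, ← Finset.mul_sum]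
      exact inv_mul_cancel₀ hσ0.ne'
    have hzA : ∀ i, (r + ε) * (σ⁻¹ • y) i ≤ (A *ᵥ (σ⁻¹ • y)) i := by
      intro i
      rw [mulVec_smul]
      simp only [Pi.smul_apply, smul_eq_mul]
      have := mul_le_mul_of_nonneg_left (hεy i) (inv_nonneg.2 hσ0.le)
      linarith
    have hS' : r + ε ≤ S := by
      calc r + ε = ∑ i, (r + ε) * (σ⁻¹ • y) i := by
            rw [← Finset.mul_sum, hz.2, mul_one]
        _ ≤ ∑ i, ∑ j, A i j * (σ⁻¹ • y) j := Finset.sum_le_sum fun i _ => hzA i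
        _ ≤ S := by
            refine Finset.sum_le_sum fun i _ => Finset.sum_le_sum fun j _ => ?_
            refine mul_le_of_le_one_right (hA i j) ?_
            rw [← hz.2]
            exact Finset.single_le_sum (fun l _ => hz.1 l) (Finset.mem_univ j)
    have h2 := hmax (show ((r + ε, σ⁻¹ • y) : ℝ × (Fin N → ℝ)) ∈ K from
      ⟨⟨⟨by positivity, hS'⟩, hz⟩, hzA⟩)
    simp only [Set.mem_ofPred_eq] at h2
    linarith
  have hpow : ∀ n : ℕ, A ^ n *ᵥ x = r ^ n • x := by
    intro n
    induction n with
    | zero => simp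
    | succ n ih => rw [pow_succ, ← mulVec_mulVec, heig, mulVec_smul, ih, smul_smul, pow_succ']
  have hyx : ∀ i, 0 < r ^ m * x i := fun i => by
    have := hy i
    rw [hydef, hpow] at this
    simpa using this
  refine ⟨r, x, hr0.lt_of_ne' ?_, fun i => (hx.1 i).lt_of_ne' ?_, heig⟩
  · rintro rfl
    have := hyx ⟨0, hN⟩
    simp [hm] at this
  · intro h0
    have := hyx i
    simp [h0] at this

/-- Perron–Frobenius: positive right and left eigenvectors of a primitive matrix. -/
lemma exists_perron_eigenvectors (hN : 0 < N) {A : Matrix (Fin N) (Fin N) ℝ}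
    (hA : ∀ i j, 0 ≤ A i j) {m : ℕ} (hm : m ≠ 0) (hAm : ∀ i j, 0 < (A ^ m) i j) :
    ∃ (r : ℝ) (v w : Fin N → ℝ), 0 < r ∧ (∀ i, 0 < v i) ∧ (∀ i, 0 < w i) ∧
      A *ᵥ v = r • v ∧ w ᵥ* A = r • w ∧ w ⬝ᵥ v = 1 := by
  obtain ⟨r, v, hr, hv, hAv⟩ := exists_pos_eigenvector hN hA hm hAm
  obtain ⟨s, w, hs, hw, hAw⟩ := exists_pos_eigenvector (A := Aᵀ) hN (fun i j => hA j i) hm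
    (fun i j => by rw [← transpose_pow]; exact hAm j i)
  rw [mulVec_transpose] at hAw
  have hd : 0 < w ⬝ᵥ v :=
    Finset.sum_pos (fun i _ => mul_pos (hw i) (hv i)) ⟨⟨0, hN⟩, Finset.mem_univ _⟩
  -- Pairing the two eigenvectors: `w · A v` computed in two ways, with `w · v > 0`.
  have hrs : s = r := by
    have h1 : (w ᵥ* A) ⬝ᵥ v = w ⬝ᵥ (A *ᵥ v) := (dotProduct_mulVec w A v).symm
    rw [hAw, hAv, smul_dotProduct, dotProduct_smul, smul_eq_mul, smul_eq_mul] at h1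
    exact mul_right_cancel₀ hd.ne' h1
  subst hrs
  refine ⟨s, v, (w ⬝ᵥ v)⁻¹ • w, hr, hv, fun i => mul_pos (inv_pos.2 hd) (hw i), hAv, ?_, ?_⟩
  · rw [smul_vecMul, hAw, smul_comm]
  · rw [smul_dotProduct, smul_eq_mul, inv_mul_cancel₀ hd.ne']

lemma map_mulVec_ofReal {A : Matrix (Fin N) (Fin N) ℝ} {v w : Fin N → ℝ} {r : ℝ}
    (h : A *ᵥ v = r • w) :
    A.map (fun a : ℝ => (a : ℂ)) *ᵥ (fun i => (v i : ℂ)) = (r : ℂ) • fun i => (w i : ℂ) := by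
  ext i
  have := congrFun h i
  simp only [mulVec, dotProduct, Pi.smul_apply, smul_eq_mul, map_apply] at this ⊢
  exact_mod_cast this

lemma map_vecMul_ofReal {A : Matrix (Fin N) (Fin N) ℝ} {v w : Fin N → ℝ} {r : ℝ}
    (h : v ᵥ* A = r • w) :
    (fun i => (v i : ℂ)) ᵥ* A.map (fun a : ℝ => (a : ℂ)) = (r : ℂ) • fun i => (w i : ℂ) := by
  ext i
  have := congrFun h i
  simp only [vecMul, dotProduct, Pi.smul_apply, smul_eq_mul, map_apply] at this ⊢
  exact_mod_cast this

lemma dotProduct_ofReal {v w : Fin N → ℝ} {r : ℝ} (h : v ⬝ᵥ w = r) :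
    (fun i => (v i : ℂ)) ⬝ᵥ (fun i => (w i : ℂ)) = (r : ℂ) := by
  simp only [dotProduct] at h ⊢
  exact_mod_cast h

lemma map_ofReal_pow (A : Matrix (Fin N) (Fin N) ℝ) (n : ℕ) :
    (A.map (fun a : ℝ => (a : ℂ))) ^ n = (A ^ n).map (fun a : ℝ => (a : ℂ)) :=
  (map_pow (Complex.ofRealHom.mapMatrix (m := Fin N)) A n).symm

/-- The spectral gap of a primitive matrix, from a Doeblin minorization. -/
lemma spectralGap_of_primitive (hN : 0 < N) {A : Matrix (Fin N) (Fin N) ℝ}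
    {m : ℕ} (hm : m ≠ 0) (hAm : ∀ i j, 0 < (A ^ m) i j)
    {r : ℝ} {v w : Fin N → ℝ} (hr : 0 < r) (hv : ∀ i, 0 < v i) (hw : ∀ i, 0 < w i)
    (hAv : A *ᵥ v = r • v) (hwA : w ᵥ* A = r • w) (hd : w ⬝ᵥ v = 1) :
    SpectralGap (A.map (fun a : ℝ => (a : ℂ))) r (fun i => (v i : ℂ)) (fun i => (w i : ℂ)) := by
  set M := A.map (fun a : ℝ => (a : ℂ)) with hM
  set R : Fin N → ℂ := fun i => (v i : ℂ) with hR
  set L : Fin N → ℂ := fun i => (w i : ℂ) with hL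
  have hMR : M *ᵥ R = (r : ℂ) • R := map_mulVec_ofReal hAv
  have hLM : L ᵥ* M = (r : ℂ) • L := map_vecMul_ofReal hwA
  have hLR : L ⬝ᵥ R = 1 := by simpa using dotProduct_ofReal hd
  have hpow : ∀ n : ℕ, A ^ n *ᵥ v = r ^ n • v := by
    intro n
    induction n with
    | zero => simp
    | succ n ih => rw [pow_succ, ← mulVec_mulVec, hAv, mulVec_smul, ih, smul_smul, pow_succ']
  -- Doeblin minorization of `A ^ m` by a multiple of the Perron projector. The cap `1 / 2` keeps `1
  -- - ε` positive.
  obtain ⟨ε, hε0, hε1, hε⟩ : ∃ ε : ℝ, 0 < ε ∧ ε ≤ 1 / 2 ∧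
      ∀ i j, ε * (r ^ m * (v i * w j)) ≤ (A ^ m) i j := by
    obtain ⟨q, -, hq⟩ := Finset.exists_min_image (Finset.univ : Finset (Fin N × Fin N))
      (fun q => (A ^ m) q.1 q.2 / (r ^ m * (v q.1 * w q.2))) ⟨(⟨0, hN⟩, ⟨0, hN⟩), Finset.mem_univ _⟩
    have hpos : ∀ i j, 0 < r ^ m * (v i * w j) := fun i j =>
      mul_pos (pow_pos hr m) (mul_pos (hv i) (hw j))
    refine ⟨min ((A ^ m) q.1 q.2 / (r ^ m * (v q.1 * w q.2))) (1 / 2),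
      lt_min (div_pos (hAm _ _) (hpos _ _)) (by norm_num), min_le_right _ _, fun i j => ?_⟩
    rw [← le_div_iff₀ (hpos i j)]
    exact (min_le_left _ _).trans (hq (i, j) (Finset.mem_univ _))
  set s : ℝ := (1 - ε) * r ^ m with hs
  have hs0 : 0 < s := mul_pos (by linarith) (pow_pos hr m)
  set D := M ^ m - ((ε * r ^ m : ℝ) : ℂ) • vecMulVec R L with hD
  have hMmR : M ^ m *ᵥ R = ((r ^ m : ℝ) : ℂ) • R := by
    rw [hM, map_ofReal_pow]; exact map_mulVec_ofReal (hpow m)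
  have hLMm : L ᵥ* M ^ m = ((r ^ m : ℝ) : ℂ) • L := by
    have : ∀ n : ℕ, L ᵥ* M ^ n = ((r ^ n : ℝ) : ℂ) • L := by
      intro n
      induction n with
      | zero => simp
      | succ n ih =>
        rw [pow_succ, ← vecMul_vecMul, ih, smul_vecMul, hLM, smul_smul]; push_cast; rw [pow_succ]
    exact this m
  have hDR : D *ᵥ R = (s : ℂ) • R := by
    rw [hD, sub_mulVec, hMmR, smul_mulVec, vecMulVec_mulVec, hLR, hs]
    ext i
    simp
    ring
  have hLD : L ᵥ* D = (s : ℂ) • L := by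
    rw [hD, vecMul_sub, hLMm, vecMul_smul, vecMul_vecMulVec, hLR, hs]
    ext i
    simp
    ring
  -- `D` has nonnegative entries and `v` as an eigenvector, so its norm in the weight `v` is exactly
  -- the eigenvalue `s`.
  have hDb : WBound D v s := by
    intro k
    have h1 : ∀ j, ‖D k j‖ * v j = (A ^ m) k j * v j - ε * r ^ m * v k * (w j * v j) := by
      intro j
      have h2 : D k j = (((A ^ m) k j - ε * (r ^ m * (v k * w j)) : ℝ) : ℂ) := by
        rw [hD, hM, map_ofReal_pow]
        simp only [Matrix.sub_apply, map_apply, Matrix.smul_apply, vecMulVec_apply, smul_eq_mul, hR, hL]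
        push_cast
        ring
      rw [h2, Complex.norm_real, Real.norm_of_nonneg (by linarith [hε k j])]
      ring
    have h3 : ∑ j, (A ^ m) k j * v j = r ^ m * v k := congrFun (hpow m) k
    have h4 : ∑ j, w j * v j = 1 := hd
    simp only [h1]
    rw [Finset.sum_sub_distrib, ← Finset.mul_sum, h3, h4, hs]
    apply le_of_eq
    ring
  have hPb : WBound (vecMulVec R L) v 1 := by
    intro k
    have h4 : ∑ j, w j * v j = 1 := hd
    have h1 : ∀ j, ‖vecMulVec R L k j‖ * v j = v k * (w j * v j) := by
      intro j
      rw [vecMulVec_apply, norm_mul, hR, hL]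
      simp only [Complex.norm_real, Real.norm_of_nonneg (hv k).le, Real.norm_of_nonneg (hw j).le]
      ring
    simp only [h1]
    rw [← Finset.mul_sum, h4]
    simp
  -- After `n + 1` blocks of length `m` the deflated matrix is `D ^ (n + 1)` minus `s ^ (n + 1)`
  -- times the projector, two terms of norm at most `s ^ (n + 1)`. This choice of `n` absorbs the
  -- factor `2`.
  obtain ⟨n, hn⟩ := exists_pow_lt_of_lt_one (show (0 : ℝ) < 1 / 2 by norm_num)
    (show 1 - ε < 1 by linarith)
  refine ⟨hMR, hLM, hLR, by exact_mod_cast hr.ne', m * (n + 1), v, s ^ (n + 1) + s ^ (n + 1),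
    by simp [hm], hv, by positivity, ?_, ?_⟩
  · rw [Complex.norm_real, Real.norm_of_nonneg hr.le, hs, mul_pow, pow_mul]
    have h5 : (1 - ε) ^ (n + 1) < 1 / 2 := by
      refine lt_of_le_of_lt ?_ hn
      exact pow_le_pow_of_le_one (by linarith) (by linarith) (Nat.le_succ n)
    have h6 : 0 < (r ^ m) ^ (n + 1) := by positivity
    nlinarith
  · obtain ⟨m', rfl⟩ := Nat.exists_eq_succ_of_ne_zero hm
    rw [pow_mul, Nat.succ_eq_add_one, sub_smul_vecMulVec_pow hMR hLM hLR]
    have h7 : M ^ (m' + 1) - (r : ℂ) ^ (m' + 1) • vecMulVec R L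
        = D - (s : ℂ) • vecMulVec R L := by
      rw [hD, sub_sub, ← add_smul, hs]
      congr 2
      push_cast [Nat.succ_eq_add_one]
      ring
    rw [h7, sub_smul_vecMulVec_pow hDR hLD hLR, sub_eq_add_neg, ← neg_smul]
    refine (hDb.pow hv hs0.le _).add hv ?_
    have := hPb.smul (-(s : ℂ) ^ (n + 1))
    rwa [norm_neg, norm_pow, Complex.norm_real, Real.norm_of_nonneg hs0.le, mul_one] at this

end PerronFrobenius

/-! ### Stability of the spectral gap -/

section Perturbation

open Matrix
open scoped ContDiff

variable {N : ℕ}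

/-- The bound is finitely many inequalities between continuous functions of the entries; the room
between `c` and `c'` makes them stable, with the same weight. -/
lemma WBound.eventually {α : Type*} {l : Filter α} {B : α → Matrix (Fin N) (Fin N) ℂ}
    {B₀ : Matrix (Fin N) (Fin N) ℂ} {w : Fin N → ℝ} {c c' : ℝ} (hw : ∀ i, 0 < w i)
    (hB : Tendsto B l (𝓝 B₀)) (h : WBound B₀ w c) (hc : c < c') :
    ∀ᶠ a in l, WBound (B a) w c' := by
  refine eventually_all.2 fun k => ?_
  have ht : Tendsto (fun a => ∑ j, ‖B a k j‖ * w j) l (𝓝 (∑ j, ‖B₀ k j‖ * w j)) := by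
    refine tendsto_finsetSum _ fun j _ => ?_
    exact ((tendsto_pi_nhds.1 (tendsto_pi_nhds.1 hB k) j).norm).mul_const _
  filter_upwards [ht.eventually_lt_const
    ((h k).trans_lt (mul_lt_mul_of_pos_right hc (hw k)))] with a ha
  exact ha.le

/-- A simple eigenvalue and its normalized eigenvector depend smoothly on the matrix. -/
lemma exists_smooth_eigenpair {n : ℕ∞ω} (hn : n ≠ 0) (M₀ : Fin N → Fin N → ℂ) {μ₀ : ℂ}
    {R L : Fin N → ℂ} (hR : of M₀ *ᵥ R = μ₀ • R) (hL : L ᵥ* of M₀ = μ₀ • L)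
    (hd : L ⬝ᵥ R = 1) (huniq : ∀ v, of M₀ *ᵥ v = μ₀ • v → v = (L ⬝ᵥ v) • R) :
    ∃ (μ : (Fin N → Fin N → ℂ) → ℂ) (v : (Fin N → Fin N → ℂ) → Fin N → ℂ),
      ContDiffAt ℂ n μ M₀ ∧ ContDiffAt ℂ n v M₀ ∧ μ M₀ = μ₀ ∧ v M₀ = R ∧
      ∀ᶠ M in 𝓝 M₀, of M *ᵥ v M = μ M • v M ∧ L ⬝ᵥ v M = 1 := by
  -- Implicit function theorem for the eigenvalue equation together with the normalization by the
  -- fixed vector `L`.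
  set f : (Fin N → Fin N → ℂ) × (ℂ × (Fin N → ℂ)) → ℂ × (Fin N → ℂ) := fun q =>
    (∑ j, L j * q.2.2 j - 1, fun k => ∑ j, q.1 k j * q.2.2 j - q.2.1 * q.2.2 k) with hf
  have hfs : ContDiff ℂ n f := by
    refine ContDiff.prodMk (by fun_prop) (contDiff_pi.2 fun k => ?_)
    fun_prop
  set u : (Fin N → Fin N → ℂ) × (ℂ × (Fin N → ℂ)) := (M₀, (μ₀, R)) with hu
  have hf0 : f u = 0 := by
    rw [hf, hu]
    refine Prod.ext ?_ (funext fun k => ?_)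
    · exact sub_eq_zero.2 hd
    · exact sub_eq_zero.2 (congrFun hR k)
  have hfd : HasFDerivAt f (fderiv ℂ f u) u :=
    ((hfs.contDiffAt).differentiableAt hn).hasFDerivAt
  -- A kernel vector `(a, x)` of the partial derivative satisfies `L · x = 0` and `M₀ x = a R + μ₀
  -- x`. Pairing with `L` gives `a = 0`, and then simplicity of the eigenvalue gives `x = 0`.
  have hinj : Function.Injective (fderiv ℂ f u ∘L .inr ℂ (Fin N → Fin N → ℂ) (ℂ × (Fin N → ℂ))) := by
    rw [injective_iff_map_eq_zero]
    rintro ⟨a, x⟩ hax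
    simp only [ContinuousLinearMap.comp_apply, ContinuousLinearMap.inr_apply] at hax
    have hline : HasDerivAt (fun t : ℂ => u + t • ((0, (a, x)) :
        (Fin N → Fin N → ℂ) × (ℂ × (Fin N → ℂ)))) (0, (a, x)) 0 := by
      simpa using ((hasDerivAt_id (0 : ℂ)).smul_const ((0, (a, x)) :
        (Fin N → Fin N → ℂ) × (ℂ × (Fin N → ℂ)))).const_add u
    have hcomp := HasFDerivAt.comp_hasDerivAt (x := (0 : ℂ)) (l := f) (l' := fderiv ℂ f u)
      (f := fun t : ℂ => u + t • ((0, (a, x)) :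
        (Fin N → Fin N → ℂ) × (ℂ × (Fin N → ℂ)))) (by simpa using hfd) hline
    rw [hax] at hcomp
    have h1 : HasDerivAt (fun t : ℂ => ∑ j, L j * (R j + t * x j) - 1) 0 0 := by
      have := (ContinuousLinearMap.fst ℂ ℂ (Fin N → ℂ)).hasFDerivAt.comp_hasDerivAt 0 hcomp
      simpa [hf, hu, Function.comp_def] using this
    have h1' : HasDerivAt (fun t : ℂ => ∑ j, L j * (R j + t * x j) - 1) (∑ j, L j * x j) 0 := by
      refine (HasDerivAt.fun_sum fun j _ => ?_).sub_const 1
      simpa using (((hasDerivAt_id (0 : ℂ)).mul_const (x j)).const_add (R j)).const_mul (L j)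
    have h2 : ∀ k, HasDerivAt (fun t : ℂ => ∑ j, M₀ k j * (R j + t * x j)
        - (μ₀ + t * a) * (R k + t * x k)) 0 0 := by
      intro k
      have := hasDerivAt_pi.1 hcomp.snd k
      simpa [hf, hu, Function.comp_def] using this
    have h2' : ∀ k, HasDerivAt (fun t : ℂ => ∑ j, M₀ k j * (R j + t * x j)
        - (μ₀ + t * a) * (R k + t * x k)) (∑ j, M₀ k j * x j - (a * R k + μ₀ * x k)) 0 := by
      intro k
      refine (HasDerivAt.fun_sum fun j _ => ?_).sub ?_
      · simpa using (((hasDerivAt_id (0 : ℂ)).mul_const (x j)).const_add (R j)).const_mul (M₀ k j)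
      · simpa using! (((hasDerivAt_id (0 : ℂ)).mul_const a).const_add μ₀).mul
          (((hasDerivAt_id (0 : ℂ)).mul_const (x k)).const_add (R k))
    have hLx : L ⬝ᵥ x = 0 := h1'.unique h1
    have hMx : of M₀ *ᵥ x = a • R + μ₀ • x := by
      ext k
      have := (h2' k).unique (h2 k)
      rw [sub_eq_zero] at this
      exact this
    have ha : a = 0 := by
      have h3 : (L ᵥ* of M₀) ⬝ᵥ x = L ⬝ᵥ (of M₀ *ᵥ x) := (dotProduct_mulVec L (of M₀) x).symm
      rw [hL, hMx, smul_dotProduct, hLx, dotProduct_add, dotProduct_smul, dotProduct_smul, hLx,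
        hd] at h3
      simpa using h3.symm
    rw [ha, zero_smul, zero_add] at hMx
    have hx := huniq x hMx
    rw [hLx, zero_smul] at hx
    rw [ha, hx]
    rfl
  have hinv : (fderiv ℂ f u ∘L .inr ℂ (Fin N → Fin N → ℂ) (ℂ × (Fin N → ℂ))).IsInvertible := by
    refine ⟨(LinearEquiv.ofInjectiveEndo _ hinj).toContinuousLinearEquiv, ?_⟩
    ext1 <;> rfl
  have hfa : ContDiffAt ℂ n f u := hfs.contDiffAt
  refine ⟨fun M => (hfa.implicitFunction hn hinv M).1, fun M => (hfa.implicitFunction hn hinv M).2,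
    (hfa.contDiffAt_implicitFunction hn hinv).fst, (hfa.contDiffAt_implicitFunction hn hinv).snd,
    congrArg Prod.fst (hfa.implicitFunction_apply_self hn hinv),
    congrArg Prod.snd (hfa.implicitFunction_apply_self hn hinv), ?_⟩
  filter_upwards [hfa.eventually_apply_implicitFunction hn hinv] with M hM
  rw [hf0] at hM
  refine ⟨funext fun k => ?_, ?_⟩
  · exact sub_eq_zero.1 (congrFun (congrArg Prod.snd hM) k)
  · exact sub_eq_zero.1 (congrArg Prod.fst hM)

/-- Stability of a spectral gap under perturbation of the matrix. -/
theorem SpectralGap.exists_near {M₀ : Fin N → Fin N → ℂ} {μ₀ : ℂ} {R₀ L₀ : Fin N → ℂ}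
    (h : SpectralGap (of M₀) μ₀ R₀ L₀) {n : ℕ∞ω} (hn : n ≠ 0) :
    ContDiffAt ℂ n (fun M : Fin N → Fin N → ℂ => dominantEigenvalue (of M)) M₀ ∧
    ∃ (R L : (Fin N → Fin N → ℂ) → Fin N → ℂ) (k : ℕ) (w : Fin N → ℝ) (q : ℝ),
      ContinuousAt R M₀ ∧ ContinuousAt L M₀ ∧ R M₀ = R₀ ∧ L M₀ = L₀ ∧ k ≠ 0 ∧ (∀ i, 0 < w i) ∧
      0 ≤ q ∧ q < 1 ∧ ∀ᶠ M in 𝓝 M₀,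
        SpectralGap (of M) (dominantEigenvalue (of M)) (R M) (L M) ∧
        WBound (((dominantEigenvalue (of M))⁻¹ • of M - vecMulVec (R M) (L M)) ^ k) w q := by
  obtain ⟨μ, v, hμ, hv, hμ0, hv0, hev⟩ :=
    exists_smooth_eigenpair hn M₀ h.right h.left h.dot fun _ => h.right_unique
  set T : (Fin N → Fin N → ℂ) → (Fin N → Fin N → ℂ) := fun M i j => M j i with hT
  -- The left eigenvector is obtained as a right eigenvector of the transpose, normalized against
  -- `R₀`; dividing by `s` below restores the mutual normalization.
  have hTc : Continuous T := by fun_prop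
  obtain ⟨μ', ℓ, hμ', hℓ, hμ'0, hℓ0, hev'⟩ :=
    exists_smooth_eigenpair hn (T M₀) (μ₀ := μ₀) (R := L₀) (L := R₀)
      ((mulVec_transpose (of M₀) L₀).trans h.left) ((vecMul_transpose (of M₀) R₀).trans h.right)
      ((dotProduct_comm _ _).trans h.dot)
      (fun x hx => by
        rw [dotProduct_comm]
        exact h.left_unique ((mulVec_transpose (of M₀) x).symm.trans hx))
  have hev'' := (hTc.tendsto M₀).eventually hev'
  set s : (Fin N → Fin N → ℂ) → ℂ := fun M => ℓ (T M) ⬝ᵥ v M with hs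
  have hℓc : ContinuousAt (fun M => ℓ (T M)) M₀ :=
    ContinuousAt.comp (f := T) (g := ℓ) hℓ.continuousAt hTc.continuousAt
  have hsc : ContinuousAt s M₀ := by
    simp only [hs, dotProduct]
    refine tendsto_finsetSum _ fun j _ => ?_
    exact (((continuous_apply j).continuousAt).comp hℓc).mul
      (((continuous_apply j).continuousAt).comp hv.continuousAt)
  have hs0 : s M₀ = 1 := by simp only [hs]; rw [hℓ0, hv0, h.dot]
  set L : (Fin N → Fin N → ℂ) → Fin N → ℂ := fun M => (s M)⁻¹ • ℓ (T M) with hLdef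
  have hLc : ContinuousAt L M₀ := (hsc.inv₀ (by rw [hs0]; exact one_ne_zero)).smul hℓc
  have hL0 : L M₀ = L₀ := by
    change (s M₀)⁻¹ • ℓ (T M₀) = L₀
    rw [hs0, hℓ0]; simp
  set B : (Fin N → Fin N → ℂ) → Matrix (Fin N) (Fin N) ℂ :=
    fun M => (μ M)⁻¹ • of M - vecMulVec (v M) (L M) with hB
  have hμne : μ M₀ ≠ 0 := by rw [hμ0]; exact h.ne_zero
  have hBc : ContinuousAt B M₀ := by
    refine continuousAt_pi.2 fun i => continuousAt_pi.2 fun j => ?_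
    have h1 : ContinuousAt (fun M : Fin N → Fin N → ℂ => M i j) M₀ :=
      (continuous_apply_apply i j).continuousAt
    have h2 : ContinuousAt (fun M => v M i) M₀ :=
      (continuous_apply i).continuousAt.comp hv.continuousAt
    have h3 : ContinuousAt (fun M => L M j) M₀ := (continuous_apply j).continuousAt.comp hLc
    exact ((hμ.continuousAt.inv₀ hμne).mul h1).sub (h2.mul h3)
  have h1 := h.smul (inv_ne_zero h.ne_zero)
  rw [inv_mul_cancel₀ h.ne_zero] at h1
  obtain ⟨k, w, c, hk, hw, hc, hlt, hb⟩ := h1.gap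
  rw [norm_one, one_pow] at hlt
  have hB0 : B M₀ = μ₀⁻¹ • of M₀ - (1 : ℂ) • vecMulVec R₀ L₀ := by
    simp only [hB]; rw [hμ0, hv0, hL0, one_smul]
  have hBk : Tendsto (fun M => B M ^ k) (𝓝 M₀) (𝓝 (B M₀ ^ k)) :=
    ((continuous_pow k).tendsto _).comp hBc
  rw [← hB0] at hb
  have hbev := WBound.eventually hw hBk hb (show c < (c + 1) / 2 by linarith)
  have hgap : ∀ᶠ M in 𝓝 M₀, SpectralGap (of M) (μ M) (v M) (L M) ∧ WBound (B M ^ k) w ((c + 1) / 2) := by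
    filter_upwards [hev, hev'', hbev, hμ.continuousAt.eventually_ne hμne,
      hsc.eventually_ne (show s M₀ ≠ 0 by rw [hs0]; exact one_ne_zero)] with M hM hM' hbM hμM hsM
    have hl : ℓ (T M) ᵥ* of M = μ' (T M) • ℓ (T M) := by
      rw [← hM'.1]; exact (mulVec_transpose (of M) _).symm
    -- The two applications of the implicit function theorem give the same eigenvalue, because the
    -- left and right eigenvectors are not orthogonal near `M₀`.
    have hμμ : μ' (T M) = μ M := by
      have h3 : (ℓ (T M) ᵥ* of M) ⬝ᵥ v M = ℓ (T M) ⬝ᵥ (of M *ᵥ v M) :=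
        (dotProduct_mulVec _ _ _).symm
      rw [hl, hM.1, smul_dotProduct, dotProduct_smul, smul_eq_mul, smul_eq_mul] at h3
      exact mul_right_cancel₀ hsM h3
    refine ⟨⟨hM.1, ?_, ?_, hμM, k, w, ‖(μ M) ^ k‖ * ((c + 1) / 2), hk, hw, by positivity, ?_, ?_⟩, hbM⟩
    · simp only [hLdef]
      rw [smul_vecMul, hl, hμμ, smul_comm]
    · simp only [hLdef]
      rw [smul_dotProduct, smul_eq_mul]
      exact inv_mul_cancel₀ hsM
    · rw [norm_pow]
      exact mul_lt_of_lt_one_right (pow_pos (norm_pos_iff.2 hμM) k) (by linarith)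
    · have h4 : of M - μ M • vecMulVec (v M) (L M) = μ M • B M := by
        simp only [hB]
        rw [smul_sub, smul_smul, mul_inv_cancel₀ hμM, one_smul]
      rw [h4, smul_pow]
      exact hbM.smul _
  have hdom : ∀ᶠ M in 𝓝 M₀, dominantEigenvalue (of M) = μ M := by
    filter_upwards [hgap] with M hM using hM.1.dominantEigenvalue_eq
  refine ⟨hμ.congr_of_eventuallyEq hdom, v, L, k, w, (c + 1) / 2, hv.continuousAt, hLc, hv0, hL0,
    hk, hw, by positivity, by linarith, ?_⟩
  filter_upwards [hgap, hdom] with M hM hd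
  rw [hd]
  exact hM

end Perturbation

/-! ### Smoothness of multidimensional exponential sums -/

section ExponentialSums

variable {d : ℕ}

/-- The linear form `z ↦ x · z` on `ℂ^d`. -/
def dotC (x : Fin d → ℤ) : (Fin d → ℂ) →L[ℂ] ℂ :=
  ∑ i, (x i : ℂ) • ContinuousLinearMap.proj (R := ℂ) (φ := fun _ : Fin d => ℂ) i

lemma dotC_apply (x : Fin d → ℤ) (z : Fin d → ℂ) : dotC x z = ∑ i, (x i : ℂ) * z i := by
  simp [dotC]

/-- The real part of a point of `ℂ^d`. -/
def reVec (z : Fin d → ℂ) : EuclideanSpace ℝ (Fin d) := WithLp.toLp 2 fun i => (z i).re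

lemma continuous_reVec : Continuous (reVec (d := d)) := by
  unfold reVec
  refine (PiLp.continuous_toLp 2 (fun _ : Fin d => ℝ)).comp ?_
  fun_prop

lemma inner_toVec (u : EuclideanSpace ℝ (Fin d)) (x : Fin d → ℤ) :
    inner ℝ u (toVec x) = ∑ i, (x i : ℝ) * u i := by
  simp [PiLp.inner_apply, toVec]

lemma dotC_re (x : Fin d → ℤ) (z : Fin d → ℂ) : (dotC x z).re = inner ℝ (reVec z) (toVec x) := by
  simp [dotC_apply, inner_toVec, reVec]

lemma norm_cexp_dotC (x : Fin d → ℤ) (z : Fin d → ℂ) :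
    ‖Complex.exp (dotC x z)‖ = Real.exp (inner ℝ (reVec z) (toVec x)) := by
  rw [Complex.norm_exp, dotC_re]

/-- The `ℓ¹` norm of a lattice point. -/
def absSum (x : Fin d → ℤ) : ℝ := ∑ i, |(x i : ℝ)|

lemma absSum_nonneg (x : Fin d → ℤ) : 0 ≤ absSum x := Finset.sum_nonneg fun _ _ => abs_nonneg _

lemma norm_dotC_le (x : Fin d → ℤ) : ‖dotC x‖ ≤ absSum x := by
  refine ContinuousLinearMap.opNorm_le_bound _ (absSum_nonneg x) fun z => ?_
  rw [dotC_apply, absSum, Finset.sum_mul]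
  refine (norm_sum_le _ _).trans (Finset.sum_le_sum fun i _ => ?_)
  rw [norm_mul, Complex.norm_intCast]
  gcongr
  exact norm_le_pi_norm z i

/-- The `ℓ¹` norm is at most `d` times the largest coordinate, whose exponential is one of the terms
on the right. The summand `1` serves the case `d = 0`. -/
lemma exp_mul_absSum_le {κ : ℝ} (hκ : 0 ≤ κ) (x : Fin d → ℤ) :
    Real.exp (κ * absSum x) ≤
      1 + ∑ i, (Real.exp (κ * d * x i) + Real.exp (-(κ * d * x i))) := by
  rcases Nat.eq_zero_or_pos d with rfl | hd
  · simp [absSum]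
  obtain ⟨i, -, hi⟩ := Finset.exists_max_image (Finset.univ : Finset (Fin d))
    (fun i => |(x i : ℝ)|) ⟨⟨0, hd⟩, Finset.mem_univ _⟩
  have h1 : absSum x ≤ d * |(x i : ℝ)| := by
    calc absSum x ≤ ∑ _j : Fin d, |(x i : ℝ)| := Finset.sum_le_sum fun j hj => hi j hj
      _ = d * |(x i : ℝ)| := by simp
  calc Real.exp (κ * absSum x) ≤ Real.exp (|κ * d * x i|) := by
        rw [abs_mul, abs_of_nonneg (show 0 ≤ κ * (d : ℝ) by positivity), mul_assoc]
        gcongr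
    _ ≤ Real.exp (κ * d * x i) + Real.exp (-(κ * d * x i)) := by
        rcases abs_cases (κ * d * (x i : ℝ)) with ⟨h, -⟩ | ⟨h, -⟩ <;> rw [h]
        · linarith [Real.exp_pos (-(κ * d * (x i : ℝ)))]
        · linarith [Real.exp_pos (κ * d * (x i : ℝ))]
    _ ≤ ∑ i, (Real.exp (κ * d * x i) + Real.exp (-(κ * d * x i))) :=
        Finset.single_le_sum (f := fun i => Real.exp (κ * d * x i) + Real.exp (-(κ * d * x i)))
          (fun _ _ => by positivity) (Finset.mem_univ i)
    _ ≤ _ := by linarith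

/-- In the interior of the domain of convergence there is room for an exponential weight. -/
lemma exists_summable_exp_absSum {a : (Fin d → ℤ) → ℝ} {U : Set (EuclideanSpace ℝ (Fin d))}
    (hU : IsOpen U)
    (h : ∀ u ∈ U, Summable fun x => a x * Real.exp (inner ℝ u (toVec x)))
    {u : EuclideanSpace ℝ (Fin d)} (hu : u ∈ U) (ha : ∀ x, 0 ≤ a x) :
    ∃ κ > 0, Summable fun x => a x * Real.exp (inner ℝ u (toVec x)) * Real.exp (κ * absSum x) := by
  have hev : ∀ᶠ t in 𝓝 (0 : ℝ), ∀ i : Fin d,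
      u + EuclideanSpace.single i t ∈ U ∧ u + EuclideanSpace.single i (-t) ∈ U := by
    refine eventually_all.2 fun i => ?_
    have hc : Continuous fun t : ℝ => (EuclideanSpace.single i t : EuclideanSpace ℝ (Fin d)) := by
      refine (PiLp.continuous_toLp 2 (fun _ : Fin d => ℝ)).comp ?_
      refine continuous_pi fun j => ?_
      by_cases hij : j = i
      · subst hij
        simpa using! continuous_id
      · simpa [hij] using! continuous_const
    have h1 : Continuous fun t : ℝ => u + EuclideanSpace.single i t := continuous_const.add hc
    have h2 : Continuous fun t : ℝ => u + EuclideanSpace.single i (-t) :=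
      continuous_const.add (hc.comp continuous_neg)
    have h0 : (EuclideanSpace.single i 0 : EuclideanSpace ℝ (Fin d)) = 0 := by
      ext j
      simp
    exact (h1.continuousAt.eventually (hU.mem_nhds (by simpa [h0] using hu))).and
      (h2.continuousAt.eventually (hU.mem_nhds (by simpa [h0] using hu)))
  obtain ⟨ρ, hρ, hρU⟩ := Metric.eventually_nhds_iff.1 hev
  -- Chosen so that the shifts of `u` by `± κ d` along each axis stay in `U`; dividing by `d + 1`
  -- rather than `d` allows `d = 0`.
  set κ := ρ / 2 / (d + 1) with hκ
  have hκ0 : 0 < κ := by positivity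
  have hκd : κ * d < ρ := by
    rw [hκ, div_mul_eq_mul_div, div_lt_iff₀ (by positivity)]
    nlinarith
  refine ⟨κ, hκ0, ?_⟩
  have hs := hρU (y := κ * d) (by
    rw [Real.dist_eq, sub_zero, abs_of_nonneg (by positivity)]; exact hκd)
  have hsum : Summable fun x => a x * Real.exp (inner ℝ u (toVec x)) +
      ∑ i : Fin d, (a x * Real.exp (inner ℝ (u + EuclideanSpace.single i (κ * d)) (toVec x)) +
        a x * Real.exp (inner ℝ (u + EuclideanSpace.single i (-(κ * d))) (toVec x))) :=
    (h u hu).add (summable_sum fun i _ => (h _ (hs i).1).add (h _ (hs i).2))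
  refine hsum.of_nonneg_of_le
    (fun x => mul_nonneg (mul_nonneg (ha x) (Real.exp_pos _).le) (Real.exp_pos _).le) fun x => ?_
  have h1 : ∀ i : Fin d, ∀ t : ℝ, inner ℝ (EuclideanSpace.single i t) (toVec x) = t * x i := by
    intro i t
    rw [EuclideanSpace.inner_single_left]
    simp [toVec]
  simp only [inner_add_left, h1, Real.exp_add]
  calc a x * Real.exp (inner ℝ u (toVec x)) * Real.exp (κ * absSum x)
      ≤ a x * Real.exp (inner ℝ u (toVec x)) *
        (1 + ∑ i, (Real.exp (κ * d * x i) + Real.exp (-(κ * d * x i)))) :=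
        mul_le_mul_of_nonneg_left (exp_mul_absSum_le hκ0.le x)
          (mul_nonneg (ha x) (Real.exp_pos _).le)
    _ = _ := by
        rw [mul_add, mul_one, Finset.mul_sum]
        congr 1
        refine Finset.sum_congr rfl fun i _ => ?_
        rw [neg_mul]
        ring

/-- The exponential sum `∑_x e^{x · z} f(x)`. -/
def expSum {E : Type*} [NormedAddCommGroup E] [NormedSpace ℂ E] (f : (Fin d → ℤ) → E)
    (z : Fin d → ℂ) : E :=
  ∑' x, Complex.exp (dotC x z) • f x

lemma summable_expSum {E : Type*} [NormedAddCommGroup E] [NormedSpace ℂ E] [CompleteSpace E]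
    {f : (Fin d → ℤ) → E} {z : Fin d → ℂ}
    (h : Summable fun x => ‖f x‖ * Real.exp (inner ℝ (reVec z) (toVec x))) :
    Summable fun x => Complex.exp (dotC x z) • f x := by
  refine Summable.of_norm (h.congr fun x => ?_)
  rw [norm_smul, norm_cexp_dotC, mul_comm]

/-- Term by term differentiation on a small ball: the derivative of a term gains a factor of size
`absSum x`, paid for by the spare exponential weight. -/
lemma hasFDerivAt_expSum {E : Type*} [NormedAddCommGroup E] [NormedSpace ℂ E] [CompleteSpace E]
    {f : (Fin d → ℤ) → E} {U : Set (EuclideanSpace ℝ (Fin d))} (hU : IsOpen U)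
    (h : ∀ u ∈ U, Summable fun x => ‖f x‖ * Real.exp (inner ℝ u (toVec x)))
    {z : Fin d → ℂ} (hz : reVec z ∈ U) :
    HasFDerivAt (expSum f) (expSum (fun x => (dotC x).smulRight (f x)) z) z := by
  obtain ⟨κ, hκ, hs⟩ := exists_summable_exp_absSum hU h hz (fun x => norm_nonneg _)
  -- Half of `κ` covers the variation of the exponential on the ball of radius `δ`, the other half
  -- the factor `absSum x`.
  set δ := κ / 2 with hδ
  have hδ0 : 0 < δ := by positivity
  have hbound : Summable fun x =>
      δ⁻¹ * (‖f x‖ * Real.exp (inner ℝ (reVec z) (toVec x)) * Real.exp (κ * absSum x)) :=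
    hs.mul_left _
  refine hasFDerivAt_tsum_of_isPreconnected (𝕜 := ℂ)
    (f' := fun x y => Complex.exp (dotC x y) • (dotC x).smulRight (f x)) hbound Metric.isOpen_ball
    (convex_ball z δ).isPreconnected ?_ ?_ (Metric.mem_ball_self hδ0)
    (summable_expSum (h _ hz)) (Metric.mem_ball_self hδ0)
  · intro x y _
    have h1 := ((dotC x).hasFDerivAt (x := y)).cexp.smul_const (f x)
    convert! h1 using 1
    ext v
    simp [smul_smul]
  · intro x y hy
    rw [norm_smul, ContinuousLinearMap.norm_smulRight_apply, norm_cexp_dotC]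
    have h2 : inner ℝ (reVec y) (toVec x) ≤ inner ℝ (reVec z) (toVec x) + δ * absSum x := by
      rw [← sub_le_iff_le_add', inner_toVec, inner_toVec, ← Finset.sum_sub_distrib, absSum,
        Finset.mul_sum]
      refine Finset.sum_le_sum fun i _ => ?_
      have h3 : |(reVec y) i - (reVec z) i| ≤ δ := by
        have h4 : (reVec y) i - (reVec z) i = ((y - z) i).re := by simp [reVec]
        rw [h4]
        refine (Complex.abs_re_le_norm _).trans ((norm_le_pi_norm _ i).trans ?_)
        rw [← dist_eq_norm]
        exact (Metric.mem_ball.1 hy).le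
      calc (x i : ℝ) * (reVec y) i - x i * (reVec z) i
          = x i * ((reVec y) i - (reVec z) i) := by ring
        _ ≤ |(x i : ℝ)| * |(reVec y) i - (reVec z) i| := by
            rw [← abs_mul]; exact le_abs_self _
        _ ≤ |(x i : ℝ)| * δ := by gcongr
        _ = δ * |(x i : ℝ)| := mul_comm _ _
    have h5 : absSum x ≤ δ⁻¹ * Real.exp (δ * absSum x) := by
      rw [← div_eq_inv_mul, le_div_iff₀ hδ0, mul_comm]
      linarith [Real.add_one_le_exp (δ * absSum x)]
    calc Real.exp (inner ℝ (reVec y) (toVec x)) * (‖dotC x‖ * ‖f x‖)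
        ≤ Real.exp (inner ℝ (reVec z) (toVec x) + δ * absSum x) *
          ((δ⁻¹ * Real.exp (δ * absSum x)) * ‖f x‖) := by
          gcongr
          exact (norm_dotC_le x).trans h5
      _ = _ := by
          rw [Real.exp_add, show κ * absSum x = δ * absSum x + δ * absSum x by rw [hδ]; ring,
            Real.exp_add]
          ring

lemma summable_smulRight {E : Type*} [NormedAddCommGroup E] [NormedSpace ℂ E]
    {f : (Fin d → ℤ) → E} {U : Set (EuclideanSpace ℝ (Fin d))} (hU : IsOpen U)
    (h : ∀ u ∈ U, Summable fun x => ‖f x‖ * Real.exp (inner ℝ u (toVec x))) :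
    ∀ u ∈ U, Summable fun x =>
      ‖(dotC x).smulRight (f x)‖ * Real.exp (inner ℝ u (toVec x)) := by
  intro u hu
  obtain ⟨κ, hκ, hs⟩ := exists_summable_exp_absSum hU h hu (fun x => norm_nonneg _)
  refine (hs.mul_left κ⁻¹).of_nonneg_of_le (fun x => by positivity) fun x => ?_
  rw [ContinuousLinearMap.norm_smulRight_apply]
  have h5 : absSum x ≤ κ⁻¹ * Real.exp (κ * absSum x) := by
    rw [← div_eq_inv_mul, le_div_iff₀ hκ, mul_comm]
    linarith [Real.add_one_le_exp (κ * absSum x)]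
  calc ‖dotC x‖ * ‖f x‖ * Real.exp (inner ℝ u (toVec x))
      ≤ (κ⁻¹ * Real.exp (κ * absSum x)) * ‖f x‖ * Real.exp (inner ℝ u (toVec x)) := by
        gcongr
        exact (norm_dotC_le x).trans h5
    _ = _ := by ring

/-- An exponential sum is smooth in the interior of its domain of convergence. -/
theorem contDiffAt_expSum (n : ℕ) {E : Type} [NormedAddCommGroup E] [NormedSpace ℂ E]
    [CompleteSpace E] {f : (Fin d → ℤ) → E} {U : Set (EuclideanSpace ℝ (Fin d))} (hU : IsOpen U)
    (h : ∀ u ∈ U, Summable fun x => ‖f x‖ * Real.exp (inner ℝ u (toVec x)))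
    {z : Fin d → ℂ} (hz : reVec z ∈ U) : ContDiffAt ℂ n (expSum f) z := by
  have hnhds : ∀ {z : Fin d → ℂ}, reVec z ∈ U → {y : Fin d → ℂ | reVec y ∈ U} ∈ 𝓝 z :=
    fun hz => (hU.preimage continuous_reVec).mem_nhds hz
  -- The derivative is again an exponential sum, with coefficients in a space of continuous linear
  -- maps and convergence on the same `U`; hence the coefficient space varies in the induction.
  induction n generalizing E with
  | zero =>
    refine contDiffAt_zero.2 ⟨_, hnhds hz, fun y hy => ?_⟩
    exact (hasFDerivAt_expSum hU h hy).continuousAt.continuousWithinAt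
  | succ n ih =>
    rw [Nat.cast_succ, contDiffAt_succ_iff_hasFDerivAt]
    exact ⟨_, ⟨_, hnhds hz, fun y hy => hasFDerivAt_expSum hU h hy⟩,
      ih (summable_smulRight hU h)⟩

end ExponentialSums

/-! ### Generating functions of the convolution powers -/

section Generating

open Matrix

variable {d N : ℕ} {p : TransitionKernel d N}

/-- The point `u + iξ` of `ℂ^d`. -/
def cplx (u ξ : EuclideanSpace ℝ (Fin d)) : Fin d → ℂ :=
  fun i => (u i : ℂ) + Complex.I * (ξ i : ℂ)

@[simp] lemma reVec_cplx (u ξ : EuclideanSpace ℝ (Fin d)) : reVec (cplx u ξ) = u := by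
  ext i
  simp [reVec, cplx]

lemma cexp_dotC_cplx (x : Fin d → ℤ) (u ξ : EuclideanSpace ℝ (Fin d)) :
    Complex.exp (dotC x (cplx u ξ)) = (Real.exp (inner ℝ u (toVec x)) : ℂ) *
      Complex.exp (Complex.I * ((inner ℝ (toVec x) ξ : ℝ) : ℂ)) := by
  rw [Complex.ofReal_exp, ← Complex.exp_add, dotC_apply, inner_toVec, real_inner_comm, inner_toVec]
  congr 1
  push_cast
  rw [Finset.mul_sum, ← Finset.sum_add_distrib]
  refine Finset.sum_congr rfl fun i _ => ?_
  simp only [cplx]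
  ring

/-- The matrix `F(z) = ∑_x p(0, x) e^{z · x}` at a complex point `z`. -/
def Fc (p : TransitionKernel d N) (z : Fin d → ℂ) : Matrix (Fin N) (Fin N) ℂ :=
  of fun k j => expSum (fun x => ((p (0, k) (x, j) : ℝ) : ℂ)) z

lemma psi_eq (p : TransitionKernel d N) (u ξ : EuclideanSpace ℝ (Fin d)) :
    psi p u ξ = Fc p (cplx u ξ) := by
  ext k j
  simp only [psi, Fc, of_apply, expSum]
  refine tsum_congr fun x => ?_
  rw [cexp_dotC_cplx, smul_eq_mul]
  push_cast
  ring

lemma F_map_eq (p : TransitionKernel d N) (u : EuclideanSpace ℝ (Fin d)) :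
    (F p u).map (fun a : ℝ => (a : ℂ)) = Fc p (cplx u 0) := by
  ext k j
  simp only [F, Fc, of_apply, expSum, map_apply]
  rw [Complex.ofReal_tsum]
  refine tsum_congr fun x => ?_
  rw [cexp_dotC_cplx, smul_eq_mul]
  push_cast
  simp
  ring

lemma FiniteAt.summable {u : EuclideanSpace ℝ (Fin d)} (h : FiniteAt p u) (k j : Fin N) :
    Summable fun x : Fin d → ℤ =>
      ‖((p (0, k) (x, j) : ℝ) : ℂ)‖ * Real.exp (inner ℝ u (toVec x)) :=
  (h k j).congr fun x => by
    rw [Complex.norm_real, Real.norm_of_nonneg (NNReal.coe_nonneg _)]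

lemma toVec_add (x y : Fin d → ℤ) : toVec (x + y) = toVec x + toVec y := by
  ext i; simp [toVec]

lemma toVec_zero : toVec (0 : Fin d → ℤ) = 0 := by
  ext i; simp [toVec]

lemma dotC_add (x y : Fin d → ℤ) : dotC (x + y) = dotC x + dotC y := by
  ext z; simp [dotC_apply, add_mul, Finset.sum_add_distrib]

lemma convPow_invariant (hinv : IsLatticeInvariant p) (n : ℕ) (x y : Fin d → ℤ) (k j : Fin N) :
    convPow p n (x, k) (y, j) = convPow p n (0, k) (y - x, j) := by
  induction n generalizing x y k with
  | zero =>
    simp only [convPow, Prod.mk.injEq, eq_comm (a := (0 : Fin d → ℤ)), sub_eq_zero,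
      eq_comm (a := y)]
  | succ n ih =>
    simp only [convPow]
    rw [← ((Equiv.addRight x).prodCongr (Equiv.refl (Fin N))).tsum_eq
      (fun c => (p (x, k) c : ℝ≥0∞) * convPow p n c (y, j))]
    refine tsum_congr fun ⟨c, l⟩ => ?_
    simp only [Equiv.prodCongr_apply, Prod.map_apply, Equiv.coe_addRight, Equiv.refl_apply]
    rw [hinv x, ih (c + x), ih c, add_sub_cancel_right]
    congr 2
    rw [sub_sub, add_comm]

lemma convPow_succ_eq (hinv : IsLatticeInvariant p) (n : ℕ) (y : Fin d → ℤ) (k j : Fin N) :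
    convPow p (n + 1) (0, k) (y, j) = ∑ l, ∑' x : Fin d → ℤ,
      (p (0, k) (x, l) : ℝ≥0∞) * convPow p n (0, l) (y - x, j) := by
  simp only [convPow]
  rw [ENNReal.tsum_prod', ENNReal.tsum_comm, tsum_fintype]
  refine Finset.sum_congr rfl fun l _ => tsum_congr fun x => ?_
  rw [convPow_invariant hinv n x]

/-- The generating function of the `n`-th convolution power is `F(u)^n`. -/
lemma tsum_convPow_mul_exp (hinv : IsLatticeInvariant p) {u : EuclideanSpace ℝ (Fin d)}
    (h : FiniteAt p u) (n : ℕ) (k j : Fin N) :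
    ∑' x : Fin d → ℤ, convPow p n (0, k) (x, j) *
      ENNReal.ofReal (Real.exp (inner ℝ u (toVec x))) = ENNReal.ofReal ((F p u ^ n) k j) := by
  have hF0 : ∀ k j, 0 ≤ F p u k j := fun k j => tsum_nonneg fun x => by positivity
  have hFn0 : ∀ n k j, 0 ≤ (F p u ^ n) k j := by
    intro n
    induction n with
    | zero => intro k j; rw [pow_zero, one_apply]; split_ifs <;> norm_num
    | succ n ih =>
      intro k j
      rw [pow_succ, mul_apply]
      exact Finset.sum_nonneg fun l _ => mul_nonneg (ih k l) (hF0 l j)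
  induction n generalizing k with
  | zero =>
    rw [tsum_eq_single 0]
    · simp only [convPow, toVec_zero, inner_zero_right, Real.exp_zero, ENNReal.ofReal_one,
        mul_one, pow_zero, one_apply]
      split_ifs <;> simp_all
    · intro x hx
      simp [convPow, hx.symm]
  | succ n ih =>
    have hp : ∀ l, ∑' x : Fin d → ℤ, (p (0, k) (x, l) : ℝ≥0∞) *
        ENNReal.ofReal (Real.exp (inner ℝ u (toVec x))) = ENNReal.ofReal (F p u k l) := by
      intro l
      simp only [F, of_apply]
      rw [ENNReal.ofReal_tsum_of_nonneg (fun x => by positivity) (h k l)]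
      refine tsum_congr fun x => ?_
      rw [ENNReal.ofReal_mul (by positivity), ENNReal.ofReal_coe_nnreal]
    calc ∑' y : Fin d → ℤ, convPow p (n + 1) (0, k) (y, j) *
          ENNReal.ofReal (Real.exp (inner ℝ u (toVec y)))
        = ∑' y : Fin d → ℤ, ∑ l, ∑' x : Fin d → ℤ, ((p (0, k) (x, l) : ℝ≥0∞) *
            ENNReal.ofReal (Real.exp (inner ℝ u (toVec x)))) * (convPow p n (0, l) (y - x, j) *
            ENNReal.ofReal (Real.exp (inner ℝ u (toVec (y - x))))) := by
          refine tsum_congr fun y => ?_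
          rw [convPow_succ_eq hinv, Finset.sum_mul]
          refine Finset.sum_congr rfl fun l _ => ?_
          rw [← ENNReal.tsum_mul_right]
          refine tsum_congr fun x => ?_
          have : toVec y = toVec x + toVec (y - x) := by rw [← toVec_add, add_sub_cancel]
          rw [this, inner_add_right, Real.exp_add, ENNReal.ofReal_mul (Real.exp_pos _).le]
          ring
      _ = ∑ l, ∑' x : Fin d → ℤ, ((p (0, k) (x, l) : ℝ≥0∞) *
            ENNReal.ofReal (Real.exp (inner ℝ u (toVec x)))) * ENNReal.ofReal ((F p u ^ n) l j) := by
          rw [Summable.tsum_finsetSum (fun _ _ => ENNReal.summable)]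
          refine Finset.sum_congr rfl fun l _ => ?_
          rw [ENNReal.tsum_comm]
          refine tsum_congr fun x => ?_
          rw [ENNReal.tsum_mul_left, ← ih l]
          congr 1
          exact (Equiv.subRight x).tsum_eq (fun y => convPow p n (0, l) (y, j) *
            ENNReal.ofReal (Real.exp (inner ℝ u (toVec y))))
      _ = ENNReal.ofReal ((F p u ^ (n + 1)) k j) := by
          rw [pow_succ', mul_apply, ENNReal.ofReal_sum_of_nonneg
            (fun l _ => mul_nonneg (hF0 k l) (hFn0 n l j))]
          refine Finset.sum_congr rfl fun l _ => ?_
          rw [ENNReal.tsum_mul_right, hp, ENNReal.ofReal_mul (hF0 k l)]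

/-- An infinite term would make the generating series infinite, while it equals an entry of a real
matrix. -/
lemma convPow_ne_top (hinv : IsLatticeInvariant p) {u : EuclideanSpace ℝ (Fin d)}
    (h : FiniteAt p u) (n : ℕ) (k j : Fin N) (x : Fin d → ℤ) :
    convPow p n (0, k) (x, j) ≠ ⊤ := by
  intro htop
  have h1 := ENNReal.le_tsum (f := fun x : Fin d → ℤ => convPow p n (0, k) (x, j) *
      ENNReal.ofReal (Real.exp (inner ℝ u (toVec x)))) x
  rw [tsum_convPow_mul_exp hinv h, htop, ENNReal.top_mul (by simp [Real.exp_pos])] at h1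
  exact absurd h1 (by simp)

lemma F_pow_nonneg (n : ℕ) (u : EuclideanSpace ℝ (Fin d)) (k j : Fin N) :
    0 ≤ (F p u ^ n) k j := by
  induction n generalizing j with
  | zero => rw [pow_zero, one_apply]; split_ifs <;> norm_num
  | succ n ih =>
    rw [pow_succ, mul_apply]
    exact Finset.sum_nonneg fun l _ => mul_nonneg (ih l) (tsum_nonneg fun x => by positivity)

/-- The identity in `[0, ∞]` has a finite value, which yields the summability needed to pass to real
numbers. -/
lemma hasSum_convPow_mul_exp (hinv : IsLatticeInvariant p) {u : EuclideanSpace ℝ (Fin d)}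
    (h : FiniteAt p u) (n : ℕ) (k j : Fin N) :
    HasSum (fun x : Fin d → ℤ => (convPow p n (0, k) (x, j)).toReal *
      Real.exp (inner ℝ u (toVec x))) ((F p u ^ n) k j) := by
  have h1 := tsum_convPow_mul_exp hinv h n k j
  have h2 : ∀ x : Fin d → ℤ, (convPow p n (0, k) (x, j) *
      ENNReal.ofReal (Real.exp (inner ℝ u (toVec x)))).toReal =
      (convPow p n (0, k) (x, j)).toReal * Real.exp (inner ℝ u (toVec x)) := fun x => by
    rw [ENNReal.toReal_mul, ENNReal.toReal_ofReal (Real.exp_pos _).le]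
  have h3 := ENNReal.hasSum_toReal (f := fun x : Fin d → ℤ => convPow p n (0, k) (x, j) *
      ENNReal.ofReal (Real.exp (inner ℝ u (toVec x)))) (by rw [h1]; exact ENNReal.ofReal_ne_top)
  simp only [h2] at h3
  rw [← tsum_congr h2, ← ENNReal.tsum_toReal_eq, h1, ENNReal.toReal_ofReal (F_pow_nonneg n u k j)]
    at h3
  · exact h3
  · intro x
    exact ENNReal.mul_ne_top (convPow_ne_top hinv h n k j x) ENNReal.ofReal_ne_top

/-- The product of the sums is a sum over pairs; the shear `(y, x) ↦ (x, y - x)` regroups it by the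
total displacement `y`. -/
lemma hasSum_convolution {G : Type*} [AddCommGroup G] {f g : G → ℂ} (hf : Summable fun x => ‖f x‖)
    (hg : Summable fun x => ‖g x‖) :
    (∀ y, Summable fun x => f x * g (y - x)) ∧
    HasSum (fun y => ∑' x, f x * g (y - x)) ((∑' x, f x) * ∑' x, g x) := by
  have h1 := summable_mul_of_summable_norm hf hg
  have h2 := tsum_mul_tsum_of_summable_norm hf hg
  set e : G × G ≃ G × G :=
    { toFun := fun q => (q.2, q.1 - q.2)
      invFun := fun q => (q.1 + q.2, q.1)
      left_inv := fun q => by simp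
      right_inv := fun q => by simp } with he
  have h3 : Summable fun q : G × G => f q.2 * g (q.1 - q.2) := (e.summable_iff).2 h1
  have h4 : ∑' q : G × G, f q.2 * g (q.1 - q.2) = (∑' x, f x) * ∑' x, g x := by
    rw [h2]
    exact e.tsum_eq (fun q : G × G => f q.1 * g q.2)
  have h5 := h3.hasSum
  rw [h4] at h5
  exact ⟨fun y => h3.prod_factor y, h5.prod_fiberwise fun y => (h3.prod_factor y).hasSum⟩

/-- The characteristic function of the `n`-th convolution power is `F(z)^n`. -/
lemma hasSum_convPow_cexp (hinv : IsLatticeInvariant p) {z : Fin d → ℂ}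
    (h : FiniteAt p (reVec z)) (n : ℕ) (k j : Fin N) :
    HasSum (fun x : Fin d → ℤ => ((convPow p n (0, k) (x, j)).toReal : ℂ) *
      Complex.exp (dotC x z)) ((Fc p z ^ n) k j) := by
  have hsum : ∀ n k j, Summable fun x : Fin d → ℤ => ‖((convPow p n (0, k) (x, j)).toReal : ℂ) *
      Complex.exp (dotC x z)‖ := fun n k j =>
    (hasSum_convPow_mul_exp hinv h n k j).summable.congr fun x => by
      rw [norm_mul, norm_cexp_dotC, Complex.norm_real, Real.norm_of_nonneg ENNReal.toReal_nonneg]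
  induction n generalizing k with
  | zero =>
    convert! hasSum_ite_eq (0 : Fin d → ℤ) (((1 : Matrix (Fin N) (Fin N) ℂ)) k j) using 1
    ext x
    by_cases hx : x = 0
    · subst hx
      by_cases hkj : k = j <;> simp [convPow, hkj, dotC_apply, one_apply]
    · simp [convPow, hx, Ne.symm hx]
  | succ n ih =>
    have hps : ∀ l, Summable fun x : Fin d → ℤ =>
        ‖((p (0, k) (x, l) : ℝ) : ℂ) * Complex.exp (dotC x z)‖ := fun l =>
      (h.summable k l).congr fun x => by rw [norm_mul, norm_cexp_dotC]
    have hconv := fun l => hasSum_convolution (hps l) (hsum n l j)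
    have hterm : ∀ y : Fin d → ℤ, ((convPow p (n + 1) (0, k) (y, j)).toReal : ℂ) *
        Complex.exp (dotC y z) = ∑ l, ∑' x : Fin d → ℤ,
          (((p (0, k) (x, l) : ℝ) : ℂ) * Complex.exp (dotC x z)) *
          (((convPow p n (0, l) (y - x, j)).toReal : ℂ) * Complex.exp (dotC (y - x) z)) := by
      intro y
      have hfin : ∀ l, ∑' x : Fin d → ℤ, (p (0, k) (x, l) : ℝ≥0∞) *
          convPow p n (0, l) (y - x, j) ≠ ⊤ := by
        have h1 := convPow_ne_top hinv h (n + 1) k j y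
        rw [convPow_succ_eq hinv] at h1
        exact fun l => (ENNReal.sum_ne_top.1 h1) l (Finset.mem_univ _)
      rw [convPow_succ_eq hinv, ENNReal.toReal_sum (fun l _ => hfin l), Complex.ofReal_sum,
        Finset.sum_mul]
      refine Finset.sum_congr rfl fun l _ => ?_
      rw [ENNReal.tsum_toReal_eq (fun x => ENNReal.mul_ne_top ENNReal.coe_ne_top
        (convPow_ne_top hinv h n l j _)), Complex.ofReal_tsum, ← tsum_mul_right]
      refine tsum_congr fun x => ?_
      have : dotC y z = dotC x z + dotC (y - x) z := by
        rw [← _root_.add_apply, ← dotC_add, add_sub_cancel]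
      rw [this, Complex.exp_add, ENNReal.toReal_mul]
      push_cast
      simp
      ring
    simp only [hterm]
    rw [pow_succ', mul_apply]
    refine hasSum_sum fun l _ => ?_
    have h1 := (hconv l).2
    rw [(ih l).tsum_eq] at h1
    convert! h1 using 2
    simp only [Fc, of_apply, expSum, smul_eq_mul]
    exact tsum_congr fun x => mul_comm _ _

end Generating

/-! ### Fourier inversion on the torus -/

section Fourier

open Matrix MeasureTheory

variable {d N : ℕ} {p : TransitionKernel d N}

/-- The fundamental box `(-π, π]^d`. -/
def box (d : ℕ) : Set (Fin d → ℝ) := Set.univ.pi fun _ => Set.Ioc (-Real.pi) Real.pi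

lemma measurableSet_box : MeasurableSet (box d) :=
  MeasurableSet.univ_pi fun _ => measurableSet_Ioc

lemma norm_le_of_mem_box {ξ : Fin d → ℝ} (h : ξ ∈ box d) : ‖ξ‖ ≤ Real.pi :=
  (pi_norm_le_iff_of_nonneg Real.pi_pos.le).2 fun i =>
    abs_le.2 ⟨(h i (Set.mem_univ i)).1.le, (h i (Set.mem_univ i)).2⟩

lemma volume_box_lt_top : volume (box d) < ⊤ := by
  rw [box, volume_pi_pi]
  exact ENNReal.prod_lt_top fun i _ => by simp

lemma integral_cexp_int (m : ℤ) : ∫ t in Set.Ioc (-Real.pi) Real.pi,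
    Complex.exp (Complex.I * (m * (t : ℂ))) = if m = 0 then ((2 * Real.pi : ℝ) : ℂ) else 0 := by
  rw [← intervalIntegral.integral_of_le (by linarith [Real.pi_pos])]
  split_ifs with hm
  · subst hm
    simp
    ring
  · have hc : Complex.I * (m : ℂ) ≠ 0 := mul_ne_zero Complex.I_ne_zero (by exact_mod_cast hm)
    have h1 := integral_exp_mul_complex (a := -Real.pi) (b := Real.pi) hc
    simp only [mul_assoc] at h1
    rw [h1]
    have h2 : Complex.exp (Complex.I * ((m : ℂ) * (Real.pi : ℂ)))
        = Complex.exp (Complex.I * ((m : ℂ) * ((-Real.pi : ℝ) : ℂ))) := by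
      rw [Complex.exp_eq_exp_iff_exists_int]
      refine ⟨m, ?_⟩
      push_cast
      ring
    rw [h2, sub_self, zero_div]

lemma integral_box_cexp (m : Fin d → ℤ) : ∫ ξ in box d,
    Complex.exp (Complex.I * ∑ i, (m i : ℂ) * (ξ i : ℂ)) =
      if m = 0 then ((2 * Real.pi : ℝ) : ℂ) ^ d else 0 := by
  have h1 : ∀ ξ : Fin d → ℝ, Complex.exp (Complex.I * ∑ i, (m i : ℂ) * (ξ i : ℂ))
      = ∏ i, Complex.exp (Complex.I * ((m i : ℂ) * (ξ i : ℂ))) := fun ξ => by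
    rw [Finset.mul_sum, Complex.exp_sum]
  simp only [h1]
  rw [volume_pi, box, Measure.restrict_pi_pi,
    integral_fintype_prod_eq_prod (fun i (t : ℝ) => Complex.exp (Complex.I * ((m i : ℂ) * (t : ℂ))))]
  simp only [integral_cexp_int]
  split_ifs with hm
  · subst hm
    simp
  · obtain ⟨i, hi⟩ : ∃ i, m i ≠ 0 := by
      by_contra! hc
      exact hm (funext hc)
    exact Finset.prod_eq_zero (Finset.mem_univ i) (if_neg hi)

lemma dotC_cplx_toLp (x : Fin d → ℤ) (u : EuclideanSpace ℝ (Fin d)) (ξ : Fin d → ℝ) :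
    Complex.exp (dotC x (cplx u (WithLp.toLp 2 ξ))) = (Real.exp (inner ℝ u (toVec x)) : ℂ) *
      Complex.exp (Complex.I * ∑ i, (x i : ℂ) * (ξ i : ℂ)) := by
  have h : inner ℝ (toVec x) (WithLp.toLp 2 ξ) = ∑ i, (x i : ℝ) * ξ i := by
    rw [real_inner_comm, inner_toVec]
  rw [cexp_dotC_cplx, h]
  push_cast
  rfl

/-- Fourier inversion for the convolution powers. -/
lemma integral_box_Fc_pow (hinv : IsLatticeInvariant p) {u : EuclideanSpace ℝ (Fin d)}
    (h : FiniteAt p u) (n : ℕ) (k j : Fin N) (x : Fin d → ℤ) :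
    ∫ ξ in box d, Complex.exp (-Complex.I * ∑ i, (x i : ℂ) * (ξ i : ℂ)) *
      (Fc p (cplx u (WithLp.toLp 2 ξ)) ^ n) k j =
      ((2 * Real.pi : ℝ) : ℂ) ^ d * ((P p n u x k j : ℝ) : ℂ) := by
  set b : (Fin d → ℤ) → ℝ := fun y => (convPow p n (0, k) (y, j)).toReal *
    Real.exp (inner ℝ u (toVec y)) with hb
  have hbs : Summable b := (hasSum_convPow_mul_exp hinv h n k j).summable
  have hb0 : ∀ y, 0 ≤ b y := fun y => mul_nonneg ENNReal.toReal_nonneg (Real.exp_pos _).le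
  set g : (Fin d → ℤ) → (Fin d → ℝ) → ℂ := fun y ξ =>
    (b y : ℂ) * Complex.exp (Complex.I * ∑ i, ((y - x) i : ℂ) * (ξ i : ℂ)) with hg
  have hgn : ∀ y ξ, ‖g y ξ‖ = b y := by
    intro y ξ
    have : Complex.I * ∑ i, (((y - x) i : ℤ) : ℂ) * (ξ i : ℂ)
        = ((∑ i, ((y - x) i : ℝ) * ξ i : ℝ) : ℂ) * Complex.I := by
      push_cast; ring
    rw [hg]
    simp only
    rw [norm_mul, this, Complex.norm_exp_ofReal_mul_I, mul_one, Complex.norm_real,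
      Real.norm_of_nonneg (hb0 y)]
  have hgc : ∀ y, Continuous (g y) := fun y => by simp only [hg]; fun_prop
  have : IsFiniteMeasure (volume.restrict (box d)) :=
    ⟨by rw [Measure.restrict_apply_univ]; exact volume_box_lt_top⟩
  have hgi : ∀ y, Integrable (g y) (volume.restrict (box d)) := fun y =>
    Integrable.of_bound (hgc y).aestronglyMeasurable (b y)
      (Eventually.of_forall fun ξ => (hgn y ξ).le)
  -- Each term has constant modulus `b y`, so finiteness of the entry of `F(u)^n` justifies
  -- exchanging sum and integral.
  have hsum : Summable fun y => ∫ ξ in box d, ‖g y ξ‖ := by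
    simp only [hgn, integral_const]
    exact hbs.const_smul _
  have h1 := hasSum_integral_of_summable_integral_norm hgi hsum
  have h2 : ∀ ξ : Fin d → ℝ, ∑' y, g y ξ =
      Complex.exp (-Complex.I * ∑ i, (x i : ℂ) * (ξ i : ℂ)) *
      (Fc p (cplx u (WithLp.toLp 2 ξ)) ^ n) k j := by
    intro ξ
    rw [← (hasSum_convPow_cexp hinv (z := cplx u (WithLp.toLp 2 ξ)) (by simpa using h) n k j).tsum_eq,
      ← tsum_mul_left]
    refine tsum_congr fun y => ?_
    have h3 : Complex.exp (Complex.I * ∑ i, (((y - x) i : ℤ) : ℂ) * (ξ i : ℂ)) =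
        Complex.exp (-Complex.I * ∑ i, (x i : ℂ) * (ξ i : ℂ)) *
        Complex.exp (Complex.I * ∑ i, (y i : ℂ) * (ξ i : ℂ)) := by
      rw [← Complex.exp_add]
      congr 1
      simp only [Pi.sub_apply, Int.cast_sub, sub_mul, Finset.sum_sub_distrib]
      ring
    simp only [hg, hb]
    rw [dotC_cplx_toLp, h3]
    push_cast
    ring
  have h4 : ∀ y, ∫ ξ in box d, g y ξ = if y = x then ((2 * Real.pi : ℝ) : ℂ) ^ d * (b x : ℂ) else 0 := by
    intro y
    simp only [hg]
    rw [integral_const_mul, integral_box_cexp]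
    simp only [sub_eq_zero]
    split_ifs with hyx
    · rw [hyx, mul_comm]
    · rw [mul_zero]
  simp only [h4, h2] at h1
  exact h1.unique (hasSum_ite_eq x _)

end Fourier

/-! ### Gaussian decay of the characteristic matrices -/

section DecayBound

open Matrix

variable {d N : ℕ} {p : TransitionKernel d N}

lemma exists_pos_forall_le {ι : Type*} [Finite ι] {f : ι → ℝ} (hf : ∀ i, 0 < f i) :
    ∃ β > 0, ∀ i, β ≤ f i := by
  have h : ∀ᶠ β in 𝓝[>] (0 : ℝ), ∀ i, β ≤ f i := eventually_all.2 fun i =>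
    (eventually_le_nhds (hf i)).filter_mono nhdsWithin_le_nhds
  obtain ⟨β, hβ, h0⟩ := (h.and self_mem_nhdsWithin).exists
  exact ⟨β, h0, hβ⟩

/-- The squared modulus is `2 + 2 cos θ`. With `t = θ² / π²`, the inequality `cos θ ≤ 1 - 2t` on
`[-π, π]` bounds it by `4 - 4t ≤ (2 - t)²`. -/
lemma norm_one_add_cexp_le {θ : ℝ} (hθ : |θ| ≤ Real.pi) :
    ‖1 + Complex.exp (Complex.I * θ)‖ ≤ 2 - θ ^ 2 / Real.pi ^ 2 := by
  have hpi := Real.pi_pos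
  have h1 := Real.cos_le_one_sub_mul_cos_sq hθ
  have h2 : θ ^ 2 / Real.pi ^ 2 ≤ 1 := by
    rw [div_le_one (by positivity)]
    exact sq_le_sq' (neg_le_of_abs_le hθ) (le_of_abs_le hθ)
  refine abs_le_of_sq_le_sq' ?_ (by linarith) |>.2
  rw [mul_comm, Complex.exp_mul_I, ← Complex.ofReal_cos, ← Complex.ofReal_sin, Complex.sq_norm,
    Complex.normSq_apply]
  simp
  rw [Complex.cos_ofReal_re, Complex.sin_ofReal_re]
  have h3 := Real.sin_sq_add_cos_sq θ
  have h4 : 2 / Real.pi ^ 2 * θ ^ 2 = 2 * (θ ^ 2 / Real.pi ^ 2) := by ring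
  rw [h4] at h1
  nlinarith [sq_nonneg (θ ^ 2 / Real.pi ^ 2)]

/-- Loss in the triangle inequality caused by two terms of a series. -/
lemma norm_le_of_hasSum_of_two_terms {ι : Type*} {b : ι → ℝ} {φ : ι → ℂ} {S β : ℝ} {T : ℂ}
    (hb : ∀ x, 0 ≤ b x) (hφ : ∀ x, ‖φ x‖ = 1) (hS : HasSum b S)
    (hT : HasSum (fun x => (b x : ℂ) * φ x) T) {x₀ x₁ : ι} (hne : x₀ ≠ x₁)
    (h0 : β ≤ b x₀) (h1 : β ≤ b x₁) :
    ‖T‖ ≤ S - β * (2 - ‖φ x₀ + φ x₁‖) ∨ β < 0 := by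
  classical
  by_cases hβ : β < 0
  · exact Or.inr hβ
  left
  push Not at hβ
  -- Mass `β` is split off at `x₀` and at `x₁`. The remaining masses are nonnegative and get the
  -- triangle inequality; the two equal masses keep their interference.
  set δ : ι → ℝ := fun x => (if x = x₀ then β else 0) + (if x = x₁ then β else 0) with hδ
  have hδle : ∀ x, δ x ≤ b x := by
    intro x
    simp only [hδ]
    by_cases hx0 : x = x₀
    · subst hx0; simpa [hne] using h0
    · by_cases hx1 : x = x₁
      · subst hx1; simpa [hx0] using h1
      · simpa [hx0, hx1] using hb x
  have hS' : HasSum (fun x => b x - δ x) (S - (β + β)) :=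
    hS.sub ((hasSum_ite_eq x₀ β).add (hasSum_ite_eq x₁ β))
  have hTδ : HasSum (fun x => (δ x : ℂ) * φ x) ((β : ℂ) * (φ x₀ + φ x₁)) := by
    have := (hasSum_ite_eq x₀ ((β : ℂ) * φ x₀)).add (hasSum_ite_eq x₁ ((β : ℂ) * φ x₁))
    rw [mul_add]
    convert! this using 1
    ext x
    simp only [hδ]
    split_ifs <;> simp_all [add_mul]
  have hT' := hT.sub hTδ
  have h2 : ‖T - (β : ℂ) * (φ x₀ + φ x₁)‖ ≤ S - (β + β) := by
    rw [← hT'.tsum_eq]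
    refine tsum_of_norm_bounded hS' fun x => ?_
    rw [← sub_mul, norm_mul, hφ, mul_one, ← Complex.ofReal_sub, Complex.norm_real,
      Real.norm_of_nonneg (sub_nonneg.2 (hδle x))]
  calc ‖T‖ = ‖(T - (β : ℂ) * (φ x₀ + φ x₁)) + (β : ℂ) * (φ x₀ + φ x₁)‖ := by rw [sub_add_cancel]
    _ ≤ (S - (β + β)) + β * ‖φ x₀ + φ x₁‖ := by
        refine (norm_add_le _ _).trans (add_le_add h2 ?_)
        rw [norm_mul, Complex.norm_real, Real.norm_of_nonneg hβ]
    _ = _ := by ring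

/-- A time at which all the states of the fundamental cell and its neighbours communicate. -/
lemma exists_pos_convPow (hirr : IsStronglyIrreducible p) :
    ∃ m : ℕ, m ≠ 0 ∧ ∀ k j : Fin N, 0 < convPow p m (0, k) (0, j) ∧
      ∀ i : Fin d, 0 < convPow p m (0, k) (Pi.single i 1, j) := by
  have h : ∀ᶠ m in atTop, ∀ k j : Fin N, 0 < convPow p m (0, k) (0, j) ∧
      ∀ i : Fin d, 0 < convPow p m (0, k) (Pi.single i 1, j) :=
    eventually_all.2 fun k => eventually_all.2 fun j =>
      (eventually_atTop.2 (hirr k j 0 0)).and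
        (eventually_all.2 fun i => eventually_atTop.2 (hirr k j 0 (Pi.single i 1)))
  obtain ⟨m, hm, hm0⟩ := (h.and (eventually_ne_atTop 0)).exists
  exact ⟨m, hm0, hm⟩

lemma P_le_F_pow (hinv : IsLatticeInvariant p) {u : EuclideanSpace ℝ (Fin d)}
    (h : FiniteAt p u) (n : ℕ) (k j : Fin N) (x : Fin d → ℤ) :
    P p n u x k j ≤ (F p u ^ n) k j :=
  le_hasSum (hasSum_convPow_mul_exp hinv h n k j) x fun _ _ =>
    mul_nonneg ENNReal.toReal_nonneg (Real.exp_pos _).le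

lemma P_pos (hinv : IsLatticeInvariant p) {u : EuclideanSpace ℝ (Fin d)}
    (h : FiniteAt p u) {n : ℕ} {k j : Fin N} {x : Fin d → ℤ} (hpos : 0 < convPow p n (0, k) (x, j))
    (v : EuclideanSpace ℝ (Fin d)) : 0 < P p n v x k j :=
  mul_pos (ENNReal.toReal_pos hpos.ne' (convPow_ne_top hinv h n k j x)) (Real.exp_pos _)

/-- Perron–Frobenius data of `F(u)`. -/
lemma exists_perron_F (hN : 0 < N) (hinv : IsLatticeInvariant p) (hirr : IsStronglyIrreducible p)
    {u : EuclideanSpace ℝ (Fin d)} (h : FiniteAt p u) :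
    ∃ v w : Fin N → ℝ, 0 < lam p u ∧ (∀ i, 0 < v i) ∧ (∀ i, 0 < w i) ∧
      F p u *ᵥ v = lam p u • v ∧ w ᵥ* F p u = lam p u • w ∧ w ⬝ᵥ v = 1 ∧
      SpectralGap ((F p u).map (fun a : ℝ => (a : ℂ))) (lam p u) (fun i => (v i : ℂ))
        (fun i => (w i : ℂ)) := by
  obtain ⟨m, hm, hpos⟩ := exists_pos_convPow hirr
  have hFm : ∀ k j, 0 < (F p u ^ m) k j := fun k j =>
    (P_pos hinv h (hpos k j).1 u).trans_le (P_le_F_pow hinv h m k j 0)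
  have hF0 : ∀ k j, 0 ≤ F p u k j := fun k j => by simpa using F_pow_nonneg (p := p) 1 u k j
  obtain ⟨r, v, w, hr, hv, hw, hAv, hwA, hd⟩ := exists_perron_eigenvectors hN hF0 hm hFm
  have hgap := spectralGap_of_primitive hN hm hFm hr hv hw hAv hwA hd
  have hlam : lam p u = r := by
    rw [lam, hgap.dominantEigenvalue_eq, Complex.ofReal_re]
  rw [hlam]
  exact ⟨v, w, hr, hv, hw, hAv, hwA, hd, hgap⟩

lemma norm_Fc_pow_le (hinv : IsLatticeInvariant p) {u ξ : EuclideanSpace ℝ (Fin d)}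
    (h : FiniteAt p u) (n : ℕ) (k j : Fin N) :
    ‖(Fc p (cplx u ξ) ^ n) k j‖ ≤ (F p u ^ n) k j := by
  rw [← (hasSum_convPow_cexp hinv (z := cplx u ξ) (by simpa using h) n k j).tsum_eq]
  refine tsum_of_norm_bounded (hasSum_convPow_mul_exp hinv h n k j) fun x => ?_
  rw [norm_mul, norm_cexp_dotC, reVec_cplx, Complex.norm_real,
    Real.norm_of_nonneg ENNReal.toReal_nonneg]

/-- The two interfering terms are `0` and the unit vector along a coordinate where `|ξ i|` equals
the sup norm of `ξ`; their relative phase is `e^{iξ_i}`. -/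
lemma norm_Fc_pow_le_sub (hinv : IsLatticeInvariant p) {u : EuclideanSpace ℝ (Fin d)}
    (h : FiniteAt p u) {m : ℕ} {k j : Fin N} {β : ℝ} (hβ : 0 ≤ β)
    (h0 : β ≤ P p m u 0 k j) (h1 : ∀ i, β ≤ P p m u (Pi.single i 1) k j)
    {ξ : Fin d → ℝ} (hξ : ‖ξ‖ ≤ Real.pi) :
    ‖(Fc p (cplx u (WithLp.toLp 2 ξ)) ^ m) k j‖ ≤
      (F p u ^ m) k j - β * (‖ξ‖ ^ 2 / Real.pi ^ 2) := by
  rcases (norm_nonneg ξ).eq_or_lt with hz | hz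
  · rw [← hz]
    simpa using norm_Fc_pow_le hinv (ξ := WithLp.toLp 2 ξ) h m k j
  obtain ⟨i, hi⟩ : ∃ i, ‖ξ‖ = |ξ i| := by
    have hd : Nonempty (Fin d) := by
      by_contra hc
      rw [not_nonempty_iff] at hc
      rw [Subsingleton.elim ξ 0, norm_zero] at hz
      exact hz.false
    obtain ⟨i, -, hi⟩ := Finset.exists_max_image Finset.univ (fun i => |ξ i|)
      Finset.univ_nonempty
    exact ⟨i, le_antisymm ((pi_norm_le_iff_of_nonneg (abs_nonneg _)).2
      fun l => hi l (Finset.mem_univ l)) (norm_le_pi_norm ξ i)⟩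
  have hφ : ∀ x : Fin d → ℤ, ‖Complex.exp (Complex.I * ∑ i, (x i : ℂ) * (ξ i : ℂ))‖ = 1 := by
    intro x
    have : Complex.I * ∑ i, (x i : ℂ) * (ξ i : ℂ)
        = ((∑ i, (x i : ℝ) * ξ i : ℝ) : ℂ) * Complex.I := by
      push_cast; ring
    rw [this, Complex.norm_exp_ofReal_mul_I]
  have hT : HasSum (fun x : Fin d → ℤ => ((P p m u x k j : ℝ) : ℂ) *
      Complex.exp (Complex.I * ∑ i, (x i : ℂ) * (ξ i : ℂ)))
      ((Fc p (cplx u (WithLp.toLp 2 ξ)) ^ m) k j) := by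
    convert! hasSum_convPow_cexp hinv (z := cplx u (WithLp.toLp 2 ξ)) (by simpa using h) m k j
      using 1
    ext x
    rw [dotC_cplx_toLp]
    simp only [P, of_apply]
    push_cast
    ring
  have hne : (0 : Fin d → ℤ) ≠ Pi.single i 1 := fun hc => by
    have := congrFun hc i
    simp at this
  have h2 := (norm_le_of_hasSum_of_two_terms
    (fun x => mul_nonneg ENNReal.toReal_nonneg (Real.exp_pos _).le) hφ
    (hasSum_convPow_mul_exp hinv h m k j) hT hne h0 (h1 i)).resolve_right (not_lt.2 hβ)
  refine h2.trans ?_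
  have h3 : ∑ l, (((Pi.single i 1 : Fin d → ℤ) l : ℤ) : ℂ) * (ξ l : ℂ) = ξ i := by
    rw [Finset.sum_eq_single i]
    · simp
    · intro l _ hl; simp [hl]
    · simp
  have h4 := norm_one_add_cexp_le (θ := ξ i) (hi ▸ hξ)
  rw [h3]
  simp only [Pi.zero_apply, Int.cast_zero, zero_mul, Finset.sum_const_zero, mul_zero,
    Complex.exp_zero]
  rw [hi, sq_abs]
  have h5 := mul_le_mul_of_nonneg_left h4 hβ
  linarith

lemma finiteAt_of_mem {u : EuclideanSpace ℝ (Fin d)} (hu : u ∈ finiteDomain p) : FiniteAt p u :=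
  interior_subset hu

/-- `F(z)` as a family of entries. -/
def FcFun (p : TransitionKernel d N) (z : Fin d → ℂ) : Fin N → Fin N → ℂ := fun k j => Fc p z k j

lemma contDiffAt_FcFun (n : ℕ) {z : Fin d → ℂ} (hz : reVec z ∈ finiteDomain p) :
    ContDiffAt ℂ n (FcFun p) z := by
  refine contDiffAt_pi.2 fun k => contDiffAt_pi.2 fun j => ?_
  exact contDiffAt_expSum n isOpen_interior
    (fun u hu => (finiteAt_of_mem hu).summable k j) hz

lemma continuous_cplx : Continuous fun q : EuclideanSpace ℝ (Fin d) × EuclideanSpace ℝ (Fin d) =>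
    cplx q.1 q.2 := by
  unfold cplx
  fun_prop

lemma continuousAt_F {u : EuclideanSpace ℝ (Fin d)} (hu : u ∈ finiteDomain p) :
    ContinuousAt (F p) u := by
  refine continuousAt_pi.2 fun k => continuousAt_pi.2 fun j => ?_
  have h1 : ContinuousAt (FcFun p) (cplx u 0) :=
    (contDiffAt_FcFun 0 (by rwa [reVec_cplx])).continuousAt
  have h2 : ContinuousAt (fun v => FcFun p (cplx v 0)) u :=
    ContinuousAt.comp (f := fun v => cplx v 0) (g := FcFun p) h1
      (continuous_cplx.comp (continuous_id.prodMk continuous_const)).continuousAt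
  have h3 : ContinuousAt (fun v => (FcFun p (cplx v 0) k j).re) u :=
    Complex.continuous_re.continuousAt.comp
      ((continuous_apply_apply k j).continuousAt.comp h2)
  refine h3.congr (Eventually.of_forall fun v => ?_)
  simp only [FcFun]
  rw [← F_map_eq]
  simp

/-- Gaussian decay of the powers of the characteristic matrices, locally uniformly in `u`. -/
theorem exists_norm_Fc_pow_le (hN : 0 < N) (hinv : IsLatticeInvariant p)
    (hirr : IsStronglyIrreducible p) {u₀ : EuclideanSpace ℝ (Fin d)} (hu₀ : u₀ ∈ finiteDomain p) :
    ∃ K c : ℝ, 0 < K ∧ 0 < c ∧ ∀ᶠ u in 𝓝 u₀, ∀ ξ : Fin d → ℝ, ‖ξ‖ ≤ Real.pi → ∀ (n : ℕ) (k j : Fin N),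
      ‖(Fc p (cplx u (WithLp.toLp 2 ξ)) ^ n) k j‖ ≤
        K * lam p u ^ n * Real.exp (-(c * n * ‖ξ‖ ^ 2)) := by
  obtain ⟨m, hm, hpos⟩ := exists_pos_convPow hirr
  have hfin := finiteAt_of_mem hu₀
  -- Half of the masses at `u₀`, so that `β` remains a lower bound for all `u` close to `u₀`.
  obtain ⟨β, hβ, hβle⟩ := exists_pos_forall_le (ι := Fin N × Fin N × Option (Fin d))
    (f := fun q => P p m u₀ (q.2.2.elim 0 fun i => Pi.single i 1) q.1 q.2.1 / 2) (by
      rintro ⟨k, j, _ | i⟩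
      · exact half_pos (P_pos hinv hfin (hpos k j).1 u₀)
      · exact half_pos (P_pos hinv hfin ((hpos k j).2 i) u₀))
  have hPc : ∀ k j x, ContinuousAt (fun u => P p m u x k j) u₀ := fun k j x => by
    simp only [P, of_apply]
    fun_prop
  have hβev : ∀ᶠ u in 𝓝 u₀, ∀ q : Fin N × Fin N × Option (Fin d),
      β ≤ P p m u (q.2.2.elim 0 fun i => Pi.single i 1) q.1 q.2.1 := by
    refine eventually_all.2 fun q => ?_
    have h1 : β < P p m u₀ (q.2.2.elim 0 fun i => Pi.single i 1) q.1 q.2.1 := by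
      have := hβle q
      linarith
    exact ((hPc _ _ _).eventually_const_lt h1).mono fun u hu => hu.le
  set Mb : ℝ := 1 + ∑ k, ∑ j, (F p u₀ ^ m) k j with hMb
  have hMb0 : 0 < Mb := by
    have : 0 ≤ ∑ k, ∑ j, (F p u₀ ^ m) k j :=
      Finset.sum_nonneg fun k _ => Finset.sum_nonneg fun j _ => F_pow_nonneg m u₀ k j
    linarith
  have hMbev : ∀ᶠ u in 𝓝 u₀, ∀ k j, (F p u ^ m) k j ≤ Mb := by
    refine eventually_all.2 fun k => eventually_all.2 fun j => ?_
    have h1 : ContinuousAt (fun u => (F p u ^ m) k j) u₀ :=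
      (continuous_apply_apply k j).continuousAt.comp ((continuousAt_F hu₀).pow m)
    have h2 : (F p u₀ ^ m) k j < Mb := by
      have h3 : (F p u₀ ^ m) k j ≤ ∑ j, (F p u₀ ^ m) k j :=
        Finset.single_le_sum (f := fun j => (F p u₀ ^ m) k j)
          (fun j _ => F_pow_nonneg m u₀ k j) (Finset.mem_univ j)
      have h4 : ∑ j, (F p u₀ ^ m) k j ≤ ∑ k, ∑ j, (F p u₀ ^ m) k j :=
        Finset.single_le_sum (f := fun k => ∑ j, (F p u₀ ^ m) k j)
          (fun k _ => Finset.sum_nonneg fun j _ => F_pow_nonneg m u₀ k j) (Finset.mem_univ k)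
      linarith
    exact (h1.eventually_lt_const h2).mono fun u hu => hu.le
  have hpi := Real.pi_pos
  -- The interference loss relative to the size of `F(u)^m`: this is the rate per block of `m`
  -- steps, hence `c / m` per step. In the constant below, `Mb / β` bounds the ratios of coordinates
  -- of the Perron vector, and `e^{cπ²}` pays for the rounding in `n / m`.
  set c : ℝ := β / (Real.pi ^ 2 * Mb) with hc
  have hc0 : 0 < c := by positivity
  have hm0 : (0 : ℝ) < m := by exact_mod_cast Nat.pos_of_ne_zero hm
  refine ⟨Real.exp (c * Real.pi ^ 2) * (Mb / β), c / m, by positivity, by positivity, ?_⟩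
  filter_upwards [hβev, hMbev, isOpen_interior.mem_nhds hu₀] with u hβu hMu hu ξ hξ n k j
  have hfu := finiteAt_of_mem hu
  obtain ⟨v, w, hr, hv, hw, hAv, hwA, hd, -⟩ := exists_perron_F hN hinv hirr hfu
  set r := lam p u with hrdef
  have hpow : ∀ n : ℕ, F p u ^ n *ᵥ v = r ^ n • v := by
    intro n
    induction n with
    | zero => simp
    | succ n ih => rw [pow_succ, ← mulVec_mulVec, hAv, mulVec_smul, ih, smul_smul, pow_succ']
  have hpow' : ∀ n k, ∑ j, (F p u ^ n) k j * v j = r ^ n * v k := fun n k => congrFun (hpow n) k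
  set Φ := Fc p (cplx u (WithLp.toLp 2 ξ)) with hΦ
  set σ := ∑ j, v j with hσ
  have hub : ∀ k, r ^ m * v k ≤ Mb * σ := by
    intro k
    rw [← hpow' m k, hσ, Finset.mul_sum]
    exact Finset.sum_le_sum fun j _ => mul_le_mul_of_nonneg_right (hMu k j) (hv j).le
  have hlb : ∀ k, β * σ ≤ r ^ m * v k := by
    intro k
    rw [← hpow' m k, hσ, Finset.mul_sum]
    refine Finset.sum_le_sum fun j _ => mul_le_mul_of_nonneg_right ?_ (hv j).le
    exact (hβu (k, j, none)).trans (P_le_F_pow hinv hfu m k j 0)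
  have hσ0 : 0 < σ := Finset.sum_pos (fun j _ => hv j) ⟨k, Finset.mem_univ _⟩
  have hratio : v k / v j ≤ Mb / β := by
    rw [div_le_div_iff₀ (hv j) hβ]
    have h1 := hub k
    have h2 := hlb j
    have h3 : 0 < r ^ m := pow_pos hr m
    have h4 : r ^ m * v k * (β * σ) ≤ Mb * σ * (r ^ m * v j) :=
      mul_le_mul h1 h2 (by positivity) (by positivity)
    have h5 : 0 < r ^ m * σ := by positivity
    refine le_of_mul_le_mul_left ?_ h5
    linarith
  have hW1 : WBound Φ v r := by
    intro k
    have h1 := hpow' 1 k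
    rw [pow_one, pow_one] at h1
    rw [← h1]
    refine Finset.sum_le_sum fun j _ => mul_le_mul_of_nonneg_right ?_ (hv j).le
    simpa using norm_Fc_pow_le hinv (ξ := WithLp.toLp 2 ξ) hfu 1 k j
  -- In the weight given by the Perron vector at `u` itself, one step has norm at most `λ(u)`, and a
  -- block of `m` steps gains the Gaussian factor. Sharpness in `λ(u)` is what lets the bound be
  -- iterated.
  have hWm : WBound (Φ ^ m) v (r ^ m * Real.exp (-(c * ‖ξ‖ ^ 2))) := by
    intro k
    have h1 : ∑ j, ‖(Φ ^ m) k j‖ * v j ≤ r ^ m * v k - β * (‖ξ‖ ^ 2 / Real.pi ^ 2) * σ := by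
      rw [← hpow' m k, hσ, Finset.mul_sum, ← Finset.sum_sub_distrib]
      refine Finset.sum_le_sum fun j _ => ?_
      rw [← sub_mul]
      exact mul_le_mul_of_nonneg_right (norm_Fc_pow_le_sub hinv hfu hβ.le (hβu (k, j, none))
        (fun i => hβu (k, j, some i)) hξ) (hv j).le
    have h2 : c * ‖ξ‖ ^ 2 * (r ^ m * v k) ≤ β * (‖ξ‖ ^ 2 / Real.pi ^ 2) * σ := by
      calc c * ‖ξ‖ ^ 2 * (r ^ m * v k) ≤ c * ‖ξ‖ ^ 2 * (Mb * σ) := by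
            exact mul_le_mul_of_nonneg_left (hub k) (by positivity)
        _ = _ := by rw [hc]; field_simp
    have h3 : 1 - c * ‖ξ‖ ^ 2 ≤ Real.exp (-(c * ‖ξ‖ ^ 2)) := by
      linarith [Real.add_one_le_exp (-(c * ‖ξ‖ ^ 2))]
    have h4 : 0 < r ^ m * v k := mul_pos (pow_pos hr m) (hv k)
    have h5 := mul_le_mul_of_nonneg_right h3 h4.le
    linarith
  have hWn : WBound (Φ ^ n) v ((r ^ m * Real.exp (-(c * ‖ξ‖ ^ 2))) ^ (n / m) * r ^ (n % m)) := by
    have h1 : Φ ^ n = (Φ ^ m) ^ (n / m) * Φ ^ (n % m) := by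
      rw [← pow_mul, ← pow_add, Nat.div_add_mod]
    rw [h1]
    exact (hWm.pow hv (by positivity) _).mul hv (by positivity) (hW1.pow hv hr.le _)
  refine (hWn.norm_apply_le hv k j).trans ?_
  have h6 : (r ^ m * Real.exp (-(c * ‖ξ‖ ^ 2))) ^ (n / m) * r ^ (n % m)
      = r ^ n * Real.exp (-(c * (n / m : ℕ) * ‖ξ‖ ^ 2)) := by
    rw [mul_pow, ← pow_mul, mul_right_comm, ← pow_add, Nat.div_add_mod, ← Real.exp_nat_mul]
    congr 2
    ring
  have h7 : (n : ℝ) / m - 1 ≤ ((n / m : ℕ) : ℝ) := by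
    have h8 : n < m * (n / m) + m := by
      have := Nat.div_add_mod n m
      have := Nat.mod_lt n (Nat.pos_of_ne_zero hm)
      omega
    have h9 : (n : ℝ) < m * ((n / m : ℕ) : ℝ) + m := by exact_mod_cast h8
    rw [sub_le_iff_le_add, div_le_iff₀ hm0]
    linarith
  have h10 : Real.exp (-(c * (n / m : ℕ) * ‖ξ‖ ^ 2)) ≤
      Real.exp (c * Real.pi ^ 2) * Real.exp (-(c / m * n * ‖ξ‖ ^ 2)) := by
    rw [← Real.exp_add]
    apply Real.exp_le_exp.2
    have h11 : ‖ξ‖ ^ 2 ≤ Real.pi ^ 2 := pow_le_pow_left₀ (norm_nonneg _) hξ 2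
    have h12 : c * ‖ξ‖ ^ 2 * ((n : ℝ) / m - 1) ≤ c * ‖ξ‖ ^ 2 * ((n / m : ℕ) : ℝ) :=
      mul_le_mul_of_nonneg_left h7 (by positivity)
    have h13 : c / m * n * ‖ξ‖ ^ 2 = c * ‖ξ‖ ^ 2 * ((n : ℝ) / m) := by ring
    rw [h13]
    nlinarith
  rw [h6]
  calc r ^ n * Real.exp (-(c * (n / m : ℕ) * ‖ξ‖ ^ 2)) * (v k / v j)
      ≤ r ^ n * (Real.exp (c * Real.pi ^ 2) * Real.exp (-(c / m * n * ‖ξ‖ ^ 2))) * (Mb / β) := by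
        gcongr
        exact (div_pos (hv k) (hv j)).le
    _ = _ := by ring

end DecayBound

/-! ### Fourier transform of a Gaussian density -/

section Gaussian

open Matrix MeasureTheory
open scoped MatrixOrder

variable {d : ℕ}

/-- The Fourier transform of a centered Gaussian density. -/
lemma integral_cexp_quadraticForm {Q : Matrix (Fin d) (Fin d) ℝ} (hQ : Q.PosDef) (y : Fin d → ℝ) :
    ∫ s : Fin d → ℝ, Complex.exp (-Complex.I * ((∑ i, y i * s i : ℝ) : ℂ)) *
        Complex.exp (((-(1 / 2) * (s ⬝ᵥ Q *ᵥ s) : ℝ) : ℂ)) =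
      (((2 * Real.pi) ^ ((d : ℝ) / 2) * (Q.det ^ (-(1 / 2) : ℝ) *
        Real.exp (-(1 / 2) * (y ⬝ᵥ Q⁻¹ *ᵥ y))) : ℝ) : ℂ) := by
  -- Factor `Q = Bᵀ B`; the substitution `t = B s` reduces to the standard Gaussian, at frequency
  -- `(Bᵀ)⁻¹ y`.
  obtain ⟨B, hB⟩ := CStarAlgebra.nonneg_iff_eq_star_mul_self.mp hQ.posSemidef.nonneg
  rw [star_eq_conjTranspose, conjTranspose_eq_transpose_of_trivial] at hB
  have hdet : Q.det = B.det ^ 2 := by rw [hB, det_mul, det_transpose, sq]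
  have hB0 : B.det ≠ 0 := fun h => by
    have := hQ.det_pos
    rw [hdet, h] at this
    simp at this
  have hBu : IsUnit B.det := isUnit_iff_ne_zero.2 hB0
  have hBtu : IsUnit Bᵀ.det := by rwa [det_transpose]
  set c : Fin d → ℝ := (Bᵀ)⁻¹ *ᵥ y with hc
  have hcB : ∀ s : Fin d → ℝ, ∑ i, c i * (B *ᵥ s) i = ∑ i, y i * s i := by
    intro s
    change c ⬝ᵥ B *ᵥ s = y ⬝ᵥ s
    rw [dotProduct_mulVec, ← mulVec_transpose, hc, mulVec_mulVec, mul_nonsing_inv _ hBtu,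
      one_mulVec]
  have hcc : c ⬝ᵥ c = y ⬝ᵥ Q⁻¹ *ᵥ y := by
    rw [hB, Matrix.mul_inv_rev, ← mulVec_mulVec, ← hc, dotProduct_mulVec,
      ← mulVec_transpose, transpose_nonsing_inv, transpose_transpose, dotProduct_comm]
  have hq : ∀ s : Fin d → ℝ, s ⬝ᵥ Q *ᵥ s = ∑ i, (B *ᵥ s) i ^ 2 := by
    intro s
    rw [hB, ← mulVec_mulVec, dotProduct_mulVec, vecMul_transpose]
    simp [dotProduct, sq]
  set g : (Fin d → ℝ) → ℂ := fun t =>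
    Complex.exp (-(1 / 2 : ℂ) * ∑ i, (t i : ℂ) ^ 2 + ∑ i, (-Complex.I * (c i : ℂ)) * t i) with hg
  have hgc : Continuous g := by simp only [hg]; fun_prop
  have h1 : ∀ s : Fin d → ℝ, Complex.exp (-Complex.I * ((∑ i, y i * s i : ℝ) : ℂ)) *
        Complex.exp (((-(1 / 2) * (s ⬝ᵥ Q *ᵥ s) : ℝ) : ℂ)) = g (toLin' B s) := by
    intro s
    rw [← Complex.exp_add, hq, ← hcB]
    simp only [hg, toLin'_apply]
    congr 1
    push_cast
    rw [add_comm]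
    congr 1
    rw [Finset.mul_sum]
    refine Finset.sum_congr rfl fun i _ => ?_
    ring
  simp only [h1]
  have hcont : Continuous (toLin' B) := LinearMap.continuous_of_finiteDimensional _
  rw [← integral_map hcont.aemeasurable hgc.aestronglyMeasurable,
    Real.map_matrix_volume_pi_eq_smul_volume_pi hB0, integral_smul_measure]
  simp only [hg]
  rw [GaussianFourier.integral_cexp_neg_mul_sum_add (by norm_num),
    ENNReal.toReal_ofReal (abs_nonneg _), Fintype.card_fin]
  have h2 : (∑ i, (-Complex.I * (c i : ℂ)) ^ 2) / (4 * (1 / 2)) =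
      ((-(1 / 2) * (y ⬝ᵥ Q⁻¹ *ᵥ y) : ℝ) : ℂ) := by
    rw [← hcc]
    simp only [mul_pow, neg_sq, Complex.I_sq, dotProduct, ← Finset.mul_sum]
    push_cast
    simp only [sq]
    ring
  have h3 : ((Real.pi : ℂ) / (1 / 2)) ^ ((d : ℂ) / 2) = (((2 * Real.pi) ^ ((d : ℝ) / 2) : ℝ) : ℂ) := by
    rw [Complex.ofReal_cpow (by positivity)]
    push_cast
    congr 1
    ring
  have h4 : |B.det⁻¹| = Q.det ^ (-(1 / 2) : ℝ) := by
    rw [hdet, Real.rpow_neg (sq_nonneg _), ← Real.sqrt_eq_rpow, Real.sqrt_sq_eq_abs, abs_inv]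
  rw [h2, h3, h4, ← Complex.ofReal_exp, Complex.real_smul]
  push_cast
  ring

end Gaussian

/-! ### Powers of numbers close to one -/

section PowerLimit

/-- `n (log(1 + z) - z)` is `O(|n z| |z|)`, which vanishes in the limit because `n z` converges and
so `z` tends to `0`. -/
lemma tendsto_one_add_pow {ι : Type*} {l : Filter ι} {n : ι → ℕ} {z : ι → ℂ} {t : ℂ}
    (hn : Tendsto n l atTop) (h : Tendsto (fun i => (n i : ℂ) * z i) l (𝓝 t)) :
    Tendsto (fun i => (1 + z i) ^ n i) l (𝓝 (Complex.exp t)) := by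
  have hninv : Tendsto (fun i => ((n i : ℂ))⁻¹) l (𝓝 0) :=
    (tendsto_inv_atTop_nhds_zero_nat (𝕜 := ℂ)).comp hn
  have hz : Tendsto z l (𝓝 0) := by
    have h1 := hninv.mul h
    rw [zero_mul] at h1
    refine h1.congr' ?_
    filter_upwards [hn.eventually_ne_atTop 0] with i hi
    rw [← mul_assoc, inv_mul_cancel₀ (by exact_mod_cast hi), one_mul]
  have hsmall : ∀ᶠ i in l, ‖z i‖ < 1 / 2 := by
    have := hz.norm
    rw [norm_zero] at this
    exact this.eventually_lt_const (by norm_num)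
  have hlog : Tendsto (fun i => (n i : ℂ) * (Complex.log (1 + z i) - z i)) l (𝓝 0) := by
    have h1 : Tendsto (fun i => ‖(n i : ℂ) * z i‖ * ‖z i‖) l (𝓝 0) := by
      simpa using h.norm.mul hz.norm
    refine squeeze_zero_norm' ?_ h1
    filter_upwards [hsmall] with i hi
    rw [norm_mul, norm_mul, mul_assoc]
    refine mul_le_mul_of_nonneg_left ?_ (norm_nonneg _)
    refine (Complex.norm_log_one_add_sub_self_le (by linarith)).trans ?_
    have h2 : (1 - ‖z i‖)⁻¹ ≤ 2 := by
      rw [inv_le_comm₀ (by linarith) (by norm_num)]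
      linarith
    nlinarith [mul_le_mul_of_nonneg_left h2 (sq_nonneg ‖z i‖)]
  have h3 : Tendsto (fun i => (n i : ℂ) * Complex.log (1 + z i)) l (𝓝 t) := by
    have := hlog.add h
    rw [zero_add] at this
    refine this.congr fun i => ?_
    ring
  refine ((Complex.continuous_exp.tendsto t).comp h3).congr' ?_
  filter_upwards [hsmall] with i hi
  have hne : 1 + z i ≠ 0 := fun hc => by
    have : z i = -1 := by linear_combination hc
    rw [this] at hi
    norm_num at hi
  rw [Function.comp_apply, Complex.exp_nat_mul, Complex.exp_log hne]

end PowerLimit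

/-! ### The dominant eigenvalue near the real domain -/

section Eigenvalue

open Matrix

variable {d N : ℕ} {p : TransitionKernel d N}

/-- The inclusion of `ℝ^d` in `ℂ^d`. -/
def toC (d : ℕ) : EuclideanSpace ℝ (Fin d) →L[ℝ] (Fin d → ℂ) :=
  ContinuousLinearMap.pi fun i => Complex.ofRealCLM ∘L EuclideanSpace.proj i

lemma cplx_eq (u ξ : EuclideanSpace ℝ (Fin d)) : cplx u ξ = toC d u + Complex.I • toC d ξ := by
  ext i
  simp [cplx, toC]

/-- The dominant eigenvalue of `F(z)`. -/
def lamC (p : TransitionKernel d N) (z : Fin d → ℂ) : ℂ := dominantEigenvalue (Fc p z)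

/-- Pulls back the stability of the gap at `F(u₀)` along the holomorphic map `F`. Order `3` is
needed because the phase contains `∇λ`, which must still be `C²`. -/
lemma exists_gap_near (hN : 0 < N) (hinv : IsLatticeInvariant p) (hirr : IsStronglyIrreducible p)
    {u₀ : EuclideanSpace ℝ (Fin d)} (hu₀ : u₀ ∈ finiteDomain p) :
    ContDiffAt ℂ 3 (lamC p) (cplx u₀ 0) ∧
    ∃ (R L : (Fin d → ℂ) → Fin N → ℂ) (k : ℕ) (w : Fin N → ℝ) (q : ℝ),
      ContinuousAt R (cplx u₀ 0) ∧ ContinuousAt L (cplx u₀ 0) ∧ k ≠ 0 ∧ (∀ i, 0 < w i) ∧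
      0 ≤ q ∧ q < 1 ∧ ∀ᶠ z in 𝓝 (cplx u₀ 0), SpectralGap (Fc p z) (lamC p z) (R z) (L z) ∧
        WBound (((lamC p z)⁻¹ • Fc p z - vecMulVec (R z) (L z)) ^ k) w q := by
  obtain ⟨v, w, hr, hv, hw, -, -, -, hgap⟩ := exists_perron_F hN hinv hirr (finiteAt_of_mem hu₀)
  rw [F_map_eq] at hgap
  have hFc : ContDiffAt ℂ 3 (FcFun p) (cplx u₀ 0) := contDiffAt_FcFun 3 (by rwa [reVec_cplx])
  obtain ⟨h1, R, L, k, w', q, hR, hL, -, -, hk, hw', hq, hq1, hev⟩ :=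
    SpectralGap.exists_near (M₀ := FcFun p (cplx u₀ 0)) hgap (n := 3) (by norm_num)
  refine ⟨ContDiffAt.comp (f := FcFun p) _ h1 hFc, fun z => R (FcFun p z), fun z => L (FcFun p z),
    k, w', q, ContinuousAt.comp (f := FcFun p) hR hFc.continuousAt,
    ContinuousAt.comp (f := FcFun p) hL hFc.continuousAt, hk, hw', hq, hq1, ?_⟩
  exact hFc.continuousAt.eventually hev

lemma lamC_ofReal (hN : 0 < N) (hinv : IsLatticeInvariant p) (hirr : IsStronglyIrreducible p)
    {u : EuclideanSpace ℝ (Fin d)} (hu : FiniteAt p u) : lamC p (cplx u 0) = (lam p u : ℂ) := by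
  obtain ⟨v, w, hr, hv, hw, -, -, -, hgap⟩ := exists_perron_F hN hinv hirr hu
  rw [lamC, ← F_map_eq]
  exact hgap.dominantEigenvalue_eq

lemma contDiff_cplx {n : WithTop ℕ∞} :
    ContDiff ℝ n fun q : EuclideanSpace ℝ (Fin d) × EuclideanSpace ℝ (Fin d) => cplx q.1 q.2 := by
  simp only [cplx_eq]
  have h1 : ContDiff ℝ n fun q : EuclideanSpace ℝ (Fin d) × EuclideanSpace ℝ (Fin d) =>
      toC d q.1 := (toC d).contDiff.comp contDiff_fst
  have h2 : ContDiff ℝ n fun q : EuclideanSpace ℝ (Fin d) × EuclideanSpace ℝ (Fin d) =>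
      toC d q.2 := (toC d).contDiff.comp contDiff_snd
  exact h1.add (h2.const_smul Complex.I)

lemma contDiffAt_lamC_cplx (hN : 0 < N) (hinv : IsLatticeInvariant p)
    (hirr : IsStronglyIrreducible p) {u : EuclideanSpace ℝ (Fin d)} (hu : u ∈ finiteDomain p) :
    ContDiffAt ℝ 3 (fun q : EuclideanSpace ℝ (Fin d) × EuclideanSpace ℝ (Fin d) =>
      lamC p (cplx q.1 q.2)) (u, 0) :=
  ContDiffAt.comp (f := fun q : EuclideanSpace ℝ (Fin d) × EuclideanSpace ℝ (Fin d) =>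
    cplx q.1 q.2) (g := lamC p) (u, 0)
    ((exists_gap_near hN hinv hirr hu).1.restrict_scalars ℝ) contDiff_cplx.contDiffAt

lemma contDiffAt_lam (hN : 0 < N) (hinv : IsLatticeInvariant p) (hirr : IsStronglyIrreducible p)
    {u : EuclideanSpace ℝ (Fin d)} (hu : u ∈ finiteDomain p) : ContDiffAt ℝ 3 (lam p) u := by
  have h1 := ContDiffAt.comp (f := fun v : EuclideanSpace ℝ (Fin d) =>
      ((v, 0) : EuclideanSpace ℝ (Fin d) × EuclideanSpace ℝ (Fin d))) u
    (contDiffAt_lamC_cplx hN hinv hirr hu) (contDiff_id.prodMk contDiff_const).contDiffAt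
  have h2 := (Complex.reCLM.contDiff (n := 3)).contDiffAt.comp u h1
  refine h2.congr_of_eventuallyEq (Eventually.of_forall fun v => ?_)
  simp only [lam, F_map_eq, Function.comp_apply, Complex.reCLM_apply, lamC]

lemma contDiffAt_gradient_lam (hN : 0 < N) (hinv : IsLatticeInvariant p)
    (hirr : IsStronglyIrreducible p) {u : EuclideanSpace ℝ (Fin d)} (hu : u ∈ finiteDomain p) :
    ContDiffAt ℝ 2 (gradient (lam p)) u := by
  have h1 : ContDiffAt ℝ 2 (fderiv ℝ (lam p)) u :=
    (contDiffAt_lam hN hinv hirr hu).fderiv_right (by norm_num)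
  exact ((InnerProductSpace.toDual ℝ (EuclideanSpace ℝ (Fin d))).symm.toContinuousLinearEquiv
    |>.contDiff).contDiffAt.comp u h1

lemma inner_gradient_lam (u v : EuclideanSpace ℝ (Fin d)) :
    inner ℝ (gradient (lam p) u) v = fderiv ℝ (lam p) u v := by
  rw [gradient, InnerProductSpace.toDual_symm_apply]

/-- The phase `e^{-i ∇λ(u) · ξ}`. -/
def phase (p : TransitionKernel d N) (u ξ : EuclideanSpace ℝ (Fin d)) : ℂ :=
  Complex.exp (-Complex.I * ((inner ℝ (gradient (lam p) u) ξ : ℝ) : ℂ))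

lemma norm_phase (u ξ : EuclideanSpace ℝ (Fin d)) : ‖phase p u ξ‖ = 1 := by
  have : -Complex.I * ((inner ℝ (gradient (lam p) u) ξ : ℝ) : ℂ)
      = ((-inner ℝ (gradient (lam p) u) ξ : ℝ) : ℂ) * Complex.I := by push_cast; ring
  rw [phase, this, Complex.norm_exp_ofReal_mul_I]

lemma phase_ne_zero (u ξ : EuclideanSpace ℝ (Fin d)) : phase p u ξ ≠ 0 := Complex.exp_ne_zero _

lemma chi_eq (u ξ : EuclideanSpace ℝ (Fin d)) : chi p u ξ = phase p u ξ • Fc p (cplx u ξ) := by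
  rw [chi, psi_eq, phase]

lemma eventually_charLam (hN : 0 < N) (hinv : IsLatticeInvariant p)
    (hirr : IsStronglyIrreducible p) {u₀ : EuclideanSpace ℝ (Fin d)} (hu₀ : u₀ ∈ finiteDomain p) :
    ∀ᶠ q in 𝓝 ((u₀, 0) : EuclideanSpace ℝ (Fin d) × EuclideanSpace ℝ (Fin d)),
      charLam p q.1 q.2 = phase p q.1 q.2 * lamC p (cplx q.1 q.2) ∧
      IsDominantEigenvalue (chi p q.1 q.2) (charLam p q.1 q.2) := by
  obtain ⟨-, R, L, k, w, q, -, -, -, -, -, -, hev⟩ := exists_gap_near hN hinv hirr hu₀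
  have hc : Tendsto (fun q : EuclideanSpace ℝ (Fin d) × EuclideanSpace ℝ (Fin d) => cplx q.1 q.2)
    (𝓝 (u₀, 0)) (𝓝 (cplx u₀ 0)) := continuous_cplx.tendsto (u₀, 0)
  filter_upwards [hc.eventually hev] with q hq
  have h1 := hq.1.smul (phase_ne_zero (p := p) q.1 q.2)
  rw [← chi_eq] at h1
  have h2 : charLam p q.1 q.2 = phase p q.1 q.2 * lamC p (cplx q.1 q.2) :=
    h1.dominantEigenvalue_eq
  rw [h2]
  exact ⟨rfl, h1.isDominantEigenvalue⟩

/-- Regularity is taken jointly in `(u, ξ)`, so that the Taylor expansion in `ξ` is uniform in `u`.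
-/
lemma contDiffAt_charLam (hN : 0 < N) (hinv : IsLatticeInvariant p)
    (hirr : IsStronglyIrreducible p) {u₀ : EuclideanSpace ℝ (Fin d)} (hu₀ : u₀ ∈ finiteDomain p) :
    ContDiffAt ℝ 2 (fun q : EuclideanSpace ℝ (Fin d) × EuclideanSpace ℝ (Fin d) =>
      charLam p q.1 q.2) (u₀, 0) := by
  have h1 : ContDiffAt ℝ 2 (fun q : EuclideanSpace ℝ (Fin d) × EuclideanSpace ℝ (Fin d) =>
      phase p q.1 q.2) (u₀, 0) := by
    have h2 : ContDiffAt ℝ 2 (fun q : EuclideanSpace ℝ (Fin d) × EuclideanSpace ℝ (Fin d) =>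
        gradient (lam p) q.1) (u₀, 0) :=
      ContDiffAt.comp (f := Prod.fst) (g := gradient (lam p)) (u₀, 0)
        (contDiffAt_gradient_lam hN hinv hirr hu₀) contDiffAt_fst
    have h3 := h2.inner ℝ (contDiffAt_snd (n := 2) (𝕜 := ℝ) (p := (u₀, (0 : EuclideanSpace ℝ (Fin d)))))
    have h4 := (Complex.ofRealCLM.contDiff (n := 2)).contDiffAt.comp _ h3
    exact (contDiffAt_const.mul h4).cexp
  have h5 := h1.mul ((contDiffAt_lamC_cplx hN hinv hirr hu₀).of_le (by norm_num))
  exact h5.congr_of_eventuallyEq ((eventually_charLam hN hinv hirr hu₀).mono fun q hq => hq.1)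

lemma charLam_zero (hN : 0 < N) (hinv : IsLatticeInvariant p) (hirr : IsStronglyIrreducible p)
    {u : EuclideanSpace ℝ (Fin d)} (hu : u ∈ levelSet p) : charLam p u 0 = 1 := by
  have h := (eventually_charLam hN hinv hirr hu.1).self_of_nhds.1
  simp only at h
  rw [h, lamC_ofReal hN hinv hirr (finiteAt_of_mem hu.1), hu.2]
  simp [phase]

/-- By holomorphy the derivative of `λ(u + iξ)` in `ξ` at `0` is `i ∇λ(u)`; the phase contributes
`-i ∇λ(u)` times `λ(u) = 1`, and they cancel. -/
lemma hasFDerivAt_charLam_zero (hN : 0 < N) (hinv : IsLatticeInvariant p)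
    (hirr : IsStronglyIrreducible p) {u : EuclideanSpace ℝ (Fin d)} (hu : u ∈ levelSet p) :
    HasFDerivAt (charLam p u) (0 : EuclideanSpace ℝ (Fin d) →L[ℝ] ℂ) 0 := by
  set D := fderiv ℂ (lamC p) (cplx u 0) with hD
  have hlamC : HasFDerivAt (lamC p) (D.restrictScalars ℝ) (cplx u 0) :=
    (((exists_gap_near hN hinv hirr hu.1).1.differentiableAt (by norm_num)).hasFDerivAt).restrictScalars ℝ
  have hlam : HasFDerivAt (lam p) (fderiv ℝ (lam p) u) u :=
    ((contDiffAt_lam hN hinv hirr hu.1).differentiableAt (by norm_num)).hasFDerivAt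
  have hre : ∀ v, D (toC d v) = ((fderiv ℝ (lam p) u v : ℝ) : ℂ) := by
    have h1 : HasFDerivAt (fun v => lamC p (cplx v 0)) ((D.restrictScalars ℝ) ∘L toC d) u := by
      refine HasFDerivAt.comp (g := lamC p) u hlamC ?_
      simp only [cplx_eq, map_zero, smul_zero, add_zero]
      exact (toC d).hasFDerivAt
    have h2 : HasFDerivAt (fun v => lamC p (cplx v 0))
        (Complex.ofRealCLM ∘L fderiv ℝ (lam p) u) u := by
      refine (Complex.ofRealCLM.hasFDerivAt.comp u hlam).congr_of_eventuallyEq ?_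
      filter_upwards [isOpen_interior.mem_nhds hu.1] with v hv
      exact lamC_ofReal hN hinv hirr (finiteAt_of_mem hv)
    intro v
    exact DFunLike.congr_fun (h1.unique h2) v
  have h3 : HasFDerivAt (fun ξ => lamC p (cplx u ξ))
      ((D.restrictScalars ℝ) ∘L (Complex.I • toC d)) 0 := by
    refine HasFDerivAt.comp (g := lamC p) 0 hlamC ?_
    have h0 : cplx u = fun ξ => toC d u + Complex.I • toC d ξ := funext (cplx_eq u)
    rw [h0]
    exact ((toC d).hasFDerivAt.const_smul Complex.I).const_add (toC d u)
  have h4 : HasFDerivAt (phase p u) ((-Complex.I) • (Complex.ofRealCLM ∘L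
      innerSL ℝ (gradient (lam p) u))) 0 := by
    have h5 := ((Complex.ofRealCLM.hasFDerivAt.comp (0 : EuclideanSpace ℝ (Fin d))
      (innerSL ℝ (gradient (lam p) u)).hasFDerivAt).const_mul (-Complex.I)).cexp
    convert! h5 using 1
    simp
  have h6 := h4.mul h3
  have h7 : charLam p u =ᶠ[𝓝 0] fun ξ => phase p u ξ * lamC p (cplx u ξ) := by
    have hc : Tendsto (fun ξ : EuclideanSpace ℝ (Fin d) => (u, ξ)) (𝓝 0) (𝓝 (u, 0)) :=
      (Continuous.prodMk_right u).tendsto 0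
    exact (hc.eventually (eventually_charLam hN hinv hirr hu.1)).mono fun ξ hξ => hξ.1
  refine (h6.congr_of_eventuallyEq h7).congr_fderiv ?_
  ext v
  simp only [_root_.add_apply, _root_.smul_apply, ContinuousLinearMap.comp_apply,
    ContinuousLinearMap.coe_restrictScalars', map_smul, hre, smul_eq_mul, _root_.zero_apply,
    lamC_ofReal hN hinv hirr (finiteAt_of_mem hu.1), hu.2, innerSL_apply_apply,
    inner_gradient_lam, Complex.ofRealCLM_apply]
  simp [phase]

end Eigenvalue

/-! ### Uniform second order expansion -/

section Taylor

variable {E : Type*} [NormedAddCommGroup E] [NormedSpace ℝ E]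

/-- Second order Taylor expansion in the second variable, uniformly in the first one. -/
lemma eventually_norm_taylor_le {J : E × E → ℂ} {u₀ : E} (hJ : ContDiffAt ℝ 2 J (u₀, 0)) (s : E)
    {ε : ℝ} (hε : 0 < ε) : ∀ᶠ q : E × ℝ in 𝓝 (u₀, 0),
      J (q.1, 0) = 1 → fderiv ℝ J (q.1, 0) (0, s) = 0 → 0 ≤ q.2 →
      ‖J (q.1, q.2 • s) - 1 -
        ((q.2 ^ 2 / 2 : ℝ) : ℂ) * fderiv ℝ (fderiv ℝ J) (u₀, 0) (0, s) (0, s)‖ ≤ ε * q.2 ^ 2 := by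
  set a := fderiv ℝ (fderiv ℝ J) (u₀, 0) (0, s) (0, s) with ha
  have h1 : ContDiffAt ℝ 1 (fderiv ℝ J) (u₀, 0) := hJ.fderiv_right (by norm_num)
  have h2 : ContinuousAt (fderiv ℝ (fderiv ℝ J)) (u₀, 0) :=
    (h1.fderiv_right (m := 0) (by norm_num)).continuousAt
  have h3 : ContinuousAt (fun q => fderiv ℝ (fderiv ℝ J) q (0, s) (0, s)) (u₀, 0) :=
    (h2.clm_apply continuousAt_const).clm_apply continuousAt_const
  have hev : ∀ᶠ q in 𝓝 ((u₀, 0) : E × E), DifferentiableAt ℝ J q ∧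
      DifferentiableAt ℝ (fderiv ℝ J) q ∧ ‖fderiv ℝ (fderiv ℝ J) q (0, s) (0, s) - a‖ ≤ ε := by
    have h4 := hJ.eventually (by norm_num)
    have h5 := h1.eventually (by norm_num)
    have h6 := Metric.tendsto_nhds.1 h3 ε hε
    filter_upwards [h4, h5, h6] with q hq4 hq5 hq6
    refine ⟨hq4.differentiableAt (by norm_num), hq5.differentiableAt (by norm_num), ?_⟩
    rw [← dist_eq_norm]
    exact hq6.le
  obtain ⟨ρ, hρ, hball⟩ := Metric.eventually_nhds_iff.1 hev
  have hs : 0 < ρ / (‖s‖ + 1) := by positivity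
  filter_upwards [prod_mem_nhds (Metric.ball_mem_nhds u₀ hρ) (Metric.ball_mem_nhds (0 : ℝ) hs)]
    with ⟨u, t⟩ ⟨hu, ht⟩ hJ1 hJ' ht0
  simp only at hJ1 hJ' ht0 hu ht ⊢
  rw [Metric.mem_ball, Real.dist_eq, sub_zero, abs_of_nonneg ht0, lt_div_iff₀ (by positivity)] at ht
  have hmem : ∀ τ ∈ Set.Icc 0 t, dist ((u, τ • s) : E × E) (u₀, 0) < ρ := by
    intro τ hτ
    rw [Prod.dist_eq, max_lt_iff]
    refine ⟨hu, ?_⟩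
    rw [dist_zero_right, norm_smul, Real.norm_of_nonneg hτ.1]
    nlinarith [hτ.2, norm_nonneg s, hτ.1]
  have hcurve : ∀ τ : ℝ, HasDerivAt (fun τ : ℝ => ((u, τ • s) : E × E)) (0, s) τ := by
    intro τ
    have := (hasDerivAt_const τ u).prodMk ((hasDerivAt_id τ).smul_const s)
    simpa using this
  -- The mean value inequality is applied twice along the segment, first to the first derivative and
  -- then to `J`. The second derivative is compared with its value at the fixed point `(u₀, 0)`.
  have hφ : ∀ τ ∈ Set.Icc 0 t, ‖fderiv ℝ J (u, τ • s) (0, s) - (τ : ℂ) * a‖ ≤ ε * t := by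
    intro τ hτ
    have hd : ∀ σ ∈ Set.Icc 0 t, HasDerivWithinAt
        (fun σ : ℝ => fderiv ℝ J (u, σ • s) (0, s) - (σ : ℂ) * a)
        (fderiv ℝ (fderiv ℝ J) (u, σ • s) (0, s) (0, s) - a) (Set.Icc 0 t) σ := by
      intro σ hσ
      have h4 := ((hball (hmem σ hσ)).2.1.hasFDerivAt.comp_hasDerivAt σ (hcurve σ))
      have h5 := h4.clm_apply (hasDerivAt_const σ ((0, s) : E × E))
      have h6 := (Complex.ofRealCLM.hasDerivAt (x := σ)).mul_const a
      simpa using! (h5.sub h6).hasDerivWithinAt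
    have h7 := Convex.norm_image_sub_le_of_norm_hasDerivWithin_le hd
      (fun σ hσ => (hball (hmem σ hσ)).2.2) (convex_Icc 0 t) (Set.left_mem_Icc.2 ht0) hτ
    simp only [zero_smul, hJ', Complex.ofReal_zero, zero_mul, sub_zero] at h7
    refine h7.trans ?_
    rw [Real.norm_of_nonneg hτ.1]
    exact mul_le_mul_of_nonneg_left hτ.2 hε.le
  have hd : ∀ σ ∈ Set.Icc 0 t, HasDerivWithinAt
      (fun σ : ℝ => J (u, σ • s) - 1 - ((σ ^ 2 / 2 : ℝ) : ℂ) * a)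
      (fderiv ℝ J (u, σ • s) (0, s) - (σ : ℂ) * a) (Set.Icc 0 t) σ := by
    intro σ hσ
    have h4 := ((hball (hmem σ hσ)).1.hasFDerivAt.comp_hasDerivAt σ (hcurve σ)).sub_const 1
    have h5 : HasDerivAt (fun σ : ℝ => σ ^ 2 / 2) σ σ := by
      have := ((hasDerivAt_id σ).pow 2).div_const 2
      convert! this using 1
      simp
    exact (h4.sub (h5.ofReal_comp.mul_const a)).hasDerivWithinAt
  have h8 := Convex.norm_image_sub_le_of_norm_hasDerivWithin_le hd hφ (convex_Icc 0 t)
    (Set.left_mem_Icc.2 ht0) (Set.right_mem_Icc.2 ht0)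
  simp only [zero_smul, hJ1, sub_self, ne_eq, OfNat.ofNat_ne_zero, not_false_eq_true, zero_pow,
    zero_div, Complex.ofReal_zero, zero_mul, sub_zero, Real.norm_of_nonneg ht0] at h8
  refine h8.trans (le_of_eq ?_)
  ring

/-- Taylor expansion at step `1/√n`: then `n (J - 1)` tends to half the second derivative, which
`tendsto_one_add_pow` turns into the limit of the powers. -/
lemma tendsto_pow_of_taylor {ι : Type*} {l : Filter ι} {J : E × E → ℂ} {u₀ : E}
    (hJ : ContDiffAt ℝ 2 J (u₀, 0)) (s : E) {u : ι → E} {n : ι → ℕ} (hu : Tendsto u l (𝓝 u₀))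
    (hn : Tendsto n l atTop) (h1 : ∀ᶠ i in l, J (u i, 0) = 1)
    (h2 : ∀ᶠ i in l, fderiv ℝ J (u i, 0) (0, s) = 0) :
    Tendsto (fun i => J (u i, (Real.sqrt (n i))⁻¹ • s) ^ n i) l
      (𝓝 (Complex.exp (fderiv ℝ (fderiv ℝ J) (u₀, 0) (0, s) (0, s) / 2))) := by
  set a := fderiv ℝ (fderiv ℝ J) (u₀, 0) (0, s) (0, s) with ha
  have hsqrt : Tendsto (fun i => (Real.sqrt (n i))⁻¹) l (𝓝 0) :=
    (tendsto_inv_atTop_zero.comp Real.tendsto_sqrt_atTop).comp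
      (tendsto_natCast_atTop_atTop.comp hn)
  have h3 : Tendsto (fun i => (n i : ℂ) * (J (u i, (Real.sqrt (n i))⁻¹ • s) - 1)) l (𝓝 (a / 2)) := by
    rw [Metric.tendsto_nhds]
    intro ε hε
    have h4 := (hu.prodMk_nhds hsqrt).eventually (eventually_norm_taylor_le hJ s (half_pos hε))
    filter_upwards [h4, h1, h2, hn.eventually_ne_atTop 0] with i hi hi1 hi2 hni
    have h5 := hi hi1 hi2 (by positivity)
    have hn0 : (0 : ℝ) < n i := by exact_mod_cast Nat.pos_of_ne_zero hni
    simp only [inv_pow, Real.sq_sqrt hn0.le] at h5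
    have h6 : (n i : ℂ) * (J (u i, (Real.sqrt (n i))⁻¹ • s) - 1) - a / 2 =
        (n i : ℂ) * (J (u i, (Real.sqrt (n i))⁻¹ • s) - 1 - ((((n i : ℝ))⁻¹ / 2 : ℝ) : ℂ) * a) := by
      have : (n i : ℂ) ≠ 0 := by exact_mod_cast hni
      push_cast
      field_simp
    rw [dist_eq_norm, h6, norm_mul, Complex.norm_natCast]
    calc (n i : ℝ) * _ ≤ (n i : ℝ) * (ε / 2 * ((n i : ℝ))⁻¹) := by gcongr
      _ = ε / 2 := by field_simp
      _ < ε := half_lt_self hε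
  simpa using tendsto_one_add_pow hn h3

end Taylor

/-! ### Conjugation symmetry -/

section Conjugation

open Matrix

variable {d N : ℕ} {p : TransitionKernel d N}

lemma SpectralGap.conj {M : Matrix (Fin N) (Fin N) ℂ} {μ : ℂ} {R L : Fin N → ℂ}
    (h : SpectralGap M μ R L) : SpectralGap (M.map (starRingEnd ℂ)) (starRingEnd ℂ μ)
      (fun i => starRingEnd ℂ (R i)) (fun i => starRingEnd ℂ (L i)) where
  right := by
    ext i
    have := congrArg (starRingEnd ℂ) (congrFun h.right i)
    simpa [mulVec, dotProduct, map_sum] using this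
  left := by
    ext i
    have := congrArg (starRingEnd ℂ) (congrFun h.left i)
    simpa [vecMul, dotProduct, map_sum] using this
  dot := by
    have := congrArg (starRingEnd ℂ) h.dot
    simpa [dotProduct, map_sum] using this
  ne_zero := by simpa using h.ne_zero
  gap := by
    obtain ⟨k, w, c, hk, hw, hc, hlt, hb⟩ := h.gap
    refine ⟨k, w, c, hk, hw, hc, by simpa using hlt, ?_⟩
    have h1 : M.map (starRingEnd ℂ) - (starRingEnd ℂ μ) •
        vecMulVec (fun i => starRingEnd ℂ (R i)) (fun i => starRingEnd ℂ (L i)) =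
        (starRingEnd ℂ).mapMatrix (M - μ • vecMulVec R L) := by
      ext i j
      simp [vecMulVec_apply]
    rw [h1, ← map_pow]
    intro i
    simpa using hb i

lemma Fc_cplx_neg (u ξ : EuclideanSpace ℝ (Fin d)) :
    Fc p (cplx u (-ξ)) = (Fc p (cplx u ξ)).map (starRingEnd ℂ) := by
  ext k j
  simp only [Fc, of_apply, map_apply, expSum]
  rw [Complex.conj_tsum]
  refine tsum_congr fun x => ?_
  rw [cexp_dotC_cplx, cexp_dotC_cplx, smul_eq_mul, smul_eq_mul, map_mul, map_mul, Complex.conj_ofReal,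
    Complex.conj_ofReal, ← Complex.exp_conj, map_mul, Complex.conj_I, Complex.conj_ofReal,
    inner_neg_right]
  push_cast
  ring_nf

lemma phase_neg (u ξ : EuclideanSpace ℝ (Fin d)) :
    phase p u (-ξ) = starRingEnd ℂ (phase p u ξ) := by
  rw [phase, phase, ← Complex.exp_conj, map_mul, map_neg, Complex.conj_I, Complex.conj_ofReal,
    inner_neg_right]
  push_cast
  ring_nf

/-- The weights are real, so `χ_u(-ξ)` is the conjugate matrix, and conjugation carries the gap and
its eigenvalue along. -/
lemma eventually_charLam_neg (hN : 0 < N) (hinv : IsLatticeInvariant p)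
    (hirr : IsStronglyIrreducible p) {u : EuclideanSpace ℝ (Fin d)} (hu : u ∈ finiteDomain p) :
    ∀ᶠ ξ in 𝓝 (0 : EuclideanSpace ℝ (Fin d)),
      charLam p u (-ξ) = starRingEnd ℂ (charLam p u ξ) := by
  obtain ⟨-, R, L, k, w, q, -, -, -, -, -, -, hev⟩ := exists_gap_near hN hinv hirr hu
  have hc : Tendsto (fun ξ : EuclideanSpace ℝ (Fin d) => cplx u ξ) (𝓝 0) (𝓝 (cplx u 0)) :=
    (continuous_cplx.comp (Continuous.prodMk_right u)).tendsto 0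
  filter_upwards [hc.eventually hev] with ξ hξ
  have h1 := hξ.1.smul (phase_ne_zero (p := p) u ξ)
  rw [← chi_eq] at h1
  have h2 := h1.conj
  have h3 : (chi p u ξ).map (starRingEnd ℂ) = chi p u (-ξ) := by
    rw [chi_eq, chi_eq, Fc_cplx_neg, phase_neg]
    ext k j
    simp
  rw [h3] at h2
  rw [charLam, charLam, h1.dominantEigenvalue_eq, h2.dominantEigenvalue_eq]

/-- The sign `c` changes at each differentiation; keeping it as a parameter lets the lemma be
applied to its own output. -/
lemma eventually_fderiv_neg {E : Type*} [NormedAddCommGroup E] [NormedSpace ℝ E] {f : E → ℂ}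
    {c : ℝ} (hd : ∀ᶠ ξ in 𝓝 (0 : E), DifferentiableAt ℝ f ξ)
    (h : ∀ᶠ ξ in 𝓝 (0 : E), f (-ξ) = c * starRingEnd ℂ (f ξ)) (v : E) :
    ∀ᶠ ξ in 𝓝 (0 : E), fderiv ℝ f (-ξ) v = ((-c : ℝ) : ℂ) * starRingEnd ℂ (fderiv ℝ f ξ v) := by
  have hneg : Tendsto (fun ξ : E => -ξ) (𝓝 0) (𝓝 0) := by
    simpa using (continuous_neg (G := E)).tendsto 0
  filter_upwards [hd, hneg.eventually hd, h.eventually_nhds] with ξ h1 h2 h3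
  have h4 : HasFDerivAt (fun ξ => f (-ξ)) ((fderiv ℝ f (-ξ)) ∘L (-ContinuousLinearMap.id ℝ E)) ξ :=
    HasFDerivAt.comp (f := fun ξ : E => -ξ) ξ h2.hasFDerivAt (hasFDerivAt_id ξ).neg
  have h5 : HasFDerivAt (fun ξ => (c : ℂ) * starRingEnd ℂ (f ξ))
      ((c : ℂ) • ((Complex.conjCLE : ℂ →L[ℝ] ℂ) ∘L fderiv ℝ f ξ)) ξ :=
    ((Complex.conjCLE : ℂ →L[ℝ] ℂ).hasFDerivAt.comp ξ h1.hasFDerivAt).const_mul (c : ℂ)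
  have h6 := DFunLike.congr_fun (h4.unique (h5.congr_of_eventuallyEq h3)) v
  simp at h6
  rw [← neg_eq_iff_eq_neg.2 h6.symm]
  push_cast
  ring

end Conjugation

/-! ### The Hessian and the quadratic form `Q_u` -/

section Hessian

open Matrix

variable {d N : ℕ} {p : TransitionKernel d N}

/-- The Hessian of `ξ ↦ λ_u(ξ)` at `0`, as a partial second derivative. -/
def hess (p : TransitionKernel d N) (u v w : EuclideanSpace ℝ (Fin d)) : ℂ :=
  fderiv ℝ (fderiv ℝ (fun q : EuclideanSpace ℝ (Fin d) × EuclideanSpace ℝ (Fin d) =>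
    charLam p q.1 q.2)) (u, 0) (0, v) (0, w)

lemma hasFDerivAt_charLam_right {u ξ : EuclideanSpace ℝ (Fin d)}
    (h : DifferentiableAt ℝ (fun q : EuclideanSpace ℝ (Fin d) × EuclideanSpace ℝ (Fin d) =>
      charLam p q.1 q.2) (u, ξ)) :
    HasFDerivAt (charLam p u) ((fderiv ℝ (fun q : EuclideanSpace ℝ (Fin d) ×
      EuclideanSpace ℝ (Fin d) => charLam p q.1 q.2) (u, ξ)) ∘L
      ContinuousLinearMap.inr ℝ _ _) ξ :=
  HasFDerivAt.comp (f := fun ξ : EuclideanSpace ℝ (Fin d) => (u, ξ)) ξ h.hasFDerivAt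
    (hasFDerivAt_prodMk_right u ξ)

lemma fderiv_fderiv_charLam (hN : 0 < N) (hinv : IsLatticeInvariant p)
    (hirr : IsStronglyIrreducible p) {u : EuclideanSpace ℝ (Fin d)} (hu : u ∈ finiteDomain p)
    (v w : EuclideanSpace ℝ (Fin d)) :
    fderiv ℝ (fderiv ℝ (charLam p u)) 0 v w = hess p u v w := by
  have hJ := contDiffAt_charLam hN hinv hirr hu
  set J := fun q : EuclideanSpace ℝ (Fin d) × EuclideanSpace ℝ (Fin d) => charLam p q.1 q.2 with hJdef
  have h1 : ContDiffAt ℝ 1 (fderiv ℝ J) (u, 0) := hJ.fderiv_right (by norm_num)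
  have hc : Tendsto (fun ξ : EuclideanSpace ℝ (Fin d) => (u, ξ)) (𝓝 0) (𝓝 (u, 0)) :=
    (Continuous.prodMk_right u).tendsto 0
  have h2 : fderiv ℝ (charLam p u) =ᶠ[𝓝 0] fun ξ => (fderiv ℝ J (u, ξ)) ∘L
      ContinuousLinearMap.inr ℝ _ _ := by
    filter_upwards [hc.eventually (hJ.eventually (by norm_num))] with ξ hξ
    exact (hasFDerivAt_charLam_right (hξ.differentiableAt (by norm_num))).fderiv
  rw [h2.fderiv_eq]
  have h3 : HasFDerivAt (fun ξ => fderiv ℝ J (u, ξ))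
      (fderiv ℝ (fderiv ℝ J) (u, 0) ∘L ContinuousLinearMap.inr ℝ _ _) 0 :=
    HasFDerivAt.comp (g := fderiv ℝ J) (f := fun ξ : EuclideanSpace ℝ (Fin d) => (u, ξ)) 0
      (h1.differentiableAt (by norm_num)).hasFDerivAt (hasFDerivAt_prodMk_right u 0)
  have h4 := h3.clm_comp (hasFDerivAt_const (ContinuousLinearMap.inr ℝ (EuclideanSpace ℝ (Fin d))
    (EuclideanSpace ℝ (Fin d))) (0 : EuclideanSpace ℝ (Fin d)))
  rw [h4.fderiv]
  simp [hess]
  rfl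

lemma charHess_eq (hN : 0 < N) (hinv : IsLatticeInvariant p) (hirr : IsStronglyIrreducible p)
    {u : EuclideanSpace ℝ (Fin d)} (hu : u ∈ finiteDomain p) (i j : Fin d) :
    charHess p u i j = hess p u (EuclideanSpace.single i 1) (EuclideanSpace.single j 1) := by
  rw [charHess, iteratedFDeriv_two_apply, ← fderiv_fderiv_charLam hN hinv hirr hu]
  rfl

/-- As part of a joint second derivative, the Hessian is continuous in `u` at once. -/
lemma continuousAt_hess (hN : 0 < N) (hinv : IsLatticeInvariant p)
    (hirr : IsStronglyIrreducible p) {u : EuclideanSpace ℝ (Fin d)} (hu : u ∈ finiteDomain p)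
    (v w : EuclideanSpace ℝ (Fin d)) : ContinuousAt (fun u => hess p u v w) u := by
  have hJ := contDiffAt_charLam hN hinv hirr hu
  have h1 := hJ.fderiv_right (m := 1) (by norm_num)
  have h2 := (h1.fderiv_right (m := 0) (by norm_num)).continuousAt
  have h3 := ContinuousAt.comp (f := fun u : EuclideanSpace ℝ (Fin d) =>
    ((u, 0) : EuclideanSpace ℝ (Fin d) × EuclideanSpace ℝ (Fin d))) h2
    (Continuous.prodMk_left (0 : EuclideanSpace ℝ (Fin d))).continuousAt
  exact (h3.clm_apply continuousAt_const).clm_apply continuousAt_const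

lemma hess_comm (hN : 0 < N) (hinv : IsLatticeInvariant p)
    (hirr : IsStronglyIrreducible p) {u : EuclideanSpace ℝ (Fin d)} (hu : u ∈ finiteDomain p)
    (v w : EuclideanSpace ℝ (Fin d)) : hess p u v w = hess p u w v :=
  ((contDiffAt_charLam hN hinv hirr hu).isSymmSndFDerivAt (by simp)) (0, v) (0, w)

/-- Differentiating `λ_u(-ξ) = conj λ_u(ξ)` twice at `0` restores the sign, so the Hessian is real.
-/
lemma hess_conj (hN : 0 < N) (hinv : IsLatticeInvariant p)
    (hirr : IsStronglyIrreducible p) {u : EuclideanSpace ℝ (Fin d)} (hu : u ∈ finiteDomain p)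
    (v w : EuclideanSpace ℝ (Fin d)) : starRingEnd ℂ (hess p u v w) = hess p u v w := by
  have hJ := contDiffAt_charLam hN hinv hirr hu
  have hf : ContDiffAt ℝ 2 (charLam p u) 0 := ContDiffAt.comp
    (f := fun ξ : EuclideanSpace ℝ (Fin d) => (u, ξ)) 0 hJ (contDiff_prodMk_right u).contDiffAt
  have h1 : ∀ᶠ ξ in 𝓝 (0 : EuclideanSpace ℝ (Fin d)), DifferentiableAt ℝ (charLam p u) ξ :=
    (hf.eventually (by norm_num)).mono fun ξ hξ => hξ.differentiableAt (by norm_num)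
  have h2 := eventually_fderiv_neg (c := 1) h1
    ((eventually_charLam_neg hN hinv hirr hu).mono fun ξ hξ => by simpa using hξ) w
  have hf' : ContDiffAt ℝ 1 (fderiv ℝ (charLam p u)) 0 := hf.fderiv_right (by norm_num)
  have hf'w : ContDiffAt ℝ 1 (fun ξ => fderiv ℝ (charLam p u) ξ w) 0 :=
    hf'.clm_apply contDiffAt_const
  have h3 : ∀ᶠ ξ in 𝓝 (0 : EuclideanSpace ℝ (Fin d)),
      DifferentiableAt ℝ (fun ξ => fderiv ℝ (charLam p u) ξ w) ξ :=
    (hf'w.eventually (by norm_num)).mono fun ξ hξ => hξ.differentiableAt (by norm_num)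
  have h4 := (eventually_fderiv_neg h3 h2 v).self_of_nhds
  have h5 : fderiv ℝ (fun ξ => fderiv ℝ (charLam p u) ξ w) 0 v = hess p u v w := by
    rw [← fderiv_fderiv_charLam hN hinv hirr hu]
    have h6 := (hf'.differentiableAt (by norm_num)).hasFDerivAt.clm_apply
      (hasFDerivAt_const w (0 : EuclideanSpace ℝ (Fin d)))
    rw [h6.fderiv]
    simp
  rw [neg_zero, h5] at h4
  simpa using h4.symm

lemma charHess_eq_neg_Q (hN : 0 < N) (hinv : IsLatticeInvariant p)
    (hirr : IsStronglyIrreducible p) {u : EuclideanSpace ℝ (Fin d)} (hu : u ∈ finiteDomain p)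
    (i j : Fin d) : charHess p u i j = -(Q p u i j : ℂ) := by
  have h := hess_conj hN hinv hirr hu (EuclideanSpace.single i 1) (EuclideanSpace.single j 1)
  rw [← charHess_eq hN hinv hirr hu, Complex.conj_eq_iff_re] at h
  simp only [Q, of_apply]
  push_cast
  rw [neg_neg]
  exact h.symm

lemma hess_self (hN : 0 < N) (hinv : IsLatticeInvariant p)
    (hirr : IsStronglyIrreducible p) {u : EuclideanSpace ℝ (Fin d)} (hu : u ∈ finiteDomain p)
    (s : Fin d → ℝ) : hess p u (WithLp.toLp 2 s) (WithLp.toLp 2 s) =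
      ((-(s ⬝ᵥ Q p u *ᵥ s) : ℝ) : ℂ) := by
  have hs : (WithLp.toLp 2 s : EuclideanSpace ℝ (Fin d)) =
      ∑ i, s i • EuclideanSpace.single i (1 : ℝ) := by
    ext j
    simp [Finset.sum_apply, Pi.single_apply]
  have h1 : ∀ v w, hess p u v w = (fderiv ℝ (fderiv ℝ (charLam p u)) 0) v w := fun v w =>
    (fderiv_fderiv_charLam hN hinv hirr hu v w).symm
  have h2 : ∀ i j, fderiv ℝ (fderiv ℝ (charLam p u)) 0 (EuclideanSpace.single i 1)
      (EuclideanSpace.single j 1) = -(Q p u i j : ℂ) := fun i j => by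
    rw [fderiv_fderiv_charLam hN hinv hirr hu, ← charHess_eq hN hinv hirr hu,
      charHess_eq_neg_Q hN hinv hirr hu]
  rw [h1, hs]
  simp only [map_sum, map_smul, _root_.sum_apply, _root_.smul_apply, h2, Finset.smul_sum]
  refine Finset.sum_comm.trans ?_
  simp only [dotProduct, mulVec, Finset.mul_sum]
  push_cast
  rw [← Finset.sum_neg_distrib]
  refine Finset.sum_congr rfl fun i _ => ?_
  rw [← Finset.sum_neg_distrib]
  refine Finset.sum_congr rfl fun j _ => ?_
  simp only [Complex.real_smul]
  ring

lemma continuousAt_Q (hN : 0 < N) (hinv : IsLatticeInvariant p)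
    (hirr : IsStronglyIrreducible p) {u : EuclideanSpace ℝ (Fin d)} (hu : u ∈ finiteDomain p) :
    ContinuousAt (Q p) u := by
  refine continuousAt_pi.2 fun i => continuousAt_pi.2 fun j => ?_
  have h1 := (Complex.continuous_re.continuousAt.comp (continuousAt_hess hN hinv hirr hu
    (EuclideanSpace.single i 1) (EuclideanSpace.single j 1))).neg
  refine h1.congr ?_
  filter_upwards [isOpen_interior.mem_nhds hu] with v hv
  simp only [Q, of_apply]
  rw [charHess_eq hN hinv hirr hv]
  rfl

lemma Q_isHermitian (hN : 0 < N) (hinv : IsLatticeInvariant p)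
    (hirr : IsStronglyIrreducible p) {u : EuclideanSpace ℝ (Fin d)} (hu : u ∈ finiteDomain p) :
    (Q p u).IsHermitian := by
  ext i j
  simp only [conjTranspose_apply, Q, of_apply, star_trivial]
  rw [charHess_eq hN hinv hirr hu, charHess_eq hN hinv hirr hu, hess_comm hN hinv hirr hu]

/-- The characteristic eigenvalue has a Gaussian limit, locally uniformly on the level set. -/
lemma tendsto_charLam_pow (hN : 0 < N) (hinv : IsLatticeInvariant p)
    (hirr : IsStronglyIrreducible p) {u₀ : EuclideanSpace ℝ (Fin d)} (hu₀ : u₀ ∈ levelSet p)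
    {ι : Type*} {l : Filter ι} {u : ι → EuclideanSpace ℝ (Fin d)} {n : ι → ℕ}
    (hu : Tendsto u l (𝓝 u₀)) (hH : ∀ i, u i ∈ levelSet p) (hn : Tendsto n l atTop)
    (s : Fin d → ℝ) :
    Tendsto (fun i => charLam p (u i) (WithLp.toLp 2 ((Real.sqrt (n i))⁻¹ • s)) ^ n i) l
      (𝓝 (Complex.exp (((-(1 / 2) * (s ⬝ᵥ Q p u₀ *ᵥ s) : ℝ) : ℂ)))) := by
  have h1 := tendsto_pow_of_taylor (contDiffAt_charLam hN hinv hirr hu₀.1)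
    (WithLp.toLp 2 s) hu hn
    (Eventually.of_forall fun i => charLam_zero hN hinv hirr (hH i))
    (Eventually.of_forall fun i => by
      have h2 := hasFDerivAt_charLam_right (p := p) (u := u i) (ξ := 0)
        ((contDiffAt_charLam hN hinv hirr (hH i).1).differentiableAt (by norm_num))
      have h3 := h2.unique (hasFDerivAt_charLam_zero hN hinv hirr (hH i))
      simpa using DFunLike.congr_fun h3 (WithLp.toLp 2 s))
  convert! h1 using 3
  have h4 := hess_self hN hinv hirr hu₀.1 s
  rw [hess] at h4
  rw [h4]
  push_cast
  ring

/-- Gaussian decay of the characteristic matrices bounds the quadratic form from below. -/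
lemma le_quadForm_of_norm_Fc_pow_le (hN : 0 < N) (hinv : IsLatticeInvariant p)
    (hirr : IsStronglyIrreducible p) {u : EuclideanSpace ℝ (Fin d)} (hu : u ∈ levelSet p)
    {K c : ℝ} (hbound : ∀ ξ : Fin d → ℝ, ‖ξ‖ ≤ Real.pi → ∀ (n : ℕ) (k j : Fin N),
      ‖(Fc p (cplx u (WithLp.toLp 2 ξ)) ^ n) k j‖ ≤
        K * lam p u ^ n * Real.exp (-(c * n * ‖ξ‖ ^ 2))) (s : Fin d → ℝ) :
    2 * c * ‖s‖ ^ 2 ≤ s ⬝ᵥ Q p u *ᵥ s := by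
  rw [hu.2] at hbound
  have hdom : ∀ᶠ ξ in 𝓝 (0 : EuclideanSpace ℝ (Fin d)),
      IsDominantEigenvalue (chi p u ξ) (charLam p u ξ) :=
    ((Continuous.prodMk_right u).tendsto (0 : EuclideanSpace ℝ (Fin d))).eventually
      ((eventually_charLam hN hinv hirr hu.1).mono fun q hq => hq.2)
  obtain ⟨-, R, L, k, w, q, -, -, -, -, -, -, hev⟩ := exists_gap_near hN hinv hirr hu.1
  have hcc : Tendsto (fun ξ : EuclideanSpace ℝ (Fin d) => cplx u ξ) (𝓝 0) (𝓝 (cplx u 0)) :=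
    (continuous_cplx.comp (Continuous.prodMk_right u)).tendsto 0
  -- `charLam ^ n` is an eigenvalue of `chi ^ n`, hence at most the row sums of its entries, which
  -- are controlled by the decay hypothesis at `s/√n`. The limit in `n` compares two Gaussians.
  have hle : ∀ s : Fin d → ℝ, Real.exp (-(1 / 2) * (s ⬝ᵥ Q p u *ᵥ s)) ≤
      N * K * Real.exp (-(c * ‖s‖ ^ 2)) := by
    intro s
    have h1 := (tendsto_charLam_pow hN hinv hirr hu (l := atTop) (u := fun _ : ℕ => u)
      (n := fun n => n) tendsto_const_nhds (fun _ => hu) tendsto_id s).norm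
    rw [← Complex.ofReal_exp, Complex.norm_real, Real.norm_of_nonneg (Real.exp_pos _).le] at h1
    refine le_of_tendsto h1 ?_
    have hs0 : Tendsto (fun n : ℕ => (Real.sqrt n)⁻¹ • s) atTop (𝓝 0) := by
      have := ((tendsto_inv_atTop_zero.comp Real.tendsto_sqrt_atTop).comp
        (tendsto_natCast_atTop_atTop (R := ℝ))).smul_const s
      simpa using this
    have hs1 : Tendsto (fun n : ℕ => (WithLp.toLp 2 ((Real.sqrt n)⁻¹ • s) :
        EuclideanSpace ℝ (Fin d))) atTop (𝓝 0) :=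
      ((PiLp.continuous_toLp 2 (fun _ : Fin d => ℝ)).tendsto 0).comp hs0
    have hs2 : ∀ᶠ n : ℕ in atTop, ‖(Real.sqrt n)⁻¹ • s‖ < Real.pi := by
      have := hs0.norm
      rw [norm_zero] at this
      exact this.eventually_lt_const Real.pi_pos
    filter_upwards [hs1.eventually (hcc.eventually hev), hs2, eventually_ne_atTop 0]
      with n hgap hsn hn0
    have h2 := hgap.1.smul (phase_ne_zero (p := p) u (WithLp.toLp 2 ((Real.sqrt n)⁻¹ • s)))
    rw [← chi_eq] at h2
    have h3 : charLam p u (WithLp.toLp 2 ((Real.sqrt n)⁻¹ • s)) = _ := h2.dominantEigenvalue_eq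
    rw [← h3] at h2
    have hpow : ∀ m : ℕ, chi p u (WithLp.toLp 2 ((Real.sqrt n)⁻¹ • s)) ^ m *ᵥ
        R (cplx u (WithLp.toLp 2 ((Real.sqrt n)⁻¹ • s))) =
        charLam p u (WithLp.toLp 2 ((Real.sqrt n)⁻¹ • s)) ^ m •
        R (cplx u (WithLp.toLp 2 ((Real.sqrt n)⁻¹ • s))) := by
      intro m
      induction m with
      | zero => simp
      | succ m ih => rw [pow_succ, ← mulVec_mulVec, h2.right, mulVec_smul, ih, smul_smul, pow_succ']
    have hR0 : R (cplx u (WithLp.toLp 2 ((Real.sqrt n)⁻¹ • s))) ≠ 0 := fun h0 => by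
      have := h2.dot
      rw [h0, dotProduct_zero] at this
      exact zero_ne_one this
    have hns : (n : ℝ) * ‖(Real.sqrt n)⁻¹ • s‖ ^ 2 = ‖s‖ ^ 2 := by
      have hn1 : (0 : ℝ) < n := by exact_mod_cast Nat.pos_of_ne_zero hn0
      rw [norm_smul, mul_pow, norm_inv, Real.norm_of_nonneg (Real.sqrt_nonneg _), inv_pow,
        Real.sq_sqrt hn1.le]
      field_simp
    have hWB : WBound (chi p u (WithLp.toLp 2 ((Real.sqrt n)⁻¹ • s)) ^ n) (fun _ => 1)
        (N * K * Real.exp (-(c * ‖s‖ ^ 2))) := by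
      intro k
      have h4 : ∀ j, ‖(chi p u (WithLp.toLp 2 ((Real.sqrt n)⁻¹ • s)) ^ n) k j‖ * 1 ≤
          K * Real.exp (-(c * ‖s‖ ^ 2)) := by
        intro j
        rw [chi_eq, smul_pow, Matrix.smul_apply, norm_smul, norm_pow, norm_phase, one_pow, one_mul,
          mul_one]
        have h5 := hbound _ hsn.le n k j
        rwa [one_pow, mul_one, mul_assoc c, hns] at h5
      refine (Finset.sum_le_sum fun j _ => h4 j).trans (le_of_eq ?_)
      simp
      ring
    exact hWB.norm_eigenvalue_le (fun _ => one_pos) hR0 (hpow n) |>.trans_eq' (by simp)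
  by_contra! hneg
  have hδ : 0 < c * ‖s‖ ^ 2 - (s ⬝ᵥ Q p u *ᵥ s) / 2 := by linarith
  -- Replacing `s` by `t • s` with `t → ∞` makes the constant `N * K` irrelevant: only the exponents
  -- are compared.
  have h1 : ∀ t : ℝ, 1 ≤ N * K * Real.exp (-((c * ‖s‖ ^ 2 - (s ⬝ᵥ Q p u *ᵥ s) / 2) * t ^ 2)) := by
    intro t
    have h2 := hle (t • s)
    rw [mulVec_smul, smul_dotProduct, dotProduct_smul, norm_smul, mul_pow, Real.norm_eq_abs,
      sq_abs, smul_eq_mul, smul_eq_mul] at h2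
    have h3 := mul_le_mul_of_nonneg_right h2
      (Real.exp_pos ((1 / 2) * (t * (t * (s ⬝ᵥ Q p u *ᵥ s))))).le
    rw [← Real.exp_add, mul_assoc, ← Real.exp_add] at h3
    refine (le_of_eq ?_).trans (h3.trans (le_of_eq ?_))
    · rw [← Real.exp_zero]
      ring_nf
    · ring_nf
  have h4 : Tendsto (fun t : ℝ => N * K *
      Real.exp (-((c * ‖s‖ ^ 2 - (s ⬝ᵥ Q p u *ᵥ s) / 2) * t ^ 2))) atTop (𝓝 (N * K * 0)) := by
    refine (Real.tendsto_exp_neg_atTop_nhds_zero.comp ?_).const_mul _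
    exact (tendsto_pow_atTop two_ne_zero).const_mul_atTop hδ
  rw [mul_zero] at h4
  have h5 := ge_of_tendsto h4 (Eventually.of_forall h1)
  linarith

lemma exists_le_quadForm (hN : 0 < N) (hinv : IsLatticeInvariant p)
    (hirr : IsStronglyIrreducible p) {u₀ : EuclideanSpace ℝ (Fin d)} (hu₀ : u₀ ∈ finiteDomain p) :
    ∃ c : ℝ, 0 < c ∧ ∀ᶠ u in 𝓝 u₀, u ∈ levelSet p → ∀ s, c * ‖s‖ ^ 2 ≤ s ⬝ᵥ Q p u *ᵥ s := by
  obtain ⟨K, c, hK, hc, hev⟩ := exists_norm_Fc_pow_le hN hinv hirr hu₀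
  exact ⟨2 * c, by positivity, hev.mono fun u h hu s =>
    le_quadForm_of_norm_Fc_pow_le hN hinv hirr hu h s⟩

lemma Q_posDef (hN : 0 < N) (hinv : IsLatticeInvariant p) (hirr : IsStronglyIrreducible p)
    {u : EuclideanSpace ℝ (Fin d)} (hu : u ∈ levelSet p) : (Q p u).PosDef := by
  obtain ⟨c, hc, hev⟩ := exists_le_quadForm hN hinv hirr hu.1
  refine PosDef.of_dotProduct_mulVec_pos (Q_isHermitian hN hinv hirr hu.1) fun {s} hs => ?_
  rw [star_trivial]
  have hs0 : 0 < ‖s‖ := norm_pos_iff.2 hs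
  exact lt_of_lt_of_le (by positivity) (hev.self_of_nhds hu s)

end Hessian

/-! ### The projector `C(u)ν(u)` and limits of matrix powers -/

section Eigenvectors

open Matrix

variable {d N : ℕ} {p : TransitionKernel d N}

lemma posRightEigenvector_spec {A : Matrix (Fin N) (Fin N) ℝ} {r : ℝ} {w : Fin N → ℝ}
    (h : ∃ v : Fin N → ℝ, (∀ k, 0 < v k) ∧ A *ᵥ v = r • v ∧ w ⬝ᵥ v = 1) :
    (∀ k, 0 < posRightEigenvector A r w k) ∧
      A *ᵥ posRightEigenvector A r w = r • posRightEigenvector A r w ∧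
      w ⬝ᵥ posRightEigenvector A r w = 1 := by
  rw [posRightEigenvector, dif_pos h]
  exact h.choose_spec

lemma posLeftEigenvector_spec {A : Matrix (Fin N) (Fin N) ℝ} {r : ℝ} {w : Fin N → ℝ}
    (h : ∃ v : Fin N → ℝ, (∀ k, 0 < v k) ∧ v ᵥ* A = r • v ∧ v ⬝ᵥ w = 1) :
    (∀ k, 0 < posLeftEigenvector A r w k) ∧
      posLeftEigenvector A r w ᵥ* A = r • posLeftEigenvector A r w ∧
      posLeftEigenvector A r w ⬝ᵥ w = 1 := by
  rw [posLeftEigenvector, dif_pos h]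
  exact h.choose_spec

lemma dotProduct_pos (hN : 0 < N) {v w : Fin N → ℝ} (hv : ∀ i, 0 < v i) (hw : ∀ i, 0 < w i) :
    0 < v ⬝ᵥ w :=
  Finset.sum_pos (fun i _ => mul_pos (hv i) (hw i)) ⟨⟨0, hN⟩, Finset.mem_univ _⟩

lemma exists_posLeft (hN : 0 < N) (hinv : IsLatticeInvariant p) (hirr : IsStronglyIrreducible p)
    {u : EuclideanSpace ℝ (Fin d)} (hu : FiniteAt p u) {w : Fin N → ℝ} (hw : ∀ i, 0 < w i) :
    ∃ v : Fin N → ℝ, (∀ k, 0 < v k) ∧ v ᵥ* F p u = lam p u • v ∧ v ⬝ᵥ w = 1 := by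
  obtain ⟨-, v, -, -, hv, -, hvF, -⟩ := exists_perron_F hN hinv hirr hu
  have h := dotProduct_pos hN hv hw
  refine ⟨(v ⬝ᵥ w)⁻¹ • v, fun k => mul_pos (inv_pos.2 h) (hv k), ?_, ?_⟩
  · rw [smul_vecMul, hvF, smul_comm]
  · rw [smul_dotProduct, smul_eq_mul, inv_mul_cancel₀ h.ne']

lemma exists_posRight (hN : 0 < N) (hinv : IsLatticeInvariant p) (hirr : IsStronglyIrreducible p)
    {u : EuclideanSpace ℝ (Fin d)} (hu : FiniteAt p u) {w : Fin N → ℝ} (hw : ∀ i, 0 < w i) :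
    ∃ v : Fin N → ℝ, (∀ k, 0 < v k) ∧ F p u *ᵥ v = lam p u • v ∧ w ⬝ᵥ v = 1 := by
  obtain ⟨v, -, -, hv, -, hFv, -, -⟩ := exists_perron_F hN hinv hirr hu
  have h := dotProduct_pos hN hw hv
  refine ⟨(w ⬝ᵥ v)⁻¹ • v, fun k => mul_pos (inv_pos.2 h) (hv k), ?_, ?_⟩
  · rw [mulVec_smul, hFv, smul_comm]
  · rw [dotProduct_smul, smul_eq_mul, inv_mul_cancel₀ h.ne']

lemma nuZero_pos (hN : 0 < N) (hinv : IsLatticeInvariant p) (hirr : IsStronglyIrreducible p)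
    (k : Fin N) : 0 < nuZero p k := by
  rw [nuZero]
  split_ifs with h
  · exact (posLeftEigenvector_spec (exists_posLeft hN hinv hirr h fun _ => one_pos)).1 k
  · have : (0 : ℝ) < N := by exact_mod_cast hN
    positivity

lemma rightVec_spec (hN : 0 < N) (hinv : IsLatticeInvariant p) (hirr : IsStronglyIrreducible p)
    {u : EuclideanSpace ℝ (Fin d)} (hu : FiniteAt p u) :
    (∀ k, 0 < rightVec p u k) ∧ F p u *ᵥ rightVec p u = lam p u • rightVec p u ∧
      nuZero p ⬝ᵥ rightVec p u = 1 :=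
  posRightEigenvector_spec (exists_posRight hN hinv hirr hu (nuZero_pos hN hinv hirr))

lemma leftVec_spec (hN : 0 < N) (hinv : IsLatticeInvariant p) (hirr : IsStronglyIrreducible p)
    {u : EuclideanSpace ℝ (Fin d)} (hu : FiniteAt p u) :
    (∀ k, 0 < leftVec p u k) ∧ leftVec p u ᵥ* F p u = lam p u • leftVec p u ∧
      leftVec p u ⬝ᵥ rightVec p u = 1 :=
  posLeftEigenvector_spec (exists_posLeft hN hinv hirr hu (rightVec_spec hN hinv hirr hu).1)

/-- The projector does not depend on the normalization of the eigenvectors, so the chosen positive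
vectors and the continuous local ones can be compared through their product. -/
lemma SpectralGap.mul_eq_rightVec_mul_leftVec (hN : 0 < N) (hinv : IsLatticeInvariant p)
    (hirr : IsStronglyIrreducible p) {u : EuclideanSpace ℝ (Fin d)} (hu : FiniteAt p u)
    {R L : Fin N → ℂ} (h : SpectralGap (Fc p (cplx u 0)) (lamC p (cplx u 0)) R L) (k j : Fin N) :
    R k * L j = ((rightVec p u k * leftVec p u j : ℝ) : ℂ) := by
  rw [lamC_ofReal hN hinv hirr hu] at h
  obtain ⟨-, hR, -⟩ := rightVec_spec hN hinv hirr hu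
  obtain ⟨-, hL, hd⟩ := leftVec_spec hN hinv hirr hu
  have h1 := h.vecMulVec_unique (R' := fun i => (rightVec p u i : ℂ))
    (L' := fun i => (leftVec p u i : ℂ))
    (by rw [← F_map_eq]; exact map_mulVec_ofReal hR)
    (by rw [← F_map_eq]; exact map_vecMul_ofReal hL)
    (by exact_mod_cast dotProduct_ofReal hd)
  have h2 := congrFun (congrFun h1 k) j
  simp only [vecMulVec_apply] at h2
  rw [← h2]
  push_cast
  rfl

variable {ι : Type*} {l : Filter ι} {u : ι → EuclideanSpace ℝ (Fin d)} {n : ι → ℕ}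
  {u₀ : EuclideanSpace ℝ (Fin d)}

lemma tendsto_inv_sqrt (hn : Tendsto n l atTop) :
    Tendsto (fun i => (Real.sqrt (n i))⁻¹) l (𝓝 0) :=
  (tendsto_inv_atTop_zero.comp Real.tendsto_sqrt_atTop).comp
    (tendsto_natCast_atTop_atTop.comp hn)

/-- The projector `C(u)ν(u)` is continuous in `u`. -/
lemma tendsto_rightVec_mul_leftVec (hN : 0 < N) (hinv : IsLatticeInvariant p)
    (hirr : IsStronglyIrreducible p) (hu₀ : u₀ ∈ finiteDomain p) (hu : Tendsto u l (𝓝 u₀))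
    (k j : Fin N) : Tendsto (fun i => rightVec p (u i) k * leftVec p (u i) j) l
      (𝓝 (rightVec p u₀ k * leftVec p u₀ j)) := by
  obtain ⟨-, R, L, _, _, _, hR, hL, -, -, -, -, hev⟩ := exists_gap_near hN hinv hirr hu₀
  have hz : Tendsto (fun i => cplx (u i) 0) l (𝓝 (cplx u₀ 0)) :=
    ((continuous_cplx.comp (Continuous.prodMk_left 0)).tendsto u₀).comp hu
  have h1 : Tendsto (fun i => (R (cplx (u i) 0) k * L (cplx (u i) 0) j).re) l
      (𝓝 (R (cplx u₀ 0) k * L (cplx u₀ 0) j).re) :=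
    (Complex.continuous_re.tendsto _).comp ((((continuous_apply k).tendsto _).comp
      (hR.tendsto.comp hz)).mul (((continuous_apply j).tendsto _).comp (hL.tendsto.comp hz)))
  rw [hev.self_of_nhds.1.mul_eq_rightVec_mul_leftVec hN hinv hirr (finiteAt_of_mem hu₀),
    Complex.ofReal_re] at h1
  refine h1.congr' ?_
  filter_upwards [hz.eventually hev, hu.eventually (isOpen_interior.mem_nhds hu₀)] with i hi hi'
  rw [hi.1.mul_eq_rightVec_mul_leftVec hN hinv hirr (finiteAt_of_mem hi'), Complex.ofReal_re]

/-- Pointwise convergence of the rescaled powers of the characteristic matrices. -/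
lemma tendsto_chi_pow (hN : 0 < N) (hinv : IsLatticeInvariant p)
    (hirr : IsStronglyIrreducible p) (hu₀ : u₀ ∈ levelSet p) (hu : Tendsto u l (𝓝 u₀))
    (hH : ∀ i, u i ∈ levelSet p) (hn : Tendsto n l atTop) (s : Fin d → ℝ) (k j : Fin N) :
    Tendsto (fun i => (chi p (u i) (WithLp.toLp 2 ((Real.sqrt (n i))⁻¹ • s)) ^ n i) k j) l
      (𝓝 (Complex.exp (((-(1 / 2) * (s ⬝ᵥ Q p u₀ *ᵥ s) : ℝ) : ℂ)) *
        ((rightVec p u₀ k * leftVec p u₀ j : ℝ) : ℂ))) := by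
  obtain ⟨hlamC, R, L, m, w, q, hR, hL, hm, hw, hq, hq1, hev⟩ :=
    exists_gap_near hN hinv hirr hu₀.1
  set ξ : ι → EuclideanSpace ℝ (Fin d) := fun i => WithLp.toLp 2 ((Real.sqrt (n i))⁻¹ • s) with hξ
  have hξ0 : Tendsto ξ l (𝓝 0) := by
    have h1 := (tendsto_inv_sqrt hn).smul_const s
    rw [zero_smul] at h1
    exact ((PiLp.continuous_toLp 2 (fun _ : Fin d => ℝ)).tendsto 0).comp h1
  have hz : Tendsto (fun i => cplx (u i) (ξ i)) l (𝓝 (cplx u₀ 0)) :=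
    (continuous_cplx.tendsto (u₀, 0)).comp (hu.prodMk_nhds hξ0)
  have hgap₀ := hev.self_of_nhds.1
  set B : (Fin d → ℂ) → Matrix (Fin N) (Fin N) ℂ := fun z =>
    (lamC p z)⁻¹ • Fc p z - vecMulVec (R z) (L z) with hB
  have hBc : Tendsto (fun i => B (cplx (u i) (ξ i))) l (𝓝 (B (cplx u₀ 0))) := by
    have hFc : ContinuousAt (FcFun p) (cplx u₀ 0) :=
      (contDiffAt_FcFun 0 (by rw [reVec_cplx]; exact hu₀.1)).continuousAt
    have hBat : ContinuousAt B (cplx u₀ 0) := by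
      refine continuousAt_pi.2 fun a => continuousAt_pi.2 fun b => ?_
      exact ((hlamC.continuousAt.inv₀ hgap₀.ne_zero).mul
        ((continuous_apply_apply a b).continuousAt.comp hFc)).sub
        (((continuous_apply a).continuousAt.comp hR).mul ((continuous_apply b).continuousAt.comp hL))
    exact hBat.tendsto.comp hz
  obtain ⟨c, hc, hcB⟩ := exists_wBound hw (B (cplx u₀ 0))
  have hBn : Tendsto (fun i => B (cplx (u i) (ξ i)) ^ n i) l (𝓝 0) :=
    tendsto_pow_zero_of_wBound (K := c + 1) hw hq hq1 (by linarith) hm hn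
      ((hz.eventually hev).mono fun i hi => hi.2)
      (WBound.eventually hw hBc hcB (by linarith))
  have hRL : Tendsto (fun i => R (cplx (u i) (ξ i)) k * L (cplx (u i) (ξ i)) j) l
      (𝓝 (R (cplx u₀ 0) k * L (cplx u₀ 0) j)) :=
    (((continuous_apply k).tendsto _).comp (hR.tendsto.comp hz)).mul
      (((continuous_apply j).tendsto _).comp (hL.tendsto.comp hz))
  have hBkj : Tendsto (fun i => (B (cplx (u i) (ξ i)) ^ n i) k j) l (𝓝 0) :=
    tendsto_pi_nhds.1 (tendsto_pi_nhds.1 hBn k) j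
  -- For `n ≠ 0`, `χ^n` is `λ_u^n` times the sum of `B^n` and the projector: the factor converges to
  -- the Gaussian and `B^n` vanishes by the uniform contraction.
  have hlim := (tendsto_charLam_pow hN hinv hirr hu₀ hu hH hn s).mul (hBkj.add hRL)
  rw [zero_add] at hlim
  rw [hgap₀.mul_eq_rightVec_mul_leftVec hN hinv hirr (finiteAt_of_mem hu₀.1)] at hlim
  refine hlim.congr' ?_
  filter_upwards [hz.eventually hev, hn.eventually_ne_atTop 0,
    (hu.prodMk_nhds hξ0).eventually (eventually_charLam hN hinv hirr hu₀.1)] with i hi hni hi'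
  obtain ⟨a, ha⟩ := Nat.exists_eq_succ_of_ne_zero hni
  have h1 := hi.1.smul (inv_ne_zero hi.1.ne_zero)
  rw [inv_mul_cancel₀ hi.1.ne_zero] at h1
  have h2 := sub_smul_vecMulVec_pow h1.right h1.left h1.dot a
  rw [one_smul, one_pow, one_smul, smul_pow] at h2
  have h3 : (B (cplx (u i) (ξ i)) ^ (a + 1)) k j =
      (lamC p (cplx (u i) (ξ i)))⁻¹ ^ (a + 1) * (Fc p (cplx (u i) (ξ i)) ^ (a + 1)) k j -
        R (cplx (u i) (ξ i)) k * L (cplx (u i) (ξ i)) j := congrFun (congrFun h2 k) j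
  have h4 : (chi p (u i) (ξ i) ^ (a + 1)) k j =
      (phase p (u i) (ξ i)) ^ (a + 1) * (Fc p (cplx (u i) (ξ i)) ^ (a + 1)) k j := by
    rw [chi_eq, smul_pow]
    rfl
  have h5 : charLam p (u i) (ξ i) = _ := hi'.1
  change charLam p (u i) (ξ i) ^ n i * _ = (chi p (u i) (ξ i) ^ n i) k j
  rw [ha, Nat.succ_eq_add_one, h3, h4, h5, sub_add_cancel, mul_pow, inv_pow]
  have := pow_ne_zero (a + 1) hi.1.ne_zero
  field_simp

end Eigenvectors

/-! ### Rescaled Fourier inversion and the diagonal bound -/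

section Inversion

open Matrix MeasureTheory

variable {d N : ℕ} {p : TransitionKernel d N}

lemma integrable_exp_neg_mul_sq_norm {c : ℝ} (hc : 0 < c) :
    Integrable fun s : Fin d → ℝ => Real.exp (-(c * ‖s‖ ^ 2)) := by
  -- The sup norm is compared with the Euclidean one; `d + 1` avoids a division by zero when `d =
  -- 0`.
  have hb : 0 < c / (d + 1) := by positivity
  have h1 := (GaussianFourier.integrable_cexp_neg_mul_sum_add (b := ((c / (d + 1) : ℝ) : ℂ))
    (ι := Fin d) (by rwa [Complex.ofReal_re]) 0).norm
  refine h1.mono' (by fun_prop) (Eventually.of_forall fun s => ?_)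
  have h2 : -((c / (d + 1) : ℝ) : ℂ) * ∑ i, (s i : ℂ) ^ 2 + ∑ i, (0 : Fin d → ℂ) i * (s i : ℂ) =
      ((-(c / (d + 1) * ∑ i, s i ^ 2) : ℝ) : ℂ) := by
    push_cast
    simp
  rw [h2, ← Complex.ofReal_exp, Complex.norm_real, Real.norm_of_nonneg (Real.exp_pos _).le,
    Real.norm_of_nonneg (Real.exp_pos _).le, Real.exp_le_exp, neg_le_neg_iff]
  have h3 : ∑ i, s i ^ 2 ≤ (d + 1) * ‖s‖ ^ 2 := by
    calc ∑ i, s i ^ 2 ≤ ∑ _i : Fin d, ‖s‖ ^ 2 := Finset.sum_le_sum fun i _ => by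
          rw [← sq_abs, ← Real.norm_eq_abs]
          gcongr
          exact norm_le_pi_norm s i
      _ = d * ‖s‖ ^ 2 := by simp
      _ ≤ _ := by nlinarith [sq_nonneg ‖s‖]
  calc c / (d + 1) * ∑ i, s i ^ 2 ≤ c / (d + 1) * ((d + 1) * ‖s‖ ^ 2) := by gcongr
    _ = c * ‖s‖ ^ 2 := by field_simp

/-- The rescaled characteristic function, truncated to the dual torus. -/
def rescaled (p : TransitionKernel d N) (n : ℕ) (u : EuclideanSpace ℝ (Fin d)) (k j : Fin N)
    (s : Fin d → ℝ) : ℂ :=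
  (box d).indicator (fun ξ => (chi p u (WithLp.toLp 2 ξ) ^ n) k j) ((Real.sqrt n)⁻¹ • s)

lemma continuous_chi_pow {u : EuclideanSpace ℝ (Fin d)} (hu : u ∈ finiteDomain p) (n : ℕ)
    (k j : Fin N) :
    Continuous fun ξ : Fin d → ℝ => (chi p u (WithLp.toLp 2 ξ) ^ n) k j := by
  have h1 : Continuous fun ξ : Fin d → ℝ => (chi p u (WithLp.toLp 2 ξ) : Matrix _ _ ℂ) := by
    have h2 : Continuous fun ξ : EuclideanSpace ℝ (Fin d) => FcFun p (cplx u ξ) := by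
      refine continuous_iff_continuousAt.2 fun ξ => ?_
      have h3 : ContinuousAt (FcFun p) (cplx u ξ) :=
        (contDiffAt_FcFun 0 (by rwa [reVec_cplx])).continuousAt
      exact ContinuousAt.comp (f := fun ξ => cplx u ξ) h3
        (continuous_cplx.comp (Continuous.prodMk_right u)).continuousAt
    have h4 : Continuous fun ξ : EuclideanSpace ℝ (Fin d) => phase p u ξ := by
      unfold phase
      fun_prop
    refine continuous_pi fun a => continuous_pi fun b => ?_
    simp only [chi_eq]
    exact (h4.mul ((continuous_apply_apply a b).comp h2)).comp
      (PiLp.continuous_toLp 2 (fun _ : Fin d => ℝ))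
  exact (continuous_apply_apply k j).comp (h1.pow n)

lemma measurable_rescaled {u : EuclideanSpace ℝ (Fin d)} (hu : u ∈ finiteDomain p) (n : ℕ)
    (k j : Fin N) : Measurable (rescaled p n u k j) :=
  ((continuous_chi_pow hu n k j).measurable.indicator measurableSet_box).comp
    (measurable_const_smul _)

lemma norm_chi_pow (n : ℕ) (u ξ : EuclideanSpace ℝ (Fin d)) (k j : Fin N) :
    ‖(chi p u ξ ^ n) k j‖ = ‖(Fc p (cplx u ξ) ^ n) k j‖ := by
  rw [chi_eq, smul_pow, Matrix.smul_apply, norm_smul, norm_pow, norm_phase, one_pow, one_mul]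

/-- Since `n ‖s/√n‖² = ‖s‖²`, the Gaussian factor no longer depends on `n`; on the level set neither
does `λ(u)^n`. This is the dominating function. -/
lemma norm_rescaled_le {u : EuclideanSpace ℝ (Fin d)} {K c : ℝ} (hK : 0 ≤ K) (hlam : 0 ≤ lam p u)
    (hbound : ∀ ξ : Fin d → ℝ, ‖ξ‖ ≤ Real.pi → ∀ (n : ℕ) (k j : Fin N),
      ‖(Fc p (cplx u (WithLp.toLp 2 ξ)) ^ n) k j‖ ≤
        K * lam p u ^ n * Real.exp (-(c * n * ‖ξ‖ ^ 2))) {n : ℕ} (hn : n ≠ 0) (k j : Fin N)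
    (s : Fin d → ℝ) : ‖rescaled p n u k j s‖ ≤ K * lam p u ^ n * Real.exp (-(c * ‖s‖ ^ 2)) := by
  rw [rescaled, norm_indicator_eq_indicator_norm]
  refine Set.indicator_apply_le' (fun h => ?_) fun _ => by positivity
  rw [norm_chi_pow]
  refine (hbound _ (norm_le_of_mem_box h) n k j).trans_eq ?_
  have hn0 : (0 : ℝ) < n := by exact_mod_cast Nat.pos_of_ne_zero hn
  rw [norm_smul, mul_pow, norm_inv, Real.norm_of_nonneg (Real.sqrt_nonneg _), inv_pow,
    Real.sq_sqrt hn0.le]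
  congr 2
  field_simp

/-- The normalized displacement `(x - n∇λ(u)) / √n`. -/
def displacement (p : TransitionKernel d N) (n : ℕ) (x : Fin d → ℤ)
    (u : EuclideanSpace ℝ (Fin d)) : EuclideanSpace ℝ (Fin d) :=
  (Real.sqrt n)⁻¹ • (toVec x - (n : ℝ) • gradient (lam p) u)

lemma norm_displacement (n : ℕ) (x : Fin d → ℤ) (u : EuclideanSpace ℝ (Fin d)) :
    ‖displacement p n x u‖ = ‖toVec x - (n : ℝ) • gradient (lam p) u‖ / Real.sqrt n := by
  rw [displacement, norm_smul, norm_inv, Real.norm_of_nonneg (Real.sqrt_nonneg _), div_eq_inv_mul]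

/-- The Fourier inversion formula in the scale of the local limit theorem. -/
lemma integral_rescaled (hinv : IsLatticeInvariant p) {u : EuclideanSpace ℝ (Fin d)}
    (hu : FiniteAt p u) {n : ℕ} (hn : n ≠ 0) (x : Fin d → ℤ) (k j : Fin N) :
    ∫ s : Fin d → ℝ, Complex.exp (-Complex.I * ((∑ i, displacement p n x u i * s i : ℝ) : ℂ)) *
      rescaled p n u k j s =
      (((2 * Real.pi) ^ ((d : ℝ) / 2) * ((2 * Real.pi * n) ^ ((d : ℝ) / 2) * P p n u x k j) : ℝ) : ℂ) := by
  have hn0 : (0 : ℝ) < n := by exact_mod_cast Nat.pos_of_ne_zero hn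
  have hsq : Real.sqrt n ≠ 0 := (Real.sqrt_pos.2 hn0).ne'
  set f : (Fin d → ℝ) → ℂ := (box d).indicator fun ξ =>
    Complex.exp (-Complex.I * ∑ i, (x i : ℂ) * (ξ i : ℂ)) *
      (Fc p (cplx u (WithLp.toLp 2 ξ)) ^ n) k j with hf
  -- With `ξ = s/√n`, the centering `n∇λ(u)` in the displacement cancels the `n`-th power of the
  -- phase in `chi`.
  have h1 : ∀ s : Fin d → ℝ, Complex.exp (-Complex.I *
      ((∑ i, displacement p n x u i * s i : ℝ) : ℂ)) * rescaled p n u k j s =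
      f ((Real.sqrt n)⁻¹ • s) := by
    intro s
    rw [rescaled, hf]
    by_cases hs : (Real.sqrt n)⁻¹ • s ∈ box d
    · rw [Set.indicator_of_mem hs, Set.indicator_of_mem hs, chi_eq, smul_pow, Matrix.smul_apply,
        smul_eq_mul, ← mul_assoc, phase, ← Complex.exp_nat_mul, ← Complex.exp_add]
      congr 2
      rw [real_inner_comm, PiLp.inner_apply, ← mul_assoc, mul_comm (n : ℂ), mul_assoc, ← mul_add]
      congr 1
      have h2 : (n : ℂ) = (((n : ℝ)) : ℂ) := by push_cast; rfl
      rw [h2, ← Complex.ofReal_mul, ← Complex.ofReal_add]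
      have h3 : ∑ i, (x i : ℂ) * (((Real.sqrt n)⁻¹ • s) i : ℂ) =
          ((∑ i, (x i : ℝ) * ((Real.sqrt n)⁻¹ • s) i : ℝ) : ℂ) := by push_cast; rfl
      rw [h3]
      congr 1
      rw [Finset.mul_sum, ← Finset.sum_add_distrib]
      refine Finset.sum_congr rfl fun i _ => ?_
      simp [displacement, toVec]
      ring
    · rw [Set.indicator_of_notMem hs, Set.indicator_of_notMem hs, mul_zero]
  simp only [h1]
  rw [Measure.integral_comp_smul, hf, integral_indicator measurableSet_box,
    integral_box_Fc_pow hinv hu, Module.finrank_fin_fun]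
  have h2 : (2 * Real.pi * n) ^ ((d : ℝ) / 2) = (2 * Real.pi) ^ ((d : ℝ) / 2) * Real.sqrt n ^ d := by
    rw [Real.mul_rpow (by positivity) hn0.le, Real.sqrt_eq_rpow, ← Real.rpow_natCast,
      ← Real.rpow_mul hn0.le]
    congr 2
    ring
  have h3 : (2 * Real.pi) ^ d = (2 * Real.pi) ^ ((d : ℝ) / 2) * (2 * Real.pi) ^ ((d : ℝ) / 2) := by
    rw [← Real.rpow_add (by positivity), add_halves, Real.rpow_natCast]
  rw [h2, Complex.real_smul, ← Complex.ofReal_pow, h3, inv_pow, inv_inv,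
    abs_of_nonneg (by positivity)]
  push_cast
  ring

/-- The diagonal bound `n^{d/2} P_u^{(n)}(0, x) = O(λ(u)^n)`. -/
lemma exists_P_le (hN : 0 < N) (hinv : IsLatticeInvariant p) (hirr : IsStronglyIrreducible p)
    {u₀ : EuclideanSpace ℝ (Fin d)} (hu₀ : u₀ ∈ finiteDomain p) :
    ∃ K : ℝ, 0 < K ∧ ∀ᶠ u in 𝓝 u₀, ∀ n : ℕ, n ≠ 0 → ∀ (x : Fin d → ℤ) (k j : Fin N),
      (2 * Real.pi * n) ^ ((d : ℝ) / 2) * P p n u x k j ≤ K * lam p u ^ n := by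
  obtain ⟨K, c, hK, hc, hev⟩ := exists_norm_Fc_pow_le hN hinv hirr hu₀
  have hI : 0 ≤ ∫ s : Fin d → ℝ, Real.exp (-(c * ‖s‖ ^ 2)) := integral_nonneg fun s => (Real.exp_pos _).le
  have hpi : 0 < (2 * Real.pi) ^ ((d : ℝ) / 2) := by positivity
  refine ⟨((2 * Real.pi) ^ ((d : ℝ) / 2))⁻¹ * (K * ((∫ s : Fin d → ℝ, Real.exp (-(c * ‖s‖ ^ 2))) + 1)),
    by positivity, ?_⟩
  filter_upwards [hev, isOpen_interior.mem_nhds hu₀] with u hbound hu n hn x k j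
  have hlam : 0 < lam p u := by
    obtain ⟨-, -, h, -⟩ := exists_perron_F hN hinv hirr (finiteAt_of_mem hu)
    exact h
  have h1 := norm_integral_le_of_norm_le
    (((integrable_exp_neg_mul_sq_norm (d := d) hc).const_mul (K * lam p u ^ n)))
    (Eventually.of_forall fun s => by
      rw [norm_mul, show -Complex.I * ((∑ i, displacement p n x u i * s i : ℝ) : ℂ) =
        ((-∑ i, displacement p n x u i * s i : ℝ) : ℂ) * Complex.I by push_cast; ring,
        Complex.norm_exp_ofReal_mul_I, one_mul]
      exact norm_rescaled_le hK.le hlam.le hbound hn k j s)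
    (f := fun s => Complex.exp (-Complex.I * ((∑ i, displacement p n x u i * s i : ℝ) : ℂ)) *
      rescaled p n u k j s)
  rw [integral_rescaled hinv (finiteAt_of_mem hu) hn, Complex.norm_real, integral_const_mul] at h1
  have h2 := (le_abs_self _).trans h1
  rw [inv_mul_eq_div, div_mul_eq_mul_div, le_div_iff₀' hpi]
  refine h2.trans ?_
  have := pow_pos hlam n
  nlinarith [mul_pos hK this]

end Inversion

/-! ### The local limit theorem without weight -/

section LocalLimit

open Matrix MeasureTheory

variable {d N : ℕ} {p : TransitionKernel d N}

lemma Sig_displacement {n : ℕ} (hn : n ≠ 0) (x : Fin d → ℤ) (u : EuclideanSpace ℝ (Fin d)) :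
    -(1 / (2 * (n : ℝ))) * Sig p u (toVec x - (n : ℝ) • gradient (lam p) u) =
      -(1 / 2) * Sig p u (displacement p n x u) := by
  have hn0 : (0 : ℝ) < n := by exact_mod_cast Nat.pos_of_ne_zero hn
  have h1 : (Real.sqrt n)⁻¹ * (Real.sqrt n)⁻¹ = (n : ℝ)⁻¹ := by
    rw [← mul_inv, Real.mul_self_sqrt hn0.le]
  rw [displacement, Sig, Sig, WithLp.ofLp_smul, mulVec_smul, smul_dotProduct, dotProduct_smul,
    smul_eq_mul, smul_eq_mul, ← mul_assoc (Real.sqrt n)⁻¹, h1]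
  field_simp

lemma A_apply {n : ℕ} (hn : n ≠ 0) (x : Fin d → ℤ) (u : EuclideanSpace ℝ (Fin d)) (k j : Fin N) :
    A p n x u k j = (2 * Real.pi * n) ^ ((d : ℝ) / 2) * P p n u x k j -
      ((Q p u).det ^ (-(1 / 2) : ℝ) * Real.exp (-(1 / 2) * Sig p u (displacement p n x u))) *
        (rightVec p u k * leftVec p u j) := by
  rw [← Sig_displacement hn]
  rfl

/-- The difference of the rescaled characteristic function and its Gaussian limit. -/
def fourierError (p : TransitionKernel d N) (n : ℕ) (u : EuclideanSpace ℝ (Fin d)) (k j : Fin N)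
    (s : Fin d → ℝ) : ℂ :=
  rescaled p n u k j s - Complex.exp (((-(1 / 2) * (s ⬝ᵥ Q p u *ᵥ s) : ℝ) : ℂ)) *
    ((rightVec p u k * leftVec p u j : ℝ) : ℂ)

lemma norm_cexp_neg_I_mul (y : ℝ) : ‖Complex.exp (-Complex.I * (y : ℂ))‖ = 1 := by
  rw [show -Complex.I * (y : ℂ) = ((-y : ℝ) : ℂ) * Complex.I by push_cast; ring,
    Complex.norm_exp_ofReal_mul_I]

lemma integrable_gaussian {Q : Matrix (Fin d) (Fin d) ℝ} {c : ℝ} (hc : 0 < c)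
    (h : ∀ s, c * ‖s‖ ^ 2 ≤ s ⬝ᵥ Q *ᵥ s) :
    Integrable fun s : Fin d → ℝ => Complex.exp (((-(1 / 2) * (s ⬝ᵥ Q *ᵥ s) : ℝ) : ℂ)) := by
  refine (integrable_exp_neg_mul_sq_norm (half_pos hc)).mono' ?_ (Eventually.of_forall fun s => ?_)
  · have : Continuous fun s : Fin d → ℝ => s ⬝ᵥ Q *ᵥ s :=
      continuous_id.dotProduct (continuous_const.matrix_mulVec continuous_id)
    exact Continuous.aestronglyMeasurable (by fun_prop)
  · rw [← Complex.ofReal_exp, Complex.norm_real, Real.norm_of_nonneg (Real.exp_pos _).le,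
      Real.exp_le_exp]
    linarith [h s]

lemma integrable_rescaled (hN : 0 < N) (hinv : IsLatticeInvariant p)
    (hirr : IsStronglyIrreducible p) {u : EuclideanSpace ℝ (Fin d)} (hu : u ∈ finiteDomain p)
    {n : ℕ} (hn : n ≠ 0) (k j : Fin N) : Integrable (rescaled p n u k j) := by
  obtain ⟨K, c, hK, hc, hev⟩ := exists_norm_Fc_pow_le hN hinv hirr hu
  obtain ⟨-, -, hlam, -⟩ := exists_perron_F hN hinv hirr (finiteAt_of_mem hu)
  exact ((integrable_exp_neg_mul_sq_norm hc).const_mul (K * lam p u ^ n)).mono'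
    (measurable_rescaled hu n k j).aestronglyMeasurable
    (Eventually.of_forall (norm_rescaled_le hK.le hlam.le hev.self_of_nhds hn k j))

/-- Both terms of `A` are Fourier transforms at the same displacement, and a Fourier transform is
bounded by the `L¹` norm. The point `x` disappears, hence uniformity in `x`. -/
lemma abs_A_le (hN : 0 < N) (hinv : IsLatticeInvariant p) (hirr : IsStronglyIrreducible p)
    {u : EuclideanSpace ℝ (Fin d)} (hu : u ∈ levelSet p) {n : ℕ} (hn : n ≠ 0) (x : Fin d → ℤ)
    (k j : Fin N) : (2 * Real.pi) ^ ((d : ℝ) / 2) * |A p n x u k j| ≤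
      ∫ s, ‖fourierError p n u k j s‖ := by
  set y : Fin d → ℝ := (displacement p n x u).ofLp with hy
  obtain ⟨c, hc, hev⟩ := exists_le_quadForm hN hinv hirr hu.1
  have h1 := integral_rescaled hinv (finiteAt_of_mem hu.1) hn x k j
  have h2 := integral_cexp_quadraticForm (Q_posDef hN hinv hirr hu) y
  have hbdd : ∀ {f : (Fin d → ℝ) → ℂ}, Integrable f → Integrable fun s =>
      Complex.exp (-Complex.I * ((∑ i, y i * s i : ℝ) : ℂ)) * f s := fun hf =>
    hf.bdd_mul (c := 1) (Continuous.aestronglyMeasurable (by fun_prop)) (Eventually.of_forall fun s => (norm_cexp_neg_I_mul _).le)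
  have h3 := (hbdd (integrable_gaussian hc (hev.self_of_nhds hu))).mul_const
    ((rightVec p u k * leftVec p u j : ℝ) : ℂ)
  have h4 : (((2 * Real.pi) ^ ((d : ℝ) / 2) * A p n x u k j : ℝ) : ℂ) =
      ∫ s, Complex.exp (-Complex.I * ((∑ i, y i * s i : ℝ) : ℂ)) * fourierError p n u k j s := by
    have h5 : ∀ s, Complex.exp (-Complex.I * ((∑ i, y i * s i : ℝ) : ℂ)) * fourierError p n u k j s =
        Complex.exp (-Complex.I * ((∑ i, y i * s i : ℝ) : ℂ)) * rescaled p n u k j s -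
        Complex.exp (-Complex.I * ((∑ i, y i * s i : ℝ) : ℂ)) *
          Complex.exp (((-(1 / 2) * (s ⬝ᵥ Q p u *ᵥ s) : ℝ) : ℂ)) *
          ((rightVec p u k * leftVec p u j : ℝ) : ℂ) := fun s => by
      rw [fourierError]
      ring
    simp only [h5]
    rw [integral_sub (hbdd (integrable_rescaled hN hinv hirr hu.1 hn k j)) h3, integral_mul_const,
      h1, h2, A_apply hn, Sig]
    push_cast
    ring
  rw [← abs_of_pos (a := (2 * Real.pi) ^ ((d : ℝ) / 2)) (by positivity), ← abs_mul,
    ← Real.norm_eq_abs, ← Complex.norm_real, h4]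
  refine (norm_integral_le_integral_norm _).trans_eq ?_
  simp only [norm_mul, norm_cexp_neg_I_mul, one_mul]

variable {u : ℕ → EuclideanSpace ℝ (Fin d)} {n : ℕ → ℕ} {u₀ : EuclideanSpace ℝ (Fin d)}

lemma tendsto_Q (hN : 0 < N) (hinv : IsLatticeInvariant p)
    (hirr : IsStronglyIrreducible p) (hu₀ : u₀ ∈ finiteDomain p) (hu : Tendsto u atTop (𝓝 u₀)) :
    Tendsto (fun m => Q p (u m)) atTop (𝓝 (Q p u₀)) :=
  (continuousAt_Q hN hinv hirr hu₀).tendsto.comp hu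

lemma tendsto_fourierError (hN : 0 < N) (hinv : IsLatticeInvariant p)
    (hirr : IsStronglyIrreducible p) (hu₀ : u₀ ∈ levelSet p) (hu : Tendsto u atTop (𝓝 u₀))
    (hH : ∀ m, u m ∈ levelSet p) (hn : Tendsto n atTop atTop) (k j : Fin N) (s : Fin d → ℝ) :
    Tendsto (fun m => fourierError p (n m) (u m) k j s) atTop (𝓝 0) := by
  have h1 := tendsto_chi_pow hN hinv hirr hu₀ hu hH hn s k j
  have hc : Continuous fun M : Matrix (Fin d) (Fin d) ℝ => s ⬝ᵥ M *ᵥ s :=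
    continuous_const.dotProduct (continuous_id.matrix_mulVec continuous_const)
  have h2 : Tendsto (fun m => s ⬝ᵥ Q p (u m) *ᵥ s) atTop (𝓝 (s ⬝ᵥ Q p u₀ *ᵥ s)) :=
    (hc.tendsto _).comp (tendsto_Q hN hinv hirr hu₀.1 hu)
  have h3 : Tendsto (fun m => Complex.exp (((-(1 / 2) * (s ⬝ᵥ Q p (u m) *ᵥ s) : ℝ) : ℂ)) *
      ((rightVec p (u m) k * leftVec p (u m) j : ℝ) : ℂ)) atTop
      (𝓝 (Complex.exp (((-(1 / 2) * (s ⬝ᵥ Q p u₀ *ᵥ s) : ℝ) : ℂ)) *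
        ((rightVec p u₀ k * leftVec p u₀ j : ℝ) : ℂ))) :=
    ((Complex.continuous_exp.tendsto _).comp ((Complex.continuous_ofReal.tendsto _).comp
      (h2.const_mul _))).mul ((Complex.continuous_ofReal.tendsto _).comp
      (tendsto_rightVec_mul_leftVec hN hinv hirr hu₀.1 hu k j))
  have h4 := h1.sub h3
  rw [sub_self] at h4
  refine h4.congr' ?_
  have hs0 : Tendsto (fun m => (Real.sqrt (n m))⁻¹ • s) atTop (𝓝 0) := by
    have := (tendsto_inv_sqrt hn).smul_const s
    rwa [zero_smul] at this
  have hs1 := hs0.norm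
  rw [norm_zero] at hs1
  filter_upwards [hs1.eventually_lt_const Real.pi_pos] with m hm
  have hbox : (Real.sqrt (n m))⁻¹ • s ∈ box d := fun i _ => by
    have := (norm_le_pi_norm ((Real.sqrt (n m))⁻¹ • s) i).trans_lt hm
    rw [Real.norm_eq_abs, abs_lt] at this
    exact ⟨this.1, this.2.le⟩
  rw [fourierError, rescaled, Set.indicator_of_mem hbox]

/-- Dominated convergence with Gaussian majorants whose constants are uniform for `u` near `u₀`. -/
lemma tendsto_integral_fourierError (hN : 0 < N) (hinv : IsLatticeInvariant p)
    (hirr : IsStronglyIrreducible p) (hu₀ : u₀ ∈ levelSet p) (hu : Tendsto u atTop (𝓝 u₀))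
    (hH : ∀ m, u m ∈ levelSet p) (hn : Tendsto n atTop atTop) (k j : Fin N) :
    Tendsto (fun m => ∫ s, ‖fourierError p (n m) (u m) k j s‖) atTop (𝓝 0) := by
  obtain ⟨K, c, hK, hc, hev⟩ := exists_norm_Fc_pow_le hN hinv hirr hu₀.1
  obtain ⟨c', hc', hev'⟩ := exists_le_quadForm hN hinv hirr hu₀.1
  set M := |rightVec p u₀ k * leftVec p u₀ j| + 1 with hM
  have hRL := (tendsto_rightVec_mul_leftVec hN hinv hirr hu₀.1 hu k j).abs.eventually_lt_const
    (lt_add_one _)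
  have h := tendsto_integral_filter_of_dominated_convergence (μ := volume) (l := atTop)
    (F := fun m s => ‖fourierError p (n m) (u m) k j s‖) (f := fun _ => 0)
    (fun s => K * Real.exp (-(c * ‖s‖ ^ 2)) + M * Real.exp (-(c' / 2 * ‖s‖ ^ 2))) ?_ ?_
    (((integrable_exp_neg_mul_sq_norm hc).const_mul K).add
      ((integrable_exp_neg_mul_sq_norm (half_pos hc')).const_mul M))
    (Eventually.of_forall fun s => by
      simpa using (tendsto_fourierError hN hinv hirr hu₀ hu hH hn k j s).norm)
  · simpa using h
  · refine Eventually.of_forall fun m => ?_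
    obtain ⟨c₁, hc₁, hev₁⟩ := exists_le_quadForm hN hinv hirr (hH m).1
    exact ((measurable_rescaled (hH m).1 _ k j).aestronglyMeasurable.sub
      ((integrable_gaussian hc₁ (hev₁.self_of_nhds (hH m))).aestronglyMeasurable.mul_const _)).norm
  · filter_upwards [hu.eventually hev, hu.eventually hev', hRL, hn.eventually_ne_atTop 0]
      with m h1 h2 h3 h4
    refine Eventually.of_forall fun s => ?_
    rw [norm_norm, fourierError]
    refine (norm_sub_le _ _).trans (add_le_add ?_ ?_)
    · have h5 := norm_rescaled_le hK.le (by rw [(hH m).2]; exact zero_le_one) h1 h4 k j s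
      rwa [(hH m).2, one_pow, mul_one] at h5
    · rw [norm_mul, ← Complex.ofReal_exp, Complex.norm_real, Complex.norm_real,
        Real.norm_of_nonneg (Real.exp_pos _).le, mul_comm, Real.norm_eq_abs]
      refine mul_le_mul h3.le (Real.exp_le_exp.2 ?_) (Real.exp_pos _).le (by positivity)
      linarith [h2 (hH m) s]

/-- The local limit theorem without weight. -/
lemma tendsto_A (hN : 0 < N) (hinv : IsLatticeInvariant p)
    (hirr : IsStronglyIrreducible p) (hu₀ : u₀ ∈ levelSet p) (hu : Tendsto u atTop (𝓝 u₀))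
    (hH : ∀ m, u m ∈ levelSet p) (hn : Tendsto n atTop atTop) (x : ℕ → Fin d → ℤ) (k j : Fin N) :
    Tendsto (fun m => A p (n m) (x m) (u m) k j) atTop (𝓝 0) := by
  have hpi : 0 < (2 * Real.pi) ^ ((d : ℝ) / 2) := by positivity
  have h := (tendsto_integral_fourierError hN hinv hirr hu₀ hu hH hn k j).const_mul
    ((2 * Real.pi) ^ ((d : ℝ) / 2))⁻¹
  rw [mul_zero] at h
  refine squeeze_zero_norm' ?_ h
  filter_upwards [hn.eventually_ne_atTop 0] with m hm
  rw [Real.norm_eq_abs, inv_mul_eq_div, le_div_iff₀' hpi]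
  exact abs_A_le hN hinv hirr (hH m) hm (x m) k j

end LocalLimit

/-! ### Exponential tails, the weight and uniformity -/

section Tail

open Matrix

variable {d N : ℕ} {p : TransitionKernel d N}

/-- A quadratic upper bound at `u`, uniform for `u` close to a point where `f` is `C²`. -/
lemma exists_le_add_fderiv_add_sq {E : Type*} [NormedAddCommGroup E] [NormedSpace ℝ E] {f : E → ℝ}
    {u₀ : E} (hf : ContDiffAt ℝ 2 f u₀) : ∃ C δ : ℝ, 0 ≤ C ∧ 0 < δ ∧ ∀ u v : E,
      ‖u - u₀‖ < δ → ‖v‖ < δ → f (u + v) ≤ f u + fderiv ℝ f u v + C * ‖v‖ ^ 2 := by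
  obtain ⟨C, t, ht, hC⟩ := (hf.fderiv_right (m := 1) (by norm_num)).exists_lipschitzOnWith
  have hd : ∀ᶠ v in 𝓝 u₀, DifferentiableAt ℝ f v :=
    (hf.eventually (by norm_num)).mono fun v hv => hv.differentiableAt (by norm_num)
  obtain ⟨δ, hδ, hball⟩ := Metric.eventually_nhds_iff_ball.1 ((eventually_mem_set.2 ht).and hd)
  refine ⟨C, δ / 2, C.2, half_pos hδ, fun u v hu hv => ?_⟩
  have hmem : ∀ w ∈ Metric.closedBall u ‖v‖, w ∈ Metric.ball u₀ δ := fun w hw => by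
    rw [Metric.mem_ball]
    rw [Metric.mem_closedBall] at hw
    have := dist_triangle w u u₀
    rw [dist_eq_norm u u₀] at this
    linarith
  have h1 := Convex.norm_image_sub_le_of_norm_fderiv_le' (f := f) (φ := fderiv ℝ f u)
    (C := C * ‖v‖) (s := Metric.closedBall u ‖v‖) (x := u) (y := u + v)
    (fun w hw => (hball w (hmem w hw)).2)
    (fun w hw => by
      have h2 := hC.dist_le_mul w (hball w (hmem w hw)).1 u
        (hball u (hmem u (Metric.mem_closedBall_self (norm_nonneg _)))).1
      rw [dist_eq_norm] at h2
      exact h2.trans (mul_le_mul_of_nonneg_left hw C.2))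
    (convex_closedBall u ‖v‖) (Metric.mem_closedBall_self (norm_nonneg _)) (by simp)
  rw [add_sub_cancel_left] at h1
  have h2 := (le_abs_self _).trans h1
  nlinarith

lemma P_eq_exp_mul_P_add (n : ℕ) (u v : EuclideanSpace ℝ (Fin d)) (x : Fin d → ℤ) (k j : Fin N) :
    P p n u x k j = Real.exp (-inner ℝ v (toVec x)) * P p n (u + v) x k j := by
  simp only [P, of_apply]
  rw [inner_add_left, Real.exp_add, Real.exp_neg]
  field_simp

/-- Exponential decay of the rescaled convolution powers, by a change of drift of order `1/√n`. -/
lemma exists_P_le_exp (hN : 0 < N) (hinv : IsLatticeInvariant p) (hirr : IsStronglyIrreducible p)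
    {u₀ : EuclideanSpace ℝ (Fin d)} (hu₀ : u₀ ∈ finiteDomain p) :
    ∃ K : ℝ, 0 < K ∧ ∀ᶠ q : EuclideanSpace ℝ (Fin d) × ℕ in 𝓝 u₀ ×ˢ atTop, q.1 ∈ levelSet p →
      ∀ (x : Fin d → ℤ) (k j : Fin N), (2 * Real.pi * q.2) ^ ((d : ℝ) / 2) * P p q.2 q.1 x k j ≤
        K * Real.exp (-‖displacement p q.2 x q.1‖) := by
  obtain ⟨K, hK, hev⟩ := exists_P_le hN hinv hirr hu₀
  obtain ⟨C, δ₁, hC, hδ₁, hlam⟩ := exists_le_add_fderiv_add_sq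
    ((contDiffAt_lam hN hinv hirr hu₀).of_le (by norm_num))
  obtain ⟨δ₂, hδ₂, hball⟩ := Metric.eventually_nhds_iff_ball.1
    (hev.and (isOpen_interior.eventually_mem hu₀))
  -- Both `u - u₀` and `v` will be shorter than this radius, so halving `δ₂` keeps `u + v` in the
  -- ball of radius `δ₂`.
  have hδ : 0 < min δ₁ (δ₂ / 2) := lt_min hδ₁ (half_pos hδ₂)
  refine ⟨K * Real.exp C, by positivity, ?_⟩
  have hsm := (tendsto_inv_sqrt (n := fun n : ℕ => n) tendsto_id).eventually_lt_const hδ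
  have hnear : ∀ᶠ u in 𝓝 u₀, u ∈ Metric.ball u₀ (min δ₁ (δ₂ / 2)) := Metric.ball_mem_nhds u₀ hδ
  filter_upwards [hnear.prod_inl _, (hsm.and (eventually_ne_atTop 0)).prod_inr _]
    with ⟨u, n⟩ hu ⟨hn, hn0⟩ hH x k j
  simp only at hu hn hn0 hH ⊢
  set w := toVec x - (n : ℝ) • gradient (lam p) u with hw
  -- Tilting by a vector of length `1/√n` along `w` gains `v · w = ‖w‖/√n`, while the quadratic cost
  -- `C n ‖v‖²` stays at most `C`. If `w = 0` then `v = 0` by the convention for the inverse.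
  set v := (Real.sqrt n)⁻¹ • (‖w‖⁻¹ • w) with hv
  have hnpos : (0 : ℝ) < n := by exact_mod_cast Nat.pos_of_ne_zero hn0
  have hvn : ‖v‖ ≤ (Real.sqrt n)⁻¹ := by
    rw [hv, norm_smul, norm_inv, Real.norm_of_nonneg (Real.sqrt_nonneg _), norm_smul, norm_inv,
      norm_norm]
    exact mul_le_of_le_one_right (by positivity) inv_mul_le_one
  have hvw : inner ℝ v w = ‖displacement p n x u‖ := by
    rw [norm_displacement, ← hw, hv, inner_smul_left, inner_smul_left, real_inner_self_eq_norm_sq]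
    rcases eq_or_ne ‖w‖ 0 with h0 | h0
    · simp [h0]
    · simp only [conj_trivial]
      field_simp
  have hu' := mem_ball_iff_norm.1 hu
  have huv : u + v ∈ Metric.ball u₀ δ₂ := by
    rw [mem_ball_iff_norm, add_sub_right_comm]
    have := norm_add_le (u - u₀) v
    have := min_le_right δ₁ (δ₂ / 2)
    linarith
  have h1 := (hball _ huv).1 n hn0 x k j
  have h2 := hlam u v (hu'.trans_le (min_le_left _ _))
    ((hvn.trans_lt hn).trans_le (min_le_left _ _))
  rw [hH.2, ← inner_gradient_lam] at h2
  have hvn2 : n * ‖v‖ ^ 2 ≤ 1 := by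
    have : ‖v‖ ^ 2 ≤ ((Real.sqrt n)⁻¹) ^ 2 := pow_le_pow_left₀ (norm_nonneg _) hvn 2
    rw [inv_pow, Real.sq_sqrt hnpos.le] at this
    calc n * ‖v‖ ^ 2 ≤ n * (n : ℝ)⁻¹ := by gcongr
      _ = 1 := mul_inv_cancel₀ hnpos.ne'
  have h3 : lam p (u + v) ^ n ≤ Real.exp (n * inner ℝ (gradient (lam p) u) v + C) := by
    obtain ⟨-, -, hpos, -⟩ := exists_perron_F hN hinv hirr (finiteAt_of_mem (hball _ huv).2)
    calc lam p (u + v) ^ n ≤ Real.exp (inner ℝ (gradient (lam p) u) v + C * ‖v‖ ^ 2) ^ n := by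
          refine pow_le_pow_left₀ hpos.le (h2.trans ?_) n
          have := Real.add_one_le_exp (inner ℝ (gradient (lam p) u) v + C * ‖v‖ ^ 2)
          linarith
      _ = Real.exp (n * inner ℝ (gradient (lam p) u) v + C * (n * ‖v‖ ^ 2)) := by
          rw [← Real.exp_nat_mul]
          ring_nf
      _ ≤ _ := by
          gcongr
          exact mul_le_of_le_one_right hC hvn2
  have h4 : inner ℝ v w = inner ℝ v (toVec x) - n * inner ℝ (gradient (lam p) u) v := by
    rw [hw, inner_sub_right, inner_smul_right, real_inner_comm v]
  calc (2 * Real.pi * n) ^ ((d : ℝ) / 2) * P p n u x k j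
      = Real.exp (-inner ℝ v (toVec x)) *
        ((2 * Real.pi * n) ^ ((d : ℝ) / 2) * P p n (u + v) x k j) := by
        rw [P_eq_exp_mul_P_add n u v]
        ring
    _ ≤ Real.exp (-inner ℝ v (toVec x)) *
        (K * Real.exp (n * inner ℝ (gradient (lam p) u) v + C)) := by
        exact mul_le_mul_of_nonneg_left (h1.trans (mul_le_mul_of_nonneg_left h3 hK.le))
          (Real.exp_pos _).le
    _ = K * Real.exp C * Real.exp (-‖displacement p n x u‖) := by
        rw [← hvw, h4, mul_left_comm, ← Real.exp_add, mul_assoc, ← Real.exp_add]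
        ring_nf

/-- A uniform lower bound for the quadratic form `Σ_u`. -/
lemma exists_le_Sig (hN : 0 < N) (hinv : IsLatticeInvariant p) (hirr : IsStronglyIrreducible p)
    {u₀ : EuclideanSpace ℝ (Fin d)} (hu₀ : u₀ ∈ finiteDomain p) :
    ∃ c : ℝ, 0 < c ∧ ∀ᶠ u in 𝓝 u₀, u ∈ levelSet p → ∀ y, c * ‖y‖ ^ 2 ≤ Sig p u y := by
  obtain ⟨c, hc, hev⟩ := exists_le_quadForm hN hinv hirr hu₀
  -- For `y = Q z`, `Sig p u y` is the form `Q` at `z`, and `D u` bounds `‖Q z‖²` by `‖z‖²`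
  -- (Euclidean against sup norm), so the lower bound on `Q` transfers to its inverse.
  set D : EuclideanSpace ℝ (Fin d) → ℝ := fun u => ∑ i, (∑ j, |Q p u i j|) ^ 2 with hD
  have hDc : Tendsto D (𝓝 u₀) (𝓝 (D u₀)) := by
    refine tendsto_finsetSum _ fun i _ => Tendsto.pow (tendsto_finsetSum _ fun j _ => ?_) 2
    exact (tendsto_pi_nhds.1 (tendsto_pi_nhds.1 (continuousAt_Q hN hinv hirr hu₀).tendsto i) j).abs
  have hD0 : 0 ≤ D u₀ := by positivity
  refine ⟨c / (D u₀ + 1), by positivity, ?_⟩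
  filter_upwards [hev, hDc.eventually_lt_const (lt_add_one _)] with u h1 h2 hu y
  set z := (Q p u)⁻¹ *ᵥ y.ofLp with hz
  have hQz : Q p u *ᵥ z = y.ofLp := by
    rw [hz, mulVec_mulVec, mul_nonsing_inv _ (isUnit_iff_ne_zero.2 (Q_posDef hN hinv hirr hu).det_pos.ne'),
      one_mulVec]
  have h3 : Sig p u y = z ⬝ᵥ Q p u *ᵥ z := by
    rw [hQz, Sig, dotProduct_comm]
  have h4 : ‖y‖ ^ 2 ≤ D u * ‖z‖ ^ 2 := by
    rw [EuclideanSpace.norm_sq_eq, hD, Finset.sum_mul]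
    refine Finset.sum_le_sum fun i _ => ?_
    rw [← mul_pow]
    refine pow_le_pow_left₀ (norm_nonneg _) ?_ 2
    rw [← hQz, Finset.sum_mul]
    change ‖∑ j, Q p u i j * z j‖ ≤ _
    refine (norm_sum_le _ _).trans (Finset.sum_le_sum fun j _ => ?_)
    rw [norm_mul, Real.norm_eq_abs]
    exact mul_le_mul_of_nonneg_left (norm_le_pi_norm z j) (abs_nonneg _)
  rw [h3]
  refine le_trans ?_ (h1 hu z)
  rw [div_mul_eq_mul_div, div_le_iff₀ (by positivity), mul_assoc]
  refine mul_le_mul_of_nonneg_left (h4.trans ?_) hc.le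
  rw [mul_comm]
  exact mul_le_mul_of_nonneg_left h2.le (sq_nonneg _)

/-- Completing the square: `(c/2) t² ≥ t - 1/(2c)`. The prefactor is continuous in `u`, hence
locally bounded. -/
lemma exists_gaussian_le_exp (hN : 0 < N) (hinv : IsLatticeInvariant p)
    (hirr : IsStronglyIrreducible p) {u₀ : EuclideanSpace ℝ (Fin d)} (hu₀ : u₀ ∈ levelSet p)
    (k j : Fin N) : ∃ K : ℝ, 0 < K ∧ ∀ᶠ u in 𝓝 u₀, u ∈ levelSet p → ∀ y,
      |((Q p u).det ^ (-(1 / 2) : ℝ) * Real.exp (-(1 / 2) * Sig p u y)) *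
        (rightVec p u k * leftVec p u j)| ≤ K * Real.exp (-‖y‖) := by
  obtain ⟨c, hc, hev⟩ := exists_le_Sig hN hinv hirr hu₀.1
  have h1 : Tendsto (fun u => (Q p u).det ^ (-(1 / 2) : ℝ) * (rightVec p u k * leftVec p u j))
      (𝓝 u₀) (𝓝 ((Q p u₀).det ^ (-(1 / 2) : ℝ) * (rightVec p u₀ k * leftVec p u₀ j))) := by
    have h2 : Tendsto (fun u => (Q p u).det) (𝓝 u₀) (𝓝 (Q p u₀).det) :=
      ((continuous_id.matrix_det).tendsto _).comp (continuousAt_Q hN hinv hirr hu₀.1).tendsto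
    exact (h2.rpow_const (Or.inl (Q_posDef hN hinv hirr hu₀).det_pos.ne')).mul
      (tendsto_rightVec_mul_leftVec hN hinv hirr hu₀.1 tendsto_id k j)
  set M := |(Q p u₀).det ^ (-(1 / 2) : ℝ) * (rightVec p u₀ k * leftVec p u₀ j)| + 1 with hM
  refine ⟨M * Real.exp (1 / (2 * c)), by positivity, ?_⟩
  filter_upwards [hev, h1.abs.eventually_lt_const (lt_add_one _)] with u h3 h4 hu y
  rw [mul_right_comm, abs_mul, abs_of_pos (Real.exp_pos _), mul_assoc M, ← Real.exp_add]
  refine mul_le_mul h4.le (Real.exp_le_exp.2 ?_) (Real.exp_pos _).le (by positivity)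
  have h5 := h3 hu y
  have h6 : 0 ≤ c / 2 * (‖y‖ - 1 / c) ^ 2 := by positivity
  have h7 : c / 2 * (‖y‖ - 1 / c) ^ 2 = c / 2 * ‖y‖ ^ 2 - ‖y‖ + 1 / (2 * c) := by
    field_simp
    ring
  linarith

variable {u : ℕ → EuclideanSpace ℝ (Fin d)} {n : ℕ → ℕ} {u₀ : EuclideanSpace ℝ (Fin d)}

lemma exists_abs_A_le_exp (hN : 0 < N) (hinv : IsLatticeInvariant p)
    (hirr : IsStronglyIrreducible p) (hu₀ : u₀ ∈ levelSet p) (hu : Tendsto u atTop (𝓝 u₀))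
    (hH : ∀ m, u m ∈ levelSet p) (hn : Tendsto n atTop atTop) (x : ℕ → Fin d → ℤ) (k j : Fin N) :
    ∃ K : ℝ, 0 < K ∧ ∀ᶠ m in atTop,
      |A p (n m) (x m) (u m) k j| ≤ K * Real.exp (-‖displacement p (n m) (x m) (u m)‖) := by
  obtain ⟨K₁, hK₁, h1⟩ := exists_P_le_exp hN hinv hirr hu₀.1
  obtain ⟨K₂, hK₂, h2⟩ := exists_gaussian_le_exp hN hinv hirr hu₀ k j
  refine ⟨K₁ + K₂, by positivity, ?_⟩
  filter_upwards [(hu.prodMk hn).eventually h1, hu.eventually h2, hn.eventually_ne_atTop 0]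
    with m h3 h4 h5
  rw [A_apply h5, add_mul]
  refine (abs_sub _ _).trans (add_le_add ?_ (h4 (hH m) _))
  rw [abs_of_nonneg]
  · exact h3 (hH m) (x m) k j
  · exact mul_nonneg (by positivity) (mul_nonneg ENNReal.toReal_nonneg (Real.exp_pos _).le)

/-- Uniform in `γ`: for `t ≤ 1` the power is at most `1`, and for `t ≥ 1` the exponent may be raised
to the integer `⌈γ₀⌉`. -/
lemma exists_rpow_mul_exp_le (γ₀ : ℝ) : ∃ B : ℝ, 0 < B ∧
    ∀ γ ∈ Set.Icc 0 γ₀, ∀ t : ℝ, 0 ≤ t → t ^ γ * Real.exp (-(t / 2)) ≤ B := by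
  set M := ⌈γ₀⌉₊ with hM
  refine ⟨1 + 2 ^ M * M.factorial, by positivity, fun γ hγ t ht => ?_⟩
  rcases le_total t 1 with h | h
  · have h1 : t ^ γ ≤ 1 := Real.rpow_le_one ht h hγ.1
    have h2 : Real.exp (-(t / 2)) ≤ 1 := Real.exp_le_one_iff.2 (by linarith)
    have h3 : (0 : ℝ) ≤ 2 ^ M * M.factorial := by positivity
    have := mul_le_one₀ h1 (Real.exp_pos _).le h2
    linarith
  · have h1 : t ^ γ ≤ t ^ M := by
      rw [← Real.rpow_natCast]
      exact Real.rpow_le_rpow_of_exponent_le h (hγ.2.trans (Nat.le_ceil _))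
    have h2 := Real.pow_div_factorial_le_exp (t / 2) (by positivity) M
    rw [div_pow, div_div, div_le_iff₀ (by positivity)] at h2
    calc t ^ γ * Real.exp (-(t / 2))
        ≤ (Real.exp (t / 2) * (2 ^ M * M.factorial)) * Real.exp (-(t / 2)) := by
          gcongr
          exact h1.trans h2
      _ = 2 ^ M * M.factorial := by
          rw [mul_right_comm, ← Real.exp_add, add_neg_cancel, Real.exp_zero, one_mul]
      _ ≤ _ := by linarith

/-- The weighted local limit theorem along sequences. -/
lemma tendsto_Atilde (hN : 0 < N) (hinv : IsLatticeInvariant p)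
    (hirr : IsStronglyIrreducible p) {γ₀ : ℝ} (hu₀ : u₀ ∈ levelSet p)
    (hu : Tendsto u atTop (𝓝 u₀)) (hH : ∀ m, u m ∈ levelSet p) (hn : Tendsto n atTop atTop)
    (x : ℕ → Fin d → ℤ) {γ : ℕ → ℝ} (hγ : ∀ m, γ m ∈ Set.Icc 0 γ₀) (k j : Fin N) :
    Tendsto (fun m => Atilde p (n m) (x m) (u m) (γ m) k j) atTop (𝓝 0) := by
  obtain ⟨K, hK, h1⟩ := exists_abs_A_le_exp hN hinv hirr hu₀ hu hH hn x k j
  obtain ⟨B, hB, h2⟩ := exists_rpow_mul_exp_le γ₀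
  have h3 := ((tendsto_A hN hinv hirr hu₀ hu hH hn x k j).abs.sqrt).const_mul (B * Real.sqrt K)
  rw [abs_zero, Real.sqrt_zero, mul_zero] at h3
  refine squeeze_zero_norm' ?_ h3
  filter_upwards [h1] with m hm
  set t := ‖displacement p (n m) (x m) (u m)‖ with ht
  set a := |A p (n m) (x m) (u m) k j| with ha
  have ht0 : 0 ≤ t := norm_nonneg _
  have h4 : Atilde p (n m) (x m) (u m) (γ m) k j = t ^ γ m * A p (n m) (x m) (u m) k j := by
    rw [ht, norm_displacement]
    rfl
  -- Half of the exponential decay is kept in one factor `√a`, enough to absorb the weight; the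
  -- other `√a` tends to `0` by the unweighted theorem.
  have h5 : Real.sqrt a ≤ Real.sqrt K * Real.exp (-(t / 2)) := by
    refine (Real.sqrt_le_sqrt hm).trans_eq ?_
    rw [Real.sqrt_mul hK.le, ← Real.exp_half, neg_div]
  rw [h4, norm_mul, Real.norm_of_nonneg (Real.rpow_nonneg ht0 _), Real.norm_eq_abs, ← ha]
  calc t ^ γ m * a = t ^ γ m * (Real.sqrt a * Real.sqrt a) := by
        rw [Real.mul_self_sqrt (abs_nonneg _)]
    _ ≤ t ^ γ m * (Real.sqrt K * Real.exp (-(t / 2)) * Real.sqrt a) := by gcongr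
    _ = (t ^ γ m * Real.exp (-(t / 2))) * Real.sqrt K * Real.sqrt a := by ring
    _ ≤ B * Real.sqrt K * Real.sqrt a := by
        gcongr
        exact h2 _ (hγ m) t ht0

/-- Counterexamples for each threshold would form a sequence with `n → ∞`; along a subsequence where
`u` converges in `K`, it contradicts `tendsto_Atilde`. -/
lemma exists_forall_abs_Atilde_lt (hN : 0 < N) (hinv : IsLatticeInvariant p)
    (hirr : IsStronglyIrreducible p) {γ₀ : ℝ}
    {K : Set (EuclideanSpace ℝ (Fin d))} (hK : IsCompact K) (hKH : K ⊆ levelSet p) {ε : ℝ}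
    (hε : 0 < ε) : ∃ n₀ : ℕ, ∀ n ≥ n₀, ∀ (x : Fin d → ℤ), ∀ u ∈ K, ∀ γ ∈ Set.Icc 0 γ₀,
      ∀ k j : Fin N, |Atilde p n x u γ k j| < ε := by
  by_contra! hcon
  choose n hn x u hu γ hγ k j hkj using hcon
  obtain ⟨u₀, hu₀, φ, hφ, hlim⟩ := hK.tendsto_subseq hu
  have hnφ : Tendsto (n ∘ φ) atTop atTop :=
    tendsto_atTop_mono (fun m => (hφ.id_le m).trans (hn (φ m))) tendsto_id
  have h1 : ∀ᶠ m in atTop, ∀ k' j' : Fin N,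
      |Atilde p (n (φ m)) (x (φ m)) (u (φ m)) (γ (φ m)) k' j'| < ε :=
    eventually_all.2 fun k' => eventually_all.2 fun j' => by
      have h2 := (tendsto_Atilde hN hinv hirr (hKH hu₀) hlim (fun m => hKH (hu (φ m))) hnφ
        (fun m => x (φ m)) (fun m => hγ (φ m)) k' j').abs
      rw [abs_zero] at h2
      exact h2.eventually_lt_const hε
  obtain ⟨m, hm⟩ := h1.exists
  exact absurd (hm (k (φ m)) (j (φ m))) (not_lt.2 (hkj (φ m)))

end Tail

end ThickenedLattice

end

theorem proposition3p9 (d N : ℕ) (hN : 0 < N) (p : TransitionKernel d N)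
    (hinv : IsLatticeInvariant p) (hirr : IsStronglyIrreducible p) (γ₀ : ℝ) (hγ₀ : 0 ≤ γ₀) :
    -- the objects that enter the estimate are well defined
    (∀ u ∈ finiteDomain p,
      IsDominantEigenvalue ((F p u).map (fun a : ℝ => (a : ℂ))) (lam p u : ℂ)) ∧
    (∀ u ∈ levelSet p,
      DifferentiableAt ℝ (lam p) u ∧
      (∀ k, 0 < rightVec p u k) ∧ (F p u).mulVec (rightVec p u) = rightVec p u ∧
      (∀ k, 0 < leftVec p u k) ∧ Matrix.vecMul (leftVec p u) (F p u) = leftVec p u ∧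
      nuZero p ⬝ᵥ rightVec p u = 1 ∧ leftVec p u ⬝ᵥ rightVec p u = 1 ∧
      (∀ᶠ ξ in 𝓝 0, IsDominantEigenvalue (chi p u ξ) (charLam p u ξ)) ∧
      ContDiffAt ℝ 2 (charLam p u) 0 ∧
      (∀ i j, charHess p u i j = -(Q p u i j : ℂ)) ∧ (Q p u).PosDef) ∧
    -- pointwise convergence
    (∀ (x : Fin d → ℤ), ∀ u ∈ levelSet p, ∀ γ ∈ Set.Icc 0 γ₀,
      Tendsto (fun n : ℕ => Atilde p n x u γ) atTop (𝓝 0)) ∧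
    -- uniform convergence
    (∀ K : Set (EuclideanSpace ℝ (Fin d)), IsCompact K → K ⊆ levelSet p →
      ∀ ε > 0, ∃ n₀ : ℕ, ∀ n ≥ n₀, ∀ (x : Fin d → ℤ), ∀ u ∈ K, ∀ γ ∈ Set.Icc 0 γ₀,
        ∀ k j : Fin N, |Atilde p n x u γ k j| < ε) := by
  refine ⟨fun u hu => ?_, fun u hu => ?_, fun x u hu γ hγ => ?_, fun K hK hKH ε hε =>
    exists_forall_abs_Atilde_lt hN hinv hirr hK hKH hε⟩
  · obtain ⟨v, w, -, -, -, -, -, -, hgap⟩ := exists_perron_F hN hinv hirr (finiteAt_of_mem hu)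
    exact hgap.isDominantEigenvalue
  · have hfin := finiteAt_of_mem hu.1
    obtain ⟨hR, hFR, hnR⟩ := rightVec_spec hN hinv hirr hfin
    obtain ⟨hL, hLF, hLR⟩ := leftVec_spec hN hinv hirr hfin
    rw [hu.2, one_smul] at hFR hLF
    exact ⟨(contDiffAt_lam hN hinv hirr hu.1).differentiableAt (by norm_num), hR, hFR, hL, hLF,
      hnR, hLR, (((Continuous.prodMk_right u).tendsto 0).eventually
        (eventually_charLam hN hinv hirr hu.1)).mono fun ξ hξ => hξ.2,
      ContDiffAt.comp (f := fun ξ : EuclideanSpace ℝ (Fin d) => (u, ξ)) 0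
        (contDiffAt_charLam hN hinv hirr hu.1) (contDiff_prodMk_right u).contDiffAt,
      charHess_eq_neg_Q hN hinv hirr hu.1, Q_posDef hN hinv hirr hu⟩
  · refine tendsto_pi_nhds.2 fun k => tendsto_pi_nhds.2 fun j => ?_
    -- The pointwise statement is the case of constant sequences `u`, `x`, `γ`.
    exact tendsto_Atilde hN hinv hirr (u := fun _ => u) hu tendsto_const_nhds (fun _ => hu)
      tendsto_id (fun _ => x) (fun _ => hγ) k j
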